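/- Let $n\ge 0$ be an integer. Let $X$ be the complex vector space with basis $t^je_i$ ($1\le i\le n$, $j\in\mathbb Z$), let $t$ be the operator $t^je_i\mapsto t^{j+1}e_i$, let $X_0=\langle t^je_i: j\ge 0\rangle$, let $V_i=\langle t^je_i : j\in\mathbb Z\rangle$ (the $i$-th column), and for $a\le b$ put $V_{[a,b]}=V_a\oplus\dots\oplus V_b$ (and $V_{[a,b]}=0$ if $a>b$). A *lattice* is a subspace $Y\subset X$ with $tY\subseteq Y$ and $t^NX_0\subseteq Y\subseteq t^{-N}X_0$ for some $N\ge 0$. The set $\mathcal G$ of lattices is the loop Grassmannian of $GL_n$. The set $\mathcal G_N$ of the $Y$ with $t^NX_0\subseteq Y\subseteq t^{-N}X_0$ has the Zariski topology of a closed subvariety of the disjoint union over $k$ of the Grassmannians of $k$-planes in $t^{-N}X_0/t^NX_0$. A subset of $\mathcal G$ is Zariski open if its intersection with every $\mathcal G_N$ is open, and subsets of $\mathcal G$ carry the induced topology. For a lattice $Y$ let $Y_0$ be the span of all $t^je_i\in Y$ and let $\delta_i(Y)$ be the largest $j$ with $t^{-j}e_i\in Y$. A *loop* $L$ is given by columns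 $\ell<r$, its left and right ends; it passes through the columns $\ell,\dots,r$, and $V_L=V_{[\ell,r]}$. A *Kostant picture* $\mathbf p$ is a finite multiset of loops. We write $L\subset L'$ ($L'$ encircles $L$) if $[\ell_L,r_L]\subsetneq[\ell_{L'},r_{L'}]$; equal loops of $\mathbf p$ are ordered linearly in an arbitrary way, and $\subset$ holds along this order. The Kostant picture $\mathbf p(Y)$ of a lattice $Y$ contains the loop with ends $\ell<r$ exactly $$\dim\Big((Y\cap V_{[\ell,r]})\big/\big((Y\cap V_{[\ell+1,r]})+(Y\cap V_{[\ell,r-1]})\big)\Big)$$ times, and $\lambda(Y)_i=\delta_i(Y)+\#\{L\in\mathbf p(Y):\text{the left end of }L\text{ is }i\}$. For a Kostant picture $\mathbf p$ and $\lambda\in\mathbb Z^n$ let $M(\mathbf p,\lambda)=\{Y\in\mathcal G:\mathbf p(Y)=\mathbf p,\ \lambda(Y)=\lambda\}$. *Compatible.* A lattice $Y$ is compatible to $\mathbf p$ if there are linearly independent vectors $y_L\in V_L$ ($L\in\mathbf p$) with $Y=Y_0\oplus\langle y_L\rangle_{L\in\mathbf p}$ and $t\,y_L\in Y_0\oplus\langle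 y_{L'}\rangle_{L'\subset L}$ for all $L$, such that, with $Y_L=(Y_0\cap V_L)\oplus\langle y_{L'}\rangle_{L'\subseteq L}$ and $Y_L^\circ=(Y_0\cap V_L)+\sum_{L'\subset L}Y_{L'}$, the projections of $Y_L$ and $Y_L^\circ$ to $V_i$ differ for every $L\in\mathbf p$ and every column $i$ that $L$ passes through. Let $M^\dagger(\mathbf p,\lambda)$ be the set of $Y\in M(\mathbf p,\lambda)$ that are compatible to $\mathbf p$. *Collapse.* Let $i$ be a column and $\mathbf q$ the set of loops of $\mathbf p$ passing through $i$. A loop of $\mathbf q$ has level $1$ if it encircles no loop of $\mathbf q$, and level $k+1$ if it is not of level $\le k$ and all loops of $\mathbf q$ that it encircles have level $\le k$. The loops of one level do not encircle each other, so they are ordered from left to right as $L_1,\dots,L_m$; replace them by the $m-1$ joins of neighbours, the join of $L_j$ and $L_{j+1}$ having the left end of $L_j$ and the right end of $L_{j+1}$. Do this for each level, keep the loops of $\mathbf p$ outside $\mathbf q$, then delete column $i$ and renumber the other columns. The result is the Kostant picture $\hat{\mathbf p}_i$ on $n-1$ columns. For a lattice $Y$ let $\hat Y_i=Y\cap\bigoplus_{j\ne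 i}V_j$, regarded as a lattice on the $n-1$ remaining, renumbered, columns. *Strongly compatible.* If $n\le 2$, $Y$ is strongly compatible to $\mathbf p$ if it is compatible to $\mathbf p$. If $n>2$, $Y$ is strongly compatible to $\mathbf p$ if it is compatible to $\mathbf p$ and $\hat Y_i$ is strongly compatible to $\hat{\mathbf p}_i$ for every column $i$. Let $M^\ddagger(\mathbf p,\lambda)$ be the set of $Y\in M^\dagger(\mathbf p,\lambda)$ that are strongly compatible to $\mathbf p$. **Proposition.** For every Kostant picture $\mathbf p$ and every $\lambda\in\mathbb Z^n$, $M^\ddagger(\mathbf p,\lambda)$ is a dense Zariski-open subset of $M^\dagger(\mathbf p,\lambda)$; moreover $M^\ddagger(\mathbf p,\lambda)$ is nonempty. -/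

import Mathlib

open LaurentPolynomial

noncomputable section

namespace LoopGrassmannian

/-! ### The lattice model of the loop Grassmannian of `GL_n` -/

/-- The space `X` with basis `t^j e_i`, `i : Fin n`, `j : ℤ`; a vector is recorded by its `n` columns,
each of which is a Laurent polynomial in `t`. -/
abbrev X (n : ℕ) : Type := Fin n → LaurentPolynomial ℂ

/-- The basis vector `t^j e_i`. -/
def tvec {n : ℕ} (i : Fin n) (j : ℤ) : X n := Pi.single i (T j)

/-- `t^N X_0`: the span of the `t^j e_i` with `j ≥ N`. -/
def tX₀ (n : ℕ) (N : ℤ) : Submodule ℂ (X n) :=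
  Submodule.span ℂ {x | ∃ (i : Fin n) (j : ℤ), N ≤ j ∧ x = tvec i j}

/-- A lattice: a subspace `Y` of `X`, closed under `t`, with `t^N X_0 ⊆ Y ⊆ t^{-N} X_0` for
some `N`. The type `Lat n` is the set of points of the loop Grassmannian of `GL_n`. -/
@[ext]
structure Lat (n : ℕ) where
  space : Submodule ℂ (X n)
  t_mem : ∀ y ∈ space, (T 1 : LaurentPolynomial ℂ) • y ∈ space
  bounded : ∃ N : ℕ, tX₀ n N ≤ space ∧ space ≤ tX₀ n (-(N : ℤ))

variable {n : ℕ}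

/-- `Y_0`: the span of all the basis vectors `t^j e_i` that lie in `Y`. -/
def Lat.zeroPart (Y : Lat n) : Submodule ℂ (X n) :=
  Submodule.span ℂ {x | ∃ (i : Fin n) (j : ℤ), tvec i j ∈ Y.space ∧ x = tvec i j}

/-- `δ_i(Y)`: the largest `j` with `t^{-j} e_i ∈ Y`. (For a lattice the set is nonempty and
bounded above, so that the supremum is its maximum.) -/
def Lat.delta (Y : Lat n) (i : Fin n) : ℤ := sSup {j : ℤ | tvec i (-j) ∈ Y.space}

/-- The sum of the columns `V_a, V_{a+1}, …, V_b` of `X` (zero if `a > b`). -/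
def cols (n a b : ℕ) : Submodule ℂ (X n) where
  carrier := {x | ∀ k : Fin n, ¬ (a ≤ (k : ℕ) ∧ (k : ℕ) ≤ b) → x k = 0}
  zero_mem' := fun _ _ => rfl
  add_mem' := fun {x y} hx hy k hk => by simp [hx k hk, hy k hk]
  smul_mem' := fun c x hx k hk => by simp [hx k hk]

/-- The projection to the `i`-th column, `V_i` being identified with the Laurent polynomials. -/
def Proj (i : Fin n) (W : Submodule ℂ (X n)) : Submodule ℂ (LaurentPolynomial ℂ) :=
  W.map (LinearMap.proj i : X n →ₗ[ℂ] LaurentPolynomial ℂ)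

/-! ### Kostant pictures -/

/-- A positive root of type `A_{n-1}`: a block of consecutive dots of the Dynkin diagram, given by
the leftmost and the rightmost column that a loop around these dots passes through. -/
@[ext]
structure Root (n : ℕ) where
  left : Fin n
  right : Fin n
  lt : left < right

/-- A Kostant picture: the number of loops around each block of dots. -/
abbrev KostantPicture (n : ℕ) : Type := Root n → ℕ

/-- The loops of a Kostant picture. Loops around the same dots are numbered from the inside to
the outside. -/
structure KLoop (p : KostantPicture n) where
  root : Root n
  idx : Fin (p root)

/-- The loop passes through column `i`. -/
def KLoop.Passes {p : KostantPicture n} (L : KLoop p) (i : Fin n) : Prop :=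
  L.root.left ≤ i ∧ i ≤ L.root.right

/-- `L.Inside L'`: the loop `L` is encircled by the loop `L'`. -/
def KLoop.Inside {p : KostantPicture n} (L L' : KLoop p) : Prop :=
  (L.root ≠ L'.root ∧ L'.root.left ≤ L.root.left ∧ L.root.right ≤ L'.root.right) ∨
    (L.root = L'.root ∧ (L.idx : ℕ) < (L'.idx : ℕ))

/-- `V_L`: the sum of the columns that the loop passes through. -/
def KLoop.V {p : KostantPicture n} (L : KLoop p) : Submodule ℂ (X n) :=
  cols n L.root.left L.root.right

/-- `UpToLevel p i k L`: the loop `L` passes through column `i`, and its level among the loops of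
`p` passing through column `i` is at most `k`. No loop has level `0`; a loop has level at most
`k + 1` if all the loops through column `i` that it encircles have level at most `k`. -/
def UpToLevel (p : KostantPicture n) (i : Fin n) : ℕ → KLoop p → Prop
  | 0, _ => False
  | k + 1, L => L.Passes i ∧ ∀ L' : KLoop p, L'.Passes i → L'.Inside L → UpToLevel p i k L'

/-- The loop `L` passes through column `i` and has level `k + 1` among the loops that do. -/
def HasLevel (p : KostantPicture n) (i : Fin n) (k : ℕ) (L : KLoop p) : Prop :=
  UpToLevel p i (k + 1) L ∧ ¬ UpToLevel p i k L

/-- `L` and `L'` are neighbours in the left-to-right order of some level at column `i`. -/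
def Consecutive (p : KostantPicture n) (i : Fin n) (L L' : KLoop p) : Prop :=
  ∃ k : ℕ, HasLevel p i k L ∧ HasLevel p i k L' ∧ L.root.left < L'.root.left ∧
    ¬ ∃ L'' : KLoop p, HasLevel p i k L'' ∧
      L.root.left < L''.root.left ∧ L''.root.left < L'.root.left

/-- The collapse of `p` along column `i`. Its loops are the loops of `p` that do not pass through
column `i`, and the joins of consecutive loops of the same level; `i.succAbove` turns the numbers
of the columns after the removal of column `i` into the original ones. -/
def KostantPicture.collapse (p : KostantPicture (n + 1)) (i : Fin (n + 1)) : KostantPicture n :=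
  fun R =>
    Nat.card {L : KLoop p // ¬ L.Passes i ∧
      L.root.left = i.succAbove R.left ∧ L.root.right = i.succAbove R.right} +
    Nat.card {q : KLoop p × KLoop p // Consecutive p i q.1 q.2 ∧
      q.1.root.left = i.succAbove R.left ∧ q.2.root.right = i.succAbove R.right}

/-! ### The pieces `M(p, λ)` -/

/-- `p(Y)`: the number of loops around the dots between the columns `ℓ < r` is the dimension of
`(Y ∩ V_{ℓ..r}) / ((Y ∩ V_{ℓ+1..r}) + (Y ∩ V_{ℓ..r-1}))`. -/
def Lat.picture (Y : Lat n) : KostantPicture n := fun R =>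
  Module.finrank ℂ
    (↥(Y.space ⊓ cols n R.left R.right) ⧸
      ((Y.space ⊓ cols n (R.left + 1) R.right) ⊔
        (Y.space ⊓ cols n R.left (R.right - 1))).submoduleOf
          (Y.space ⊓ cols n R.left R.right))

/-- The number of loops of `p` with left end at column `i`. -/
def KostantPicture.leftEnds (p : KostantPicture n) (i : Fin n) : ℕ :=
  Nat.card {L : KLoop p // L.root.left = i}

/-- `λ(Y)`. -/
def Lat.coweight (Y : Lat n) : Fin n → ℤ := fun i => Y.delta i + (Y.picture.leftEnds i : ℤ)

/-- `M(p, λ)`. -/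
def M (p : KostantPicture n) (lam : Fin n → ℤ) : Set (Lat n) :=
  {Y | Y.picture = p ∧ Y.coweight = lam}

/-! ### Compatibility -/

/-- The family `y`, indexed by the loops of `p`, is a basis of `Y` that generates a `p`-flag. -/
structure IsFlagBasis (p : KostantPicture n) (Y : Lat n) (y : KLoop p → X n) : Prop where
  linearIndependent : LinearIndependent ℂ y
  disjoint : Disjoint Y.zeroPart (Submodule.span ℂ (Set.range y))
  sup_eq : Y.zeroPart ⊔ Submodule.span ℂ (Set.range y) = Y.space
  mem_V : ∀ L, y L ∈ L.V
  t_smul_mem : ∀ L, (T 1 : LaurentPolynomial ℂ) • y L ∈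
    Y.zeroPart ⊔ Submodule.span ℂ (y '' {L' | L'.Inside L})

/-- The member `Y_L` of the `p`-flag generated by `y`. -/
def flag (p : KostantPicture n) (Y : Lat n) (y : KLoop p → X n) (L : KLoop p) :
    Submodule ℂ (X n) :=
  (Y.zeroPart ⊓ L.V) ⊔ Submodule.span ℂ (y '' {L' | L'.Inside L ∨ L' = L})

/-- `Y_L°`: the sum of `Y_0 ∩ V_L` and of the `Y_{L'}` for the loops `L'` encircled by `L`. -/
def flagInner (p : KostantPicture n) (Y : Lat n) (y : KLoop p → X n) (L : KLoop p) :
    Submodule ℂ (X n) :=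
  (⨆ (L' : KLoop p) (_ : L'.Inside L), flag p Y y L') ⊔ (Y.zeroPart ⊓ L.V)

/-- The lattice `Y` is compatible to the Kostant picture `p`. -/
def Compatible (p : KostantPicture n) (Y : Lat n) : Prop :=
  ∃ y : KLoop p → X n, IsFlagBasis p Y y ∧
    ∀ (L : KLoop p) (i : Fin n), L.Passes i →
      Proj i (flag p Y y L) ≠ Proj i (flagInner p Y y L)

/-- The linear map that forgets column `i` and renumbers the other ones. -/
def dropCol (i : Fin (n + 1)) : X (n + 1) →ₗ[ℂ] X n :=
  LinearMap.funLeft ℂ (LaurentPolynomial ℂ) i.succAbove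

/-- The `i`-th column of the vectors in `W` vanishes. -/
def colZero (i : Fin n) : Submodule ℂ (X n) :=
  LinearMap.ker (LinearMap.proj i : X n →ₗ[ℂ] LaurentPolynomial ℂ)

lemma dropCol_succAbove (i : Fin (n + 1)) (k : Fin n) (j : ℤ) :
    dropCol i (tvec (i.succAbove k) j) = tvec k j := by
  ext m : 1
  by_cases h : m = k
  · subst h; simp [dropCol, tvec, LinearMap.funLeft_apply]
  · have h' : i.succAbove m ≠ i.succAbove k := fun e => h (Fin.succAbove_right_injective e)
    simp [dropCol, tvec, LinearMap.funLeft_apply, h, h']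

lemma dropCol_self (i : Fin (n + 1)) (j : ℤ) : dropCol i (tvec i j) = 0 := by
  ext m : 1
  simp [dropCol, tvec, LinearMap.funLeft_apply]

lemma dropCol_tX₀ (i : Fin (n + 1)) (N : ℤ) : (tX₀ (n + 1) N).map (dropCol i) ≤ tX₀ n N := by
  unfold tX₀
  rw [Submodule.map_span_le]
  rintro _ ⟨k, j, hj, rfl⟩
  rcases Fin.eq_self_or_eq_succAbove i k with rfl | ⟨m, rfl⟩
  · rw [dropCol_self]; exact zero_mem _
  · rw [dropCol_succAbove]; exact Submodule.subset_span ⟨m, j, hj, rfl⟩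

/-- The collapse of the lattice `Y` along column `i`: the intersection of `Y` with the sum of all
the columns other than `i`, these columns being renumbered. -/
def Lat.collapse (Y : Lat (n + 1)) (i : Fin (n + 1)) : Lat n where
  space := (Y.space ⊓ colZero i).map (dropCol i)
  t_mem := by
    rintro _ ⟨x, ⟨hx, hx0⟩, rfl⟩
    refine ⟨(T 1 : LaurentPolynomial ℂ) • x, ⟨Y.t_mem x hx, ?_⟩, ?_⟩
    · have h0 : x i = 0 := by simpa [colZero] using hx0
      simp [colZero, h0]
    · ext m : 1
      simp [dropCol, LinearMap.funLeft_apply]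
  bounded := by
    obtain ⟨N, h1, h2⟩ := Y.bounded
    refine ⟨N, ?_, ?_⟩
    · conv_lhs => unfold tX₀
      rw [Submodule.span_le]
      rintro _ ⟨k, j, hj, rfl⟩
      refine ⟨tvec (i.succAbove k) j, ⟨h1 (Submodule.subset_span ⟨_, j, hj, rfl⟩), ?_⟩,
        dropCol_succAbove i k j⟩
      simp [colZero, tvec]
    · exact (Submodule.map_mono (inf_le_left.trans h2)).trans (dropCol_tX₀ i _)

/-- The lattice `Y` is strongly compatible to `p`; by recursion on the number of columns. -/
def StronglyCompatible : (n : ℕ) → KostantPicture n → Lat n → Prop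
  | 0, p, Y => Compatible p Y
  | 1, p, Y => Compatible p Y
  | 2, p, Y => Compatible p Y
  | n + 3, p, Y => Compatible p Y ∧
      ∀ i : Fin (n + 3), StronglyCompatible (n + 2) (p.collapse i) (Y.collapse i)

/-- `M^†(p, λ)`. -/
def MDagger (p : KostantPicture n) (lam : Fin n → ℤ) : Set (Lat n) :=
  {Y | Y ∈ M p lam ∧ Compatible p Y}

/-- `M^‡(p, λ)`. -/
def MDDagger (p : KostantPicture n) (lam : Fin n → ℤ) : Set (Lat n) :=
  {Y | Y ∈ MDagger p lam ∧ StronglyCompatible n p Y}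

/-! ### The Zariski topology of the loop Grassmannian -/

/-- Labels of the basis vectors `t^j e_i`, `-N ≤ j < N`, of `t^{-N} X_0 / t^N X_0`. -/
abbrev Box (n N : ℕ) : Type := Fin n × ↥(Finset.Ico (-(N : ℤ)) (N : ℤ))

/-- The preimage in `t^{-N} X_0` of the row space of `A` in `t^{-N} X_0 / t^N X_0`. -/
def rowLattice {k : ℕ} (N : ℕ) (A : Matrix (Fin k) (Box n N) ℂ) : Submodule ℂ (X n) :=
  Submodule.span ℂ (Set.range fun a : Fin k => ∑ b : Box n N, A a b • tvec b.1 (b.2 : ℤ)) ⊔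
    tX₀ n N

/-- The lattices `Y` with `t^N X_0 ⊆ Y ⊆ t^{-N} X_0` and `dim (Y / t^N X_0) = k` at whose
Plücker coordinates, in the Grassmannian of `k`-planes in `t^{-N} X_0 / t^N X_0`, the polynomial
`f` does not vanish. The Plücker coordinates are the `k × k` minors of a matrix whose rows are a
basis of `Y / t^N X_0`; they are indexed by all maps from `Fin k` to the set of columns. For
homogeneous `f` the choice of the matrix does not matter. -/
def pluckerOpen (n N k : ℕ) (f : MvPolynomial (Fin k → Box n N) ℂ) : Set (Lat n) :=
  {Y | ∃ A : Matrix (Fin k) (Box n N) ℂ, LinearIndependent ℂ A.row ∧ Y.space = rowLattice N A ∧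
    MvPolynomial.eval (fun c : Fin k → Box n N => (A.submatrix id c).det) f ≠ 0}

/-- The lattices with `t^N X_0 ⊆ Y ⊆ t^{-N} X_0`. -/
abbrev BoundedLat (n N : ℕ) : Type :=
  {Y : Lat n // tX₀ n N ≤ Y.space ∧ Y.space ≤ tX₀ n (-(N : ℤ))}

/-- The Zariski topology on `BoundedLat n N`, a closed subvariety of the disjoint union of
the Grassmannians of `t^{-N} X_0 / t^N X_0`. -/
abbrev boundedZariski (n N : ℕ) : TopologicalSpace (BoundedLat n N) :=
  TopologicalSpace.generateFrom {U | ∃ (k d : ℕ) (f : MvPolynomial (Fin k → Box n N) ℂ),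
    f.IsHomogeneous d ∧ U = Subtype.val ⁻¹' pluckerOpen n N k f}

/-- The Zariski topology of the loop Grassmannian, the increasing union of the projective varieties
`BoundedLat n N`: a set is open if its intersection with each of these is open. -/
instance zariski (n : ℕ) : TopologicalSpace (Lat n) :=
  ⨆ N : ℕ, TopologicalSpace.coinduced (Subtype.val : BoundedLat n N → Lat n) (boundedZariski n N)

end LoopGrassmannian

end

/-! Modulo `Y_0` a column becomes `ℂ[X]` with `t` acting by the shift `dX`, and a lattice becomes a
finite-dimensional `tau`-stable subspace `W` of `P n`, its `model`. The argument runs on the numbers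
`D W S = dim (W ∩ V_S)` for arbitrary sets `S` of columns. It rests on the fact that the
finite-dimensional stable subspaces of one column form a chain, so that a projection to a column is
known from its dimension alone.

Compatibility is numerical (`compatible_iff_D`): for every block of columns, `D` is the number `cnt`
of loops contained in it, and omitting a column `i` from the block lowers `D` by the number
`maxLevel` of levels at `i`. The collapse of a picture replaces `m` loops of one level by `m - 1`,
so it loses one loop per level, the same amount (`cnt_collapse`). Hence the collapses of a
compatible lattice automatically have the right dimensions on blocks. By induction on `n`, strong
compatibility determines every `D W S`, and a compatible lattice whose dimensions nowhere exceed
these values is strongly compatible (`mem_MDDagger_iff`). Openness is then semicontinuity: an upper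
bound on the dimension of the intersection with a coordinate subspace is the nonvanishing of some
Plücker coordinate.

For existence, a matrix of real polynomials is built whose flag minors on intervals of columns are
powers of `X` with exponents `cnt`. The three-term relation, in which positive lowest coefficients
cannot cancel, gives the orders of all other flag minors. These orders bound the dimensions `D` of
the common kernel `star` from above, and the chain property gives the opposite bound
(`star_goodMinor`). So the dimensions satisfy the tropical three-term relation, which is the
recursion defining `maxLevel` and passes to collapses; therefore the lattice `genericLat` is
strongly compatible.

For density, flag bases are parametrised by a nilpotent matrix `C`, recording `t`, and a matrix `a`
of constant coefficients, subject to linear conditions. The line joining the data of a given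
compatible lattice to those of `genericLat` consists of compatible lattices except for finitely many
parameters. An open set that contains the lattice of one good parameter contains those of all but
finitely many good ones (`finite_notMem_of_isOpen`), so any neighbourhood of the given lattice meets
the strongly compatible locus. -/

open LaurentPolynomial

noncomputable section

namespace LoopGrassmannian

section

/-! ### Vectors of polynomials with the truncated multiplication by `t` -/

/-- One column modulo its part in `Y_0`: the coefficient of `X ^ k` belongs to the `k+1`-st basis
vector of the column outside of `Y_0`. -/
abbrev E : Type := Polynomial ℂ

/-- The columns modulo `Y_0`. -/
abbrev P (n : ℕ) : Type := Fin n → E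

/-- The operator `t` on a column modulo its part in `Y_0`. -/
def dX : E →ₗ[ℂ] E where
  toFun := Polynomial.divX
  map_add' _ _ := Polynomial.divX_add
  map_smul' c p := by ext; simp [Polynomial.coeff_divX]

@[simp] lemma coeff_dX (p : E) (k : ℕ) : (dX p).coeff k = p.coeff (k + 1) := Polynomial.coeff_divX

lemma coeff_dX_pow (p : E) (j k : ℕ) : ((dX ^ j) p).coeff k = p.coeff (k + j) := by
  induction j generalizing p with
  | zero => simp
  | succ j ih => rw [pow_succ, Module.End.mul_apply, ih, coeff_dX]; congr 1

/-- The operator `t` on the columns modulo `Y_0`. -/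
def tau {n : ℕ} : P n →ₗ[ℂ] P n := LinearMap.pi fun i => dX ∘ₗ LinearMap.proj i

@[simp] lemma tau_apply {n : ℕ} (x : P n) (i : Fin n) : tau x i = dX (x i) := rfl

lemma tau_pow_apply {n : ℕ} (x : P n) (i : Fin n) (k : ℕ) : (tau ^ k) x i = (dX ^ k) (x i) := by
  induction k generalizing x with
  | zero => simp
  | succ k ih => rw [pow_succ, Module.End.mul_apply, ih, pow_succ, Module.End.mul_apply, tau_apply]

/-- The projection to a column. -/
abbrev pr {n : ℕ} (i : Fin n) : P n →ₗ[ℂ] E := LinearMap.proj i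

variable {n : ℕ}

/-- The vectors supported on the columns in `S`. -/
def VS (S : Set (Fin n)) : Submodule ℂ (P n) where
  carrier := {x | ∀ k, k ∉ S → x k = 0}
  zero_mem' := fun _ _ => rfl
  add_mem' := fun {x y} hx hy k hk => by simp [hx k hk, hy k hk]
  smul_mem' := fun c x hx k hk => by simp [hx k hk]

lemma mem_VS {S : Set (Fin n)} {x : P n} : x ∈ VS S ↔ ∀ k, k ∉ S → x k = 0 := Iff.rfl

lemma VS_mono {S S' : Set (Fin n)} (h : S ⊆ S') : VS S ≤ VS S' :=
  fun _ hx k hk => hx k fun hk' => hk (h hk')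

lemma VS_inf (S S' : Set (Fin n)) : VS S ⊓ VS S' = VS (S ∩ S') := by
  ext x
  simp only [Submodule.mem_inf, mem_VS]
  constructor
  · rintro ⟨h1, h2⟩ k hk
    by_cases h : k ∈ S
    · exact h2 k fun h' => hk ⟨h, h'⟩
    · exact h1 k h
  · exact fun h => ⟨fun k hk => h k fun h' => hk h'.1, fun k hk => h k fun h' => hk h'.2⟩

@[simp] lemma VS_empty : VS (∅ : Set (Fin n)) = ⊥ := by
  rw [eq_bot_iff]
  intro x hx
  ext1 k
  exact hx k (by simp)

@[simp] lemma VS_univ : VS (Set.univ : Set (Fin n)) = ⊤ := by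
  rw [eq_top_iff]
  intro x _ k hk
  simp at hk

lemma tau_mem_VS {S : Set (Fin n)} {x : P n} (hx : x ∈ VS S) : tau x ∈ VS S :=
  fun k hk => by rw [tau_apply, hx k hk, map_zero]

/-- The dimension of the part of `W` that is supported on the columns in `S`. -/
def D (W : Submodule ℂ (P n)) (S : Set (Fin n)) : ℕ := Module.finrank ℂ ↥(W ⊓ VS S)

@[simp] lemma D_empty (W : Submodule ℂ (P n)) : D W ∅ = 0 := by
  rw [D, VS_empty, inf_bot_eq, finrank_bot]

lemma D_univ (W : Submodule ℂ (P n)) : D W Set.univ = Module.finrank ℂ W := by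
  rw [D, VS_univ, inf_top_eq]

lemma D_mono (W : Submodule ℂ (P n)) [FiniteDimensional ℂ W] {S S' : Set (Fin n)} (h : S ⊆ S') :
    D W S ≤ D W S' := by
  have : FiniteDimensional ℂ ↥(W ⊓ VS S') := Submodule.finiteDimensional_of_le inf_le_left
  exact Submodule.finrank_mono (inf_le_inf_left W (VS_mono h))

/-! ### Stable subspaces of one column -/

lemma finrank_degreeLT (k : ℕ) : Module.finrank ℂ ↥(Polynomial.degreeLT ℂ k) = k := by
  rw [(Polynomial.degreeLTEquiv ℂ k).finrank_eq]; simp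

instance (k : ℕ) : FiniteDimensional ℂ ↥(Polynomial.degreeLT ℂ k) :=
  Module.Finite.equiv (Polynomial.degreeLTEquiv ℂ k).symm

lemma mem_degreeLT_iff_coeff {k : ℕ} {f : E} :
    f ∈ Polynomial.degreeLT ℂ k ↔ ∀ j, k ≤ j → f.coeff j = 0 := by
  rw [Polynomial.mem_degreeLT, Polynomial.degree_lt_iff_coeff_zero]

/-- A stable subspace that contains a polynomial with a nonzero coefficient at `k` and none above
contains all polynomials of degree at most `k`. -/
lemma degreeLT_le_of_mem {U : Submodule ℂ E} (hU : ∀ f ∈ U, dX f ∈ U) {f : E} {k : ℕ} (hf : f ∈ U)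
    (hk : f.coeff k ≠ 0) (hlt : ∀ j, k < j → f.coeff j = 0) : Polynomial.degreeLT ℂ (k + 1) ≤ U := by
  induction k generalizing f with
  | zero =>
    intro g hg
    rw [mem_degreeLT_iff_coeff] at hg
    have : g = (g.coeff 0 / f.coeff 0) • f := by
      ext j
      rcases Nat.eq_zero_or_pos j with rfl | hj
      · simp [hk]
      · simp [hg j (by omega), hlt j hj]
    rw [this]
    exact U.smul_mem _ hf
  | succ k ih =>
    have h1 : Polynomial.degreeLT ℂ (k + 1) ≤ U :=
      ih (hU f hf) (by simpa using hk) fun j hj => by simpa using hlt (j + 1) (by omega)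
    intro g hg
    rw [mem_degreeLT_iff_coeff] at hg
    have h2 : g - (g.coeff (k + 1) / f.coeff (k + 1)) • f ∈ U := by
      apply h1
      rw [mem_degreeLT_iff_coeff]
      intro j hj
      rcases eq_or_lt_of_le hj with rfl | hj
      · simp [hk]
      · simp [hg j (by omega), hlt j (by omega)]
    have := U.add_mem h2 (U.smul_mem (g.coeff (k + 1) / f.coeff (k + 1)) hf)
    simpa using this

/-- A member of degree `k` produces, by shifts and elimination, all polynomials of degree at most
`k`. So the degrees of the members stay below the dimension, and the stable subspaces form a chain.
-/
lemma eq_degreeLT_of_stable {U : Submodule ℂ E} [FiniteDimensional ℂ U]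
    (hU : ∀ f ∈ U, dX f ∈ U) : U = Polynomial.degreeLT ℂ (Module.finrank ℂ U) := by
  by_cases h0 : U = ⊥
  · subst h0
    rw [finrank_bot, eq_comm, eq_bot_iff]
    intro f hf
    rw [mem_degreeLT_iff_coeff] at hf
    ext j
    simpa using hf j (Nat.zero_le j)
  have hdeg : ∀ f ∈ U, f ≠ 0 → f.natDegree < Module.finrank ℂ U := by
    intro f hf hf0
    have := degreeLT_le_of_mem hU hf (k := f.natDegree) (by simpa using hf0)
      fun j hj => Polynomial.coeff_eq_zero_of_natDegree_lt hj
    have := Submodule.finrank_mono this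
    rw [finrank_degreeLT] at this
    exact this
  apply Submodule.eq_of_le_of_finrank_eq
  · intro f hf
    rw [mem_degreeLT_iff_coeff]
    intro j hj
    by_cases hf0 : f = 0
    · simp [hf0]
    exact Polynomial.coeff_eq_zero_of_natDegree_lt ((hdeg f hf hf0).trans_le hj)
  · rw [finrank_degreeLT]

/-- In a chain the sum of two members is the larger one. This is the origin of the maxima and minima
in the tropical relations. -/
lemma finrank_sup_of_stable {U U' : Submodule ℂ E} [FiniteDimensional ℂ U] [FiniteDimensional ℂ U']
    (hU : ∀ f ∈ U, dX f ∈ U) (hU' : ∀ f ∈ U', dX f ∈ U') :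
    Module.finrank ℂ ↥(U ⊔ U') = max (Module.finrank ℂ U) (Module.finrank ℂ U') := by
  have h1 := eq_degreeLT_of_stable hU
  have h2 := eq_degreeLT_of_stable hU'
  rcases le_total (Module.finrank ℂ U) (Module.finrank ℂ U') with h | h
  · rw [sup_eq_right.mpr, max_eq_right h]
    rw [h1, h2]
    exact Polynomial.degreeLT_mono h
  · rw [sup_eq_left.mpr, max_eq_left h]
    rw [h1, h2]
    exact Polynomial.degreeLT_mono h

lemma map_pr_stable {W : Submodule ℂ (P n)} (hW : ∀ x ∈ W, tau x ∈ W) (S : Set (Fin n)) (i : Fin n) :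
    ∀ f ∈ (W ⊓ VS S).map (pr i), dX f ∈ (W ⊓ VS S).map (pr i) := by
  rintro _ ⟨x, hx, rfl⟩
  exact ⟨tau x, ⟨hW x hx.1, tau_mem_VS hx.2⟩, rfl⟩

/-- Rank and nullity for the projection of `W ⊓ VS S` to a column. -/
lemma finrank_map_pr_add (W : Submodule ℂ (P n)) [FiniteDimensional ℂ W] (S : Set (Fin n))
    (i : Fin n) :
    Module.finrank ℂ ↥((W ⊓ VS S).map (pr i)) + D W (S \ {i}) = D W S := by
  have : FiniteDimensional ℂ ↥(W ⊓ VS S) := Submodule.finiteDimensional_of_le inf_le_left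
  have h := LinearMap.finrank_range_add_finrank_ker ((pr i).domRestrict (W ⊓ VS S))
  rw [LinearMap.range_domRestrict] at h
  rw [D, D, ← h]
  congr 1
  have hk : (LinearMap.ker ((pr i).domRestrict (W ⊓ VS S))).map (W ⊓ VS S).subtype
      = W ⊓ VS (S \ {i}) := by
    ext x
    simp only [Submodule.mem_map, LinearMap.mem_ker, LinearMap.domRestrict_apply,
      Submodule.subtype_apply, Subtype.exists, exists_and_left, exists_prop, Submodule.mem_inf]
    constructor
    · rintro ⟨y, hy, ⟨hy1, hy2⟩, rfl⟩
      refine ⟨hy1, fun k hk => ?_⟩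
      by_cases hki : k = i
      · subst hki; exact hy
      · exact hy2 k fun h => hk ⟨h, hki⟩
    · rintro ⟨h1, h2⟩
      exact ⟨x, h2 i (by simp), ⟨h1, VS_mono Set.sdiff_subset h2⟩, rfl⟩
  rw [← hk, Submodule.finrank_map_subtype_eq]

/-- The kernel of the projection can only shrink on a subspace, so the image loses at most the
codimension. -/
lemma finrank_map_pr_le (W U : Submodule ℂ (P n)) [FiniteDimensional ℂ W] (h : U ≤ W) (i : Fin n) :
    Module.finrank ℂ ↥(W.map (pr i)) + Module.finrank ℂ U
      ≤ Module.finrank ℂ ↥(U.map (pr i)) + Module.finrank ℂ W := by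
  have : FiniteDimensional ℂ U := Submodule.finiteDimensional_of_le h
  have h1 := LinearMap.finrank_range_add_finrank_ker ((pr i).domRestrict W)
  have h2 := LinearMap.finrank_range_add_finrank_ker ((pr i).domRestrict U)
  rw [LinearMap.range_domRestrict] at h1 h2
  have h3 : Module.finrank ℂ ↥(LinearMap.ker ((pr i).domRestrict U))
      ≤ Module.finrank ℂ ↥(LinearMap.ker ((pr i).domRestrict W)) := by
    rw [← Submodule.finrank_map_subtype_eq U, ← Submodule.finrank_map_subtype_eq W]
    apply Submodule.finrank_mono
    rintro _ ⟨y, hy, rfl⟩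
    exact ⟨⟨y, h y.2⟩, hy, rfl⟩
  omega

/-- Inclusion and exclusion for two sets of columns. -/
lemma D_sup (W : Submodule ℂ (P n)) [FiniteDimensional ℂ W] (S S' : Set (Fin n)) :
    Module.finrank ℂ ↥((W ⊓ VS S) ⊔ (W ⊓ VS S')) + D W (S ∩ S') = D W S + D W S' := by
  have h1 : FiniteDimensional ℂ ↥(W ⊓ VS S) := Submodule.finiteDimensional_of_le inf_le_left
  have h2 : FiniteDimensional ℂ ↥(W ⊓ VS S') := Submodule.finiteDimensional_of_le inf_le_left
  rw [D, D, D, ← Submodule.finrank_sup_add_finrank_inf_eq (W ⊓ VS S), ← VS_inf,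
    inf_inf_distrib_left]

/-- Removing a column `k` from a set of columns `Q` that is the union of `Q₁` and `Q₂`. -/
lemma D_diff_ge (W : Submodule ℂ (P n)) [FiniteDimensional ℂ W] (hW : ∀ x ∈ W, tau x ∈ W)
    {Q Q₁ Q₂ : Set (Fin n)} (h1 : Q₁ ⊆ Q) (h2 : Q₂ ⊆ Q) (k : Fin n) :
    min (D W (Q₁ \ {k}) + D W Q₂) (D W (Q₂ \ {k}) + D W Q₁) ≤ D W (Q \ {k}) + D W (Q₁ ∩ Q₂) := by
  have f1 : FiniteDimensional ℂ ↥(W ⊓ VS Q₁) := Submodule.finiteDimensional_of_le inf_le_left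
  have f2 : FiniteDimensional ℂ ↥(W ⊓ VS Q₂) := Submodule.finiteDimensional_of_le inf_le_left
  have f : FiniteDimensional ℂ ↥(W ⊓ VS Q) := Submodule.finiteDimensional_of_le inf_le_left
  have e1 := finrank_map_pr_add W Q₁ k
  have e2 := finrank_map_pr_add W Q₂ k
  have e := finrank_map_pr_add W Q k
  -- The column-`k` projection of `W ∩ V_Q` is compared with that of its subspace `(W ∩ V_{Q₁}) + (W
  -- ∩ V_{Q₂})`. By the chain property the dimension of the latter is a maximum.
  have e3 := finrank_map_pr_le (W ⊓ VS Q) ((W ⊓ VS Q₁) ⊔ (W ⊓ VS Q₂))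
    (sup_le (inf_le_inf_left _ (VS_mono h1)) (inf_le_inf_left _ (VS_mono h2))) k
  rw [Submodule.map_sup, finrank_sup_of_stable (map_pr_stable hW _ _) (map_pr_stable hW _ _)] at e3
  have e4 := D_sup W Q₁ Q₂
  change _ ≤ _ + D W Q at e3
  rcases max_cases (Module.finrank ℂ ↥((W ⊓ VS Q₁).map (pr k)))
    (Module.finrank ℂ ↥((W ⊓ VS Q₂).map (pr k))) with ⟨h, -⟩ | ⟨h, -⟩ <;> rw [h] at e3 <;> omega

/-- The columns from `a` to `b`. -/
def iv (n a b : ℕ) : Set (Fin n) := {k | a ≤ (k : ℕ) ∧ (k : ℕ) ≤ b}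

lemma mem_iv {a b : ℕ} {k : Fin n} : k ∈ iv n a b ↔ a ≤ (k : ℕ) ∧ (k : ℕ) ≤ b := Iff.rfl

end

section

/-! ### Levels of loops -/

variable {n : ℕ}

instance : Finite (Root n) :=
  Finite.of_injective (fun R : Root n => (R.left, R.right)) fun R R' h => by
    simp only [Prod.mk.injEq] at h
    exact Root.ext h.1 h.2

/-- A loop as a pair of its root and its number. -/
def KLoop.equivSigma (p : KostantPicture n) : KLoop p ≃ Σ R : Root n, Fin (p R) where
  toFun L := ⟨L.root, L.idx⟩
  invFun q := ⟨q.1, q.2⟩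

instance (p : KostantPicture n) : Finite (KLoop p) := Finite.of_equiv _ (KLoop.equivSigma p).symm

instance (p : KostantPicture n) : Fintype (KLoop p) := Fintype.ofFinite _

lemma KLoop.ext' {p : KostantPicture n} {L L' : KLoop p} (h : L.root = L'.root)
    (h' : (L.idx : ℕ) = L'.idx) : L = L' := by
  obtain ⟨R, k⟩ := L
  obtain ⟨R', k'⟩ := L'
  obtain rfl : R = R' := h
  obtain rfl : k = k' := Fin.ext h'
  rfl

lemma KLoop.left_lt_right {p : KostantPicture n} (L : KLoop p) :
    (L.root.left : ℕ) < L.root.right := L.root.lt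

lemma Root.ext_val {R R' : Root n} (h : (R.left : ℕ) = R'.left) (h' : (R.right : ℕ) = R'.right) :
    R = R' := Root.ext (Fin.ext h) (Fin.ext h')

/-- The number of loops with given ends, zero if these are not the ends of a loop. -/
def mult (p : KostantPicture n) (a b : ℕ) : ℕ :=
  if h : a < b ∧ b < n then p ⟨⟨a, h.1.trans h.2⟩, ⟨b, h.2⟩, h.1⟩ else 0

lemma mult_root (p : KostantPicture n) (R : Root n) : mult p R.left R.right = p R := by
  have h : (R.left : ℕ) < R.right := R.lt
  simp [mult, h]

/-- The loops contained in the columns from `a` to `b`. -/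
def loopsIn (p : KostantPicture n) (a b : ℕ) : Set (KLoop p) :=
  {L | a ≤ (L.root.left : ℕ) ∧ (L.root.right : ℕ) ≤ b}

/-- The number of the loops contained in the columns from `a` to `b`. -/
def cnt (p : KostantPicture n) (a b : ℕ) : ℕ := (loopsIn p a b).ncard

lemma loopsIn_eq_empty (p : KostantPicture n) {a b : ℕ} (h : b ≤ a) : loopsIn p a b = ∅ := by
  ext L
  have := L.left_lt_right
  simp only [loopsIn, Set.mem_ofPred_eq, Set.mem_empty_iff_false, iff_false]
  omega

lemma cnt_eq_zero (p : KostantPicture n) {a b : ℕ} (h : b ≤ a) : cnt p a b = 0 := by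
  rw [cnt, loopsIn_eq_empty p h, Set.ncard_empty]

lemma ncard_root (p : KostantPicture n) (a b : ℕ) :
    {L : KLoop p | (L.root.left : ℕ) = a ∧ (L.root.right : ℕ) = b}.ncard = mult p a b := by
  by_cases h : a < b ∧ b < n
  · set R : Root n := ⟨⟨a, h.1.trans h.2⟩, ⟨b, h.2⟩, h.1⟩
    have e : {L : KLoop p | (L.root.left : ℕ) = a ∧ (L.root.right : ℕ) = b}
        = Set.range fun k : Fin (p R) => (⟨R, k⟩ : KLoop p) := by
      ext L
      constructor
      · rintro ⟨h1, h2⟩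
        obtain ⟨R', k⟩ := L
        obtain rfl : R' = R := Root.ext_val h1 h2
        exact ⟨k, rfl⟩
      · rintro ⟨k, rfl⟩
        exact ⟨rfl, rfl⟩
    rw [e, ← Set.image_univ, Set.ncard_image_of_injective, Set.ncard_univ, Nat.card_fin]
    · simp [mult, h, R]
    · intro k k' hk
      injection hk
  · rw [mult, dif_neg h, Set.ncard_eq_zero]
    ext L
    have := L.left_lt_right
    have := L.root.right.2
    simp only [Set.mem_ofPred_eq, Set.mem_empty_iff_false, iff_false]
    omega

/-- Inclusion and exclusion: a loop in the block avoids its first column, or avoids its last one, or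
has both as its ends. -/
lemma cnt_rec (p : KostantPicture n) {a b : ℕ} (h : a < b) :
    cnt p a b + cnt p (a + 1) (b - 1) = cnt p (a + 1) b + cnt p a (b - 1) + mult p a b := by
  have e : loopsIn p a b = (loopsIn p (a + 1) b ∪ loopsIn p a (b - 1)) ∪
      {L : KLoop p | (L.root.left : ℕ) = a ∧ (L.root.right : ℕ) = b} := by
    ext L
    simp only [loopsIn, Set.mem_ofPred_eq, Set.mem_union]
    omega
  have e' : loopsIn p (a + 1) (b - 1) = loopsIn p (a + 1) b ∩ loopsIn p a (b - 1) := by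
    ext L
    simp only [loopsIn, Set.mem_ofPred_eq, Set.mem_inter_iff]
    omega
  rw [cnt, e, Set.ncard_union_eq, ncard_root, cnt, e', cnt, cnt,
    ← Set.ncard_union_add_ncard_inter (loopsIn p (a + 1) b)]
  · omega
  · rw [Set.disjoint_left]
    intro L
    simp only [loopsIn, Set.mem_ofPred_eq, Set.mem_union]
    omega

/-- The maximal level at column `i` of the loops contained in the columns from `a` to `b`. -/
def maxLevel (p : KostantPicture n) (i : ℕ) (a b : ℕ) : ℕ :=
  if a < b ∧ a ≤ i ∧ i ≤ b then
    mult p a b + max (maxLevel p i (a + 1) b) (maxLevel p i a (b - 1))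
  else 0
termination_by b - a

/-- The level of a loop at column `i`, minus one. -/
def depth (p : KostantPicture n) (i : ℕ) (L : KLoop p) : ℕ :=
  max (maxLevel p i (L.root.left + 1) L.root.right) (maxLevel p i L.root.left (L.root.right - 1))
    + L.idx

lemma maxLevel_eq_zero (p : KostantPicture n) {i a b : ℕ} (h : ¬ (a ≤ i ∧ i ≤ b)) :
    maxLevel p i a b = 0 := by
  rw [maxLevel, if_neg fun h' => h h'.2]

lemma maxLevel_root {p : KostantPicture n} {i : Fin n} {L : KLoop p} (hi : L.Passes i) :
    maxLevel p i L.root.left L.root.right = p L.root +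
      max (maxLevel p i (L.root.left + 1) L.root.right)
        (maxLevel p i L.root.left (L.root.right - 1)) := by
  rw [maxLevel, if_pos ⟨L.left_lt_right, hi.1, hi.2⟩, mult_root]

lemma depth_lt_maxLevel {p : KostantPicture n} {i : Fin n} {a b : ℕ} {L : KLoop p}
    (hi : L.Passes i) (hL : L ∈ loopsIn p a b) : depth p i L < maxLevel p i a b := by
  obtain ⟨h1, h2⟩ := hL
  have hlr := L.left_lt_right
  have hi1 : (L.root.left : ℕ) ≤ i := hi.1
  have hi2 : (i : ℕ) ≤ L.root.right := hi.2
  induction hd : b - a generalizing a b with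
  | zero => omega
  | succ d ih =>
    by_cases hr : a = L.root.left ∧ b = L.root.right
    · obtain ⟨rfl, rfl⟩ := hr
      rw [maxLevel_root hi, depth]
      have := L.idx.2
      omega
    · rw [maxLevel, if_pos (by omega)]
      by_cases ha : a = L.root.left
      · have := ih (a := a) (b := b - 1) h1 (by omega) (by omega)
        omega
      · have := ih (a := a + 1) (b := b) (by omega) h2 (by omega)
        omega

/-- The outermost loop around the whole block serves, if there is one; otherwise a loop comes from
whichever of the two shorter blocks attains the maximum. -/
lemma exists_depth_add_one_eq {p : KostantPicture n} {i : Fin n} {a b : ℕ}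
    (h : 0 < maxLevel p i a b) :
    ∃ L : KLoop p, L.Passes i ∧ L ∈ loopsIn p a b ∧ depth p i L + 1 = maxLevel p i a b := by
  induction hd : b - a using Nat.strong_induction_on generalizing a b with
  | _ d ih =>
    subst hd
    have hab : a < b ∧ a ≤ (i : ℕ) ∧ (i : ℕ) ≤ b := by
      by_contra h'
      rw [maxLevel, if_neg h'] at h
      exact lt_irrefl _ h
    by_cases hm : 0 < mult p a b
    · have hb : b < n := by
        by_contra hb
        rw [mult, dif_neg fun h => hb h.2] at hm
        exact lt_irrefl _ hm
      set R : Root n := ⟨⟨a, hab.1.trans hb⟩, ⟨b, hb⟩, hab.1⟩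
      have hR : mult p a b = p R := mult_root p R
      have hi : (⟨R, ⟨p R - 1, by omega⟩⟩ : KLoop p).Passes i := ⟨hab.2.1, hab.2.2⟩
      refine ⟨⟨R, ⟨p R - 1, by omega⟩⟩, hi, ⟨le_rfl, le_rfl⟩, ?_⟩
      have := maxLevel_root hi
      simp only [depth]
      change _ = maxLevel p i R.left R.right
      simp only at this
      rw [this]
      omega
    · rw [maxLevel, if_pos hab] at h ⊢
      rcases le_total (maxLevel p i (a + 1) b) (maxLevel p i a (b - 1)) with hle | hle
      · obtain ⟨L, hL1, hL2, hL3⟩ := ih (b - 1 - a) (by omega) (a := a) (b := b - 1) (by omega) rfl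
        exact ⟨L, hL1, ⟨hL2.1, hL2.2.trans (Nat.sub_le _ _)⟩, by omega⟩
      · obtain ⟨L, hL1, hL2, hL3⟩ := ih (b - (a + 1)) (by omega) (a := a + 1) (b := b) (by omega) rfl
        exact ⟨L, hL1, ⟨(Nat.le_succ a).trans hL2.1, hL2.2⟩, by omega⟩

lemma KLoop.Inside.mem_loopsIn {p : KostantPicture n} {L L' : KLoop p} (h : L.Inside L') :
    L ∈ loopsIn p L'.root.left L'.root.right := by
  rcases h with h | h
  · exact ⟨h.2.1, h.2.2⟩
  · rw [← h.1]; exact ⟨le_rfl, le_rfl⟩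

lemma KLoop.Inside.trans {p : KostantPicture n} {L L' L'' : KLoop p} (h : L.Inside L')
    (h' : L'.Inside L'') : L.Inside L'' := by
  rcases h with ⟨h1, h2, h3⟩ | ⟨h1, h2⟩ <;> rcases h' with ⟨h1', h2', h3'⟩ | ⟨h1', h2'⟩
  · left
    refine ⟨fun e => h1 ?_, h2'.trans h2, h3.trans h3'⟩
    rw [← e] at h2' h3'
    exact Root.ext (le_antisymm h2' h2) (le_antisymm h3 h3')
  · left; rw [← h1']; exact ⟨h1, h2, h3⟩
  · left; rw [h1]; exact ⟨h1', h2', h3'⟩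
  · right; exact ⟨h1.trans h1', h2.trans h2'⟩

lemma KLoop.Inside.ne {p : KostantPicture n} {L L' : KLoop p} (h : L.Inside L') : L ≠ L' := by
  rintro rfl
  rcases h with h | h
  · exact h.1 rfl
  · exact lt_irrefl _ h.2

/-- A loop contained in the columns of another loop is inside it unless it has the same root. -/
lemma inside_of_mem_loopsIn {p : KostantPicture n} {L L' : KLoop p} (hr : L.root ≠ L'.root)
    (h : L ∈ loopsIn p L'.root.left L'.root.right) : L.Inside L' := Or.inl ⟨hr, h.1, h.2⟩

/-- The three cases match the three terms in the definition of `depth`. -/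
lemma KLoop.inside_iff {p : KostantPicture n} {L L' : KLoop p} : L.Inside L' ↔
    L ∈ loopsIn p (L'.root.left + 1) L'.root.right ∨ L ∈ loopsIn p L'.root.left (L'.root.right - 1) ∨
      (L.root = L'.root ∧ (L.idx : ℕ) < L'.idx) := by
  have hlr := L.left_lt_right
  have hlr' := L'.left_lt_right
  constructor
  · rintro (⟨h1, h2, h3⟩ | h)
    · have h2' : (L'.root.left : ℕ) ≤ L.root.left := h2
      have h3' : (L.root.right : ℕ) ≤ L'.root.right := h3
      have : ¬ ((L.root.left : ℕ) = L'.root.left ∧ (L.root.right : ℕ) = L'.root.right) :=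
        fun h => h1 (Root.ext_val h.1 h.2)
      simp only [loopsIn, Set.mem_ofPred_eq]
      omega
    · exact Or.inr (Or.inr h)
  · rintro (⟨h1, h2⟩ | ⟨h1, h2⟩ | h)
    · refine inside_of_mem_loopsIn (fun e => ?_) ⟨by omega, h2⟩
      rw [e] at h1; omega
    · refine inside_of_mem_loopsIn (fun e => ?_) ⟨h1, by omega⟩
      rw [e] at h2; omega
    · exact Or.inr h

lemma depth_lt_of_inside {p : KostantPicture n} {i : Fin n} {L L' : KLoop p} (hi : L.Passes i)
    (h : L.Inside L') : depth p i L < depth p i L' := by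
  rw [KLoop.inside_iff] at h
  rcases h with h | h | ⟨h, h'⟩
  · have := depth_lt_maxLevel hi h
    rw [depth.eq_def p i L']
    omega
  · have := depth_lt_maxLevel hi h
    rw [depth.eq_def p i L']
    omega
  · simp only [depth, h]
    omega

lemma exists_inside_of_depth_pos {p : KostantPicture n} {i : Fin n} {L : KLoop p} (hi : L.Passes i)
    (h : 0 < depth p i L) : ∃ L' : KLoop p, L'.Passes i ∧ L'.Inside L ∧
      depth p i L' + 1 = depth p i L := by
  by_cases h0 : (L.idx : ℕ) = 0
  · rw [depth, h0, add_zero] at h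
    rcases le_total (maxLevel p i (L.root.left + 1) L.root.right)
      (maxLevel p i L.root.left (L.root.right - 1)) with hle | hle
    · rw [max_eq_right hle] at h
      obtain ⟨L', h1, h2, h3⟩ := exists_depth_add_one_eq h
      refine ⟨L', h1, KLoop.inside_iff.mpr (Or.inr (Or.inl h2)), ?_⟩
      rw [depth.eq_def p i L, h3, h0]; omega
    · rw [max_eq_left hle] at h
      obtain ⟨L', h1, h2, h3⟩ := exists_depth_add_one_eq h
      refine ⟨L', h1, KLoop.inside_iff.mpr (Or.inl h2), ?_⟩
      rw [depth.eq_def p i L, h3, h0]; omega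
  · have := L.idx.2
    refine ⟨⟨L.root, ⟨L.idx - 1, by omega⟩⟩, hi, Or.inr ⟨rfl, ?_⟩, ?_⟩
    · simp only; omega
    · simp only [depth]; omega

/-- Both sides measure the longest chain of encircled loops through the column: `depth` grows
strictly along encirclement, and below a loop of positive depth there is one of depth exactly one
less. -/
lemma upToLevel_iff {p : KostantPicture n} {i : Fin n} {k : ℕ} {L : KLoop p} :
    UpToLevel p i k L ↔ L.Passes i ∧ depth p i L < k := by
  induction k generalizing L with
  | zero => simp [UpToLevel]
  | succ k ih =>
    rw [UpToLevel]
    refine and_congr_right fun hi => ?_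
    constructor
    · intro h
      by_contra hk
      obtain ⟨L', h1, h2, h3⟩ := exists_inside_of_depth_pos hi (by omega)
      have := (ih.mp (h L' h1 h2)).2
      omega
    · intro h L' h1 h2
      exact ih.mpr ⟨h1, by have := depth_lt_of_inside h1 h2; omega⟩

lemma hasLevel_iff {p : KostantPicture n} {i : Fin n} {k : ℕ} {L : KLoop p} :
    HasLevel p i k L ↔ L.Passes i ∧ depth p i L = k := by
  rw [HasLevel, upToLevel_iff, upToLevel_iff]
  constructor
  · rintro ⟨⟨h1, h2⟩, h3⟩
    exact ⟨h1, by have : ¬ depth p i L < k := fun h => h3 ⟨h1, h⟩; omega⟩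
  · rintro ⟨h1, rfl⟩
    exact ⟨⟨h1, by omega⟩, fun h => lt_irrefl _ h.2⟩

/-- Among the loops inside a given one, every smaller level occurs. -/
lemma exists_depth_eq {p : KostantPicture n} {i : Fin n} {a b k : ℕ} (h : k < maxLevel p i a b) :
    ∃ L : KLoop p, L.Passes i ∧ L ∈ loopsIn p a b ∧ depth p i L = k := by
  obtain ⟨L, h1, h2, h3⟩ := exists_depth_add_one_eq (lt_of_le_of_lt (Nat.zero_le _) h)
  have hk : k ≤ depth p i L := by omega
  clear h h3
  induction hd : depth p i L - k generalizing L with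
  | zero => exact ⟨L, h1, h2, by omega⟩
  | succ d ih =>
    obtain ⟨L', h1', h2', h3'⟩ := exists_inside_of_depth_pos h1 (by omega)
    have h4 := h2'.mem_loopsIn
    exact ih L' h1' ⟨h2.1.trans h4.1, h4.2.trans h2.2⟩ (by omega) (by omega)

/-- Two loops through a column are either equal, or one is inside the other, or they are ordered
from left to right. -/
lemma KLoop.trichotomy {p : KostantPicture n} (L L' : KLoop p) :
    L = L' ∨ L.Inside L' ∨ L'.Inside L ∨
      (L.root.left < L'.root.left ∧ L.root.right < L'.root.right) ∨
      (L'.root.left < L.root.left ∧ L'.root.right < L.root.right) := by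
  by_cases hr : L.root = L'.root
  · rcases lt_trichotomy (L.idx : ℕ) L'.idx with h | h | h
    · exact Or.inr (Or.inl (Or.inr ⟨hr, h⟩))
    · exact Or.inl (KLoop.ext' hr h)
    · exact Or.inr (Or.inr (Or.inl (Or.inr ⟨hr.symm, h⟩)))
  · rcases lt_or_ge L.root.left L'.root.left with h1 | h1 <;>
      rcases lt_or_ge L.root.right L'.root.right with h2 | h2
    · exact Or.inr (Or.inr (Or.inr (Or.inl ⟨h1, h2⟩)))
    · exact Or.inr (Or.inr (Or.inl (Or.inl ⟨fun e => hr e.symm, h1.le, h2⟩)))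
    · exact Or.inr (Or.inl (Or.inl ⟨hr, h1, h2.le⟩))
    · rcases eq_or_lt_of_le h1 with h1 | h1
      · exact Or.inr (Or.inr (Or.inl (Or.inl ⟨fun e => hr e.symm, h1.symm.le, h2⟩)))
      · rcases eq_or_lt_of_le h2 with h2 | h2
        · exact Or.inr (Or.inl (Or.inl ⟨hr, h1.le, h2.symm.le⟩))
        · exact Or.inr (Or.inr (Or.inr (Or.inr ⟨h1, h2⟩)))

/-- Loops of the same level are ordered from left to right. -/
lemma eq_or_lt_of_depth_eq {p : KostantPicture n} {i : Fin n} {L L' : KLoop p} (hi : L.Passes i)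
    (hi' : L'.Passes i) (h : depth p i L = depth p i L') : L = L' ∨
      (L.root.left < L'.root.left ∧ L.root.right < L'.root.right) ∨
      (L'.root.left < L.root.left ∧ L'.root.right < L.root.right) := by
  rcases KLoop.trichotomy L L' with h1 | h1 | h1 | h1
  · exact Or.inl h1
  · exact absurd h (depth_lt_of_inside hi h1).ne
  · exact absurd h (depth_lt_of_inside hi' h1).ne'
  · exact Or.inr h1

end

section

/-! ### Compatibility modulo `Y_0` -/

variable {n : ℕ}

/-- The family `y` is a basis of `W` that generates a flag, compatible to the Kostant picture. -/
structure IsModelFlag (p : KostantPicture n) (W : Submodule ℂ (P n)) (y : KLoop p → P n) :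
    Prop where
  linearIndependent : LinearIndependent ℂ y
  span_eq : Submodule.span ℂ (Set.range y) = W
  mem_VS : ∀ L, y L ∈ VS (iv n L.root.left L.root.right)
  tau_mem : ∀ L, tau (y L) ∈ Submodule.span ℂ (y '' {L' | L'.Inside L})
  coeff_ne : ∀ (L : KLoop p) (i : Fin n), L.Passes i → (y L i).coeff (depth p i L) ≠ 0

lemma apply_eq_zero_of_not_passes {p : KostantPicture n} {y : KLoop p → P n}
    (hV : ∀ L, y L ∈ VS (iv n L.root.left L.root.right)) {L : KLoop p} {i : Fin n}
    (hi : ¬ L.Passes i) : y L i = 0 := hV L i fun h => hi ⟨h.1, h.2⟩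

/-- The order of the pole at column `i` is bounded by the level. -/
lemma coeff_eq_zero_of_depth_lt {p : KostantPicture n} {y : KLoop p → P n}
    (hV : ∀ L, y L ∈ VS (iv n L.root.left L.root.right))
    (ht : ∀ L, tau (y L) ∈ Submodule.span ℂ (y '' {L' | L'.Inside L})) {i : Fin n} {k : ℕ}
    {L : KLoop p} (hk : depth p i L < k) : (y L i).coeff k = 0 := by
  induction k generalizing L with
  | zero => omega
  | succ k ih =>
    by_cases hi : L.Passes i
    · have : Submodule.span ℂ (y '' {L' | L'.Inside L}) ≤
          LinearMap.ker ((Polynomial.lcoeff ℂ k).comp (pr i)) := by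
        rw [Submodule.span_le]
        rintro _ ⟨L', hL', rfl⟩
        by_cases hi' : L'.Passes i
        · exact ih (by have := depth_lt_of_inside hi' hL'; omega)
        · simp [apply_eq_zero_of_not_passes hV hi']
      have := this (ht L)
      simpa using this
    · simp [apply_eq_zero_of_not_passes hV hi]

lemma span_stable {p : KostantPicture n} {y : KLoop p → P n} {s : Set (KLoop p)}
    (ht : ∀ L, tau (y L) ∈ Submodule.span ℂ (y '' {L' | L'.Inside L}))
    (hs : ∀ L ∈ s, ∀ L', L'.Inside L → L' ∈ s) :
    ∀ x ∈ Submodule.span ℂ (y '' s), tau x ∈ Submodule.span ℂ (y '' s) := by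
  have : Submodule.span ℂ (y '' s) ≤ (Submodule.span ℂ (y '' s)).comap tau := by
    rw [Submodule.span_le]
    rintro _ ⟨L, hL, rfl⟩
    exact Submodule.span_mono (Set.image_mono (hs L hL)) (ht L)
  exact this

/-- A combination of the `y L` with pairwise different levels at column `i` and vanishing column
`i` has no contribution of loops through column `i`. -/
lemma coeff_passes_eq_zero {p : KostantPicture n} {y : KLoop p → P n}
    (hV : ∀ L, y L ∈ VS (iv n L.root.left L.root.right))
    (ht : ∀ L, tau (y L) ∈ Submodule.span ℂ (y '' {L' | L'.Inside L}))
    (hne : ∀ (L : KLoop p) (i : Fin n), L.Passes i → (y L i).coeff (depth p i L) ≠ 0)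
    {c : KLoop p → ℂ} {i : Fin n}
    (hinj : ∀ L L', c L ≠ 0 → c L' ≠ 0 → L.Passes i → L'.Passes i → depth p i L = depth p i L' →
      L = L') (h0 : (∑ L, c L • y L) i = 0) (L : KLoop p) (hL : L.Passes i) : c L = 0 := by
  classical
  by_contra hc
  -- Take the deepest loop through the column that occurs. At its depth no other occurring vector
  -- has a nonzero coefficient, so its term cannot cancel.
  obtain ⟨M, hM, hmax⟩ := Finset.exists_max_image
    (Finset.univ.filter fun L => c L ≠ 0 ∧ L.Passes i) (depth p i) ⟨L, by simp [hc, hL]⟩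
  simp only [Finset.mem_filter, Finset.mem_univ, true_and] at hM hmax
  have h1 := congrArg (fun f : E => f.coeff (depth p i M)) h0
  simp only [Finset.sum_apply, Pi.smul_apply, Polynomial.finsetSum_coeff, Polynomial.coeff_smul,
    Polynomial.coeff_zero, smul_eq_mul] at h1
  rw [Finset.sum_eq_single M] at h1
  · rcases mul_eq_zero.mp h1 with h1 | h1
    · exact hM.1 h1
    · exact hne M i hM.2 h1
  · intro L' _ hL'
    by_cases hc' : c L' = 0
    · simp [hc']
    by_cases hi' : L'.Passes i
    · have h2 := hmax L' ⟨hc', hi'⟩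
      rcases eq_or_lt_of_le h2 with h2 | h2
      · exact absurd (hinj L' M hc' hM.1 hi' hM.2 h2) hL'
      · rw [coeff_eq_zero_of_depth_lt hV ht h2, mul_zero]
    · simp [apply_eq_zero_of_not_passes hV hi']
  · intro hM'; simp at hM'

/-- In a nontrivial relation consider the leftmost left end. All occurring loops through that column
start there, so they have different levels and cannot cancel. -/
lemma linearIndependent_of_coeff_ne {p : KostantPicture n} {y : KLoop p → P n}
    (hV : ∀ L, y L ∈ VS (iv n L.root.left L.root.right))
    (ht : ∀ L, tau (y L) ∈ Submodule.span ℂ (y '' {L' | L'.Inside L}))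
    (hne : ∀ (L : KLoop p) (i : Fin n), L.Passes i → (y L i).coeff (depth p i L) ≠ 0) :
    LinearIndependent ℂ y := by
  classical
  rw [Fintype.linearIndependent_iff]
  intro c hc
  by_contra! hex
  obtain ⟨L₀, hL₀⟩ := hex
  obtain ⟨M, hM, hmin⟩ := Finset.exists_min_image
    (Finset.univ.filter fun L => c L ≠ 0) (fun L => L.root.left) ⟨L₀, by simpa using hL₀⟩
  simp only [Finset.mem_filter, Finset.mem_univ, true_and] at hM hmin
  refine hM (coeff_passes_eq_zero hV ht hne (i := M.root.left) ?_ (by rw [hc]; rfl) M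
    ⟨le_rfl, M.root.lt.le⟩)
  intro L L' hL hL' hi hi' hd
  have e1 : L.root.left = M.root.left := le_antisymm hi.1 (hmin L hL)
  have e2 : L'.root.left = M.root.left := le_antisymm hi'.1 (hmin L' hL')
  rcases eq_or_lt_of_depth_eq hi hi' hd with h | h | h
  · exact h
  · exact absurd h.1 (by rw [e1, e2]; exact lt_irrefl _)
  · exact absurd h.1 (by rw [e1, e2]; exact lt_irrefl _)

namespace IsModelFlag

variable {p : KostantPicture n} {W : Submodule ℂ (P n)} {y : KLoop p → P n}

lemma finiteDimensional (h : IsModelFlag p W y) : FiniteDimensional ℂ W := by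
  rw [← h.span_eq]
  exact FiniteDimensional.span_of_finite ℂ (Set.finite_range y)

lemma stable (h : IsModelFlag p W y) : ∀ x ∈ W, tau x ∈ W := by
  rw [← h.span_eq, ← Set.image_univ]
  exact span_stable h.tau_mem fun _ _ _ _ => trivial

lemma coeff_eq_zero (h : IsModelFlag p W y) {i : Fin n} {k : ℕ} {L : KLoop p}
    (hk : depth p i L < k) : (y L i).coeff k = 0 :=
  coeff_eq_zero_of_depth_lt h.mem_VS h.tau_mem hk

/-- The part of `W` in a block of columns is spanned by the vectors of the loops in the block. -/
lemma inf_VS_eq (h : IsModelFlag p W y) (a b : ℕ) :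
    W ⊓ VS (iv n a b) = Submodule.span ℂ (y '' loopsIn p a b) := by
  classical
  apply le_antisymm
  · rintro x ⟨hx, hxV⟩
    rw [← h.span_eq] at hx
    obtain ⟨c, rfl⟩ := (Submodule.mem_span_range_iff_exists_fun ℂ).mp hx
    suffices hc : ∀ L, c L ≠ 0 → L ∈ loopsIn p a b by
      refine Submodule.sum_mem _ fun L _ => ?_
      by_cases hL : c L = 0
      · simp [hL]
      · exact Submodule.smul_mem _ _ (Submodule.subset_span ⟨L, hc L hL, rfl⟩)
    intro L hL
    constructor
    -- If the leftmost left end of the occurring loops lay left of `a`, the combination would vanish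
    -- in that column, although the occurring loops through it have different levels.
    · obtain ⟨M, hM, hmin⟩ := Finset.exists_min_image
        (Finset.univ.filter fun L => c L ≠ 0) (fun L => L.root.left) ⟨L, by simp [hL]⟩
      simp only [Finset.mem_filter, Finset.mem_univ, true_and] at hM hmin
      refine le_trans ?_ (Fin.le_def.mp (hmin L hL))
      by_contra hlt
      refine hM (coeff_passes_eq_zero h.mem_VS h.tau_mem h.coeff_ne
        (i := M.root.left) ?_ (hxV _ fun hk => hlt hk.1) M
        ⟨le_rfl, M.root.lt.le⟩)
      intro L₁ L₂ hc1 hc2 h1 h2 hd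
      rcases eq_or_lt_of_depth_eq h1 h2 hd with e | e | e
      · exact e
      · exact absurd (e.1.trans_le h2.1) (hmin L₁ hc1).not_gt
      · exact absurd (e.1.trans_le h1.1) (hmin L₂ hc2).not_gt
    · obtain ⟨M, hM, hmax⟩ := Finset.exists_max_image
        (Finset.univ.filter fun L => c L ≠ 0) (fun L => L.root.right) ⟨L, by simp [hL]⟩
      simp only [Finset.mem_filter, Finset.mem_univ, true_and] at hM hmax
      refine le_trans (Fin.le_def.mp (hmax L hL)) ?_
      by_contra hlt
      refine hM (coeff_passes_eq_zero h.mem_VS h.tau_mem h.coeff_ne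
        (i := M.root.right) ?_ (hxV _ fun hk => hlt hk.2) M
        ⟨M.root.lt.le, le_rfl⟩)
      intro L₁ L₂ hc1 hc2 h1 h2 hd
      rcases eq_or_lt_of_depth_eq h1 h2 hd with e | e | e
      · exact e
      · exact absurd (h1.2.trans_lt e.2) (hmax L₂ hc2).not_gt
      · exact absurd (h2.2.trans_lt e.2) (hmax L₁ hc1).not_gt
  · rw [Submodule.span_le]
    rintro _ ⟨L, hL, rfl⟩
    refine ⟨?_, fun k hk => ?_⟩
    · rw [← h.span_eq]
      exact Submodule.subset_span ⟨L, rfl⟩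
    · exact h.mem_VS L k fun hk' => hk ⟨hL.1.trans hk'.1, hk'.2.trans hL.2⟩

lemma D_iv (h : IsModelFlag p W y) (a b : ℕ) : D W (iv n a b) = cnt p a b := by
  classical
  have h1 := h.linearIndependent.comp (Subtype.val : loopsIn p a b → KLoop p)
    Subtype.val_injective
  rw [D, h.inf_VS_eq, cnt, Set.image_eq_range]
  have := finrank_span_eq_card h1
  rw [← Nat.card_coe_set_eq, Nat.card_eq_fintype_card, ← this]
  rfl

/-- Depths of loops in the block stay below `maxLevel`, and one loop attaining the greatest depth
already generates the whole stable subspace. -/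
lemma map_pr_eq (h : IsModelFlag p W y) (a b : ℕ) (i : Fin n) :
    (W ⊓ VS (iv n a b)).map (pr i) = Polynomial.degreeLT ℂ (maxLevel p i a b) := by
  apply le_antisymm
  · rw [h.inf_VS_eq, Submodule.map_span, Submodule.span_le]
    rintro _ ⟨_, ⟨L, hL, rfl⟩, rfl⟩
    rw [SetLike.mem_coe, mem_degreeLT_iff_coeff]
    intro j hj
    by_cases hi : L.Passes i
    · exact h.coeff_eq_zero ((depth_lt_maxLevel hi hL).trans_le hj)
    · have := apply_eq_zero_of_not_passes h.mem_VS hi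
      simp [this]
  · rcases Nat.eq_zero_or_pos (maxLevel p i a b) with h0 | h0
    · rw [h0]
      intro f hf
      rw [mem_degreeLT_iff_coeff] at hf
      rw [show f = 0 by ext j; simpa using hf j (Nat.zero_le j)]
      exact zero_mem _
    · obtain ⟨L, h1, h2, h3⟩ := exists_depth_add_one_eq h0
      rw [← h3]
      refine degreeLT_le_of_mem (map_pr_stable h.stable _ i) (f := y L i) ?_ (h.coeff_ne L i h1)
        fun j hj => h.coeff_eq_zero hj
      refine ⟨y L, ?_, rfl⟩
      rw [SetLike.mem_coe, h.inf_VS_eq]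
      exact Submodule.subset_span ⟨L, h2, rfl⟩

lemma D_iv_diff (h : IsModelFlag p W y) (a b : ℕ) (i : Fin n) :
    maxLevel p i a b + D W (iv n a b \ {i}) = cnt p a b := by
  have := h.finiteDimensional
  have h1 := finrank_map_pr_add W (iv n a b) i
  rwa [h.map_pr_eq, finrank_degreeLT, h.D_iv] at h1

end IsModelFlag

/-! ### Construction of flags -/

lemma tau_pow_eq_zero {x : P n} : ∃ k, (tau ^ k) x = 0 := by
  refine ⟨Finset.univ.sup (fun i => (x i).natDegree) + 1, ?_⟩
  ext i j
  rw [tau_pow_apply, coeff_dX_pow]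
  apply Polynomial.coeff_eq_zero_of_natDegree_lt
  have := Finset.le_sup (f := fun i => (x i).natDegree) (Finset.mem_univ i)
  omega

/-- A stable subspace is obtained from a smaller one by adding vectors one by one, with stable
intermediate steps. -/
lemma exists_triangular_family {A B : Submodule ℂ (P n)} [FiniteDimensional ℂ B] (hAB : A ≤ B)
    (hA : ∀ x ∈ A, tau x ∈ A) (hB : ∀ x ∈ B, tau x ∈ B) {r : ℕ}
    (hr : Module.finrank ℂ B = Module.finrank ℂ A + r) :
    ∃ z : Fin r → P n, (∀ k, z k ∈ B) ∧
      (∀ k, tau (z k) ∈ A ⊔ Submodule.span ℂ (z '' {k' | k' < k})) ∧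
      B = A ⊔ Submodule.span ℂ (Set.range z) := by
  induction r generalizing A with
  | zero =>
    refine ⟨Fin.elim0, fun k => k.elim0, fun k => k.elim0, ?_⟩
    rw [Set.range_eq_empty, Submodule.span_empty, sup_bot_eq]
    exact (Submodule.eq_of_le_of_finrank_eq hAB (by omega)).symm
  | succ r ih =>
    obtain ⟨x, hxB, hxA⟩ : ∃ x ∈ B, x ∉ A := by
      by_contra! hc
      have : A = B := le_antisymm hAB hc
      subst this
      omega
    -- As `tau` acts nilpotently on `x`, some last iterate of `x` is still outside of `A`.
    obtain ⟨x, hxB, hxA, hx⟩ : ∃ x ∈ B, x ∉ A ∧ tau x ∈ A := by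
      obtain ⟨k, hk⟩ := tau_pow_eq_zero (x := x)
      induction k generalizing x with
      | zero => exact absurd (by simp [show x = 0 by simpa using hk]) hxA
      | succ k ihk =>
        by_cases hx : tau x ∈ A
        · exact ⟨x, hxB, hxA, hx⟩
        · refine ihk (tau x) (hB x hxB) hx ?_
          rwa [pow_succ, Module.End.mul_apply] at hk
    set A' := A ⊔ Submodule.span ℂ {x} with hA'
    have hA'B : A' ≤ B := sup_le hAB (by simpa using hxB)
    have : FiniteDimensional ℂ A := Submodule.finiteDimensional_of_le hAB
    have hfr : Module.finrank ℂ A' = Module.finrank ℂ A + 1 := by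
      have h1 := Submodule.finrank_sup_add_finrank_inf_eq A (Submodule.span ℂ {x})
      have hx0 : x ≠ 0 := fun h => hxA (h ▸ zero_mem A)
      rw [finrank_span_singleton hx0] at h1
      have h2 : A ⊓ Submodule.span ℂ {x} = ⊥ := by
        rw [eq_bot_iff]
        rintro _ ⟨hv, hv'⟩
        obtain ⟨c, rfl⟩ := Submodule.mem_span_singleton.mp hv'
        by_cases hc : c = 0
        · simp [hc]
        · exact absurd ((Submodule.smul_mem_iff A hc).mp hv) hxA
      rw [h2, finrank_bot] at h1
      omega
    have hA's : ∀ v ∈ A', tau v ∈ A' := by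
      intro v hv
      obtain ⟨a, ha, b, hb, rfl⟩ := Submodule.mem_sup.mp hv
      obtain ⟨c, rfl⟩ := Submodule.mem_span_singleton.mp hb
      rw [map_add, map_smul]
      exact Submodule.mem_sup_left (A.add_mem (hA a ha) (A.smul_mem c hx))
    obtain ⟨z, hz1, hz2, hz3⟩ := ih hA'B hA's (by omega)
    refine ⟨Fin.cons x z, ?_, ?_, ?_⟩
    · intro k
      refine Fin.cases ?_ (fun k => ?_) k
      · exact hxB
      · exact hz1 k
    · intro k
      refine Fin.cases ?_ (fun k => ?_) k
      · exact Submodule.mem_sup_left hx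
      · rw [Fin.cons_succ]
        refine (?_ : A' ⊔ _ ≤ _) (hz2 k)
        rw [hA', sup_assoc]
        refine sup_le_sup_left (sup_le ?_ ?_) A
        · rw [Submodule.span_singleton_le_iff_mem]
          exact Submodule.subset_span ⟨0, Fin.succ_pos k, rfl⟩
        · apply Submodule.span_mono
          rintro _ ⟨k', hk', rfl⟩
          exact ⟨k'.succ, Fin.succ_lt_succ_iff.mpr hk', rfl⟩
    · rw [hz3, hA', sup_assoc, ← Submodule.span_union, Fin.range_cons, Set.singleton_union]

lemma iv_inter (a b : ℕ) : iv n (a + 1) b ∩ iv n a (b - 1) = iv n (a + 1) (b - 1) := by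
  ext k
  simp only [Set.mem_inter_iff, mem_iv]
  omega

lemma iv_mono {a b a' b' : ℕ} (ha : a' ≤ a) (hb : b ≤ b') : iv n a b ⊆ iv n a' b' :=
  fun _ hk => ⟨ha.trans hk.1, hk.2.trans hb⟩

/-- The numerical criterion for compatibility. -/
lemma exists_isModelFlag {p : KostantPicture n} {W : Submodule ℂ (P n)} [FiniteDimensional ℂ W]
    (hW : ∀ x ∈ W, tau x ∈ W) (h1 : ∀ a b, D W (iv n a b) = cnt p a b)
    (h2 : ∀ (R : Root n) (i : Fin n), R.left ≤ i → i ≤ R.right →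
      maxLevel p i R.left R.right + D W (iv n R.left R.right \ {i}) ≤ cnt p R.left R.right) :
    ∃ y : KLoop p → P n, IsModelFlag p W y := by
  classical
  have hfd : ∀ S : Set (Fin n), FiniteDimensional ℂ ↥(W ⊓ VS S) := fun S =>
    Submodule.finiteDimensional_of_le inf_le_left
  have hst : ∀ S : Set (Fin n), ∀ x ∈ W ⊓ VS S, tau x ∈ W ⊓ VS S := fun S x hx =>
    ⟨hW x hx.1, tau_mem_VS hx.2⟩
  -- For each block the sum of the two shorter blocks has codimension `p R`: inclusion and exclusion
  -- for `D` and `cnt_rec` differ exactly by the multiplicity of `R`. The added vectors become the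
  -- `y_L` with root `R`, numbered from the inside.
  have key : ∀ R : Root n, ∃ z : Fin (p R) → P n,
      (∀ k, z k ∈ W ⊓ VS (iv n R.left R.right)) ∧
      (∀ k, tau (z k) ∈ ((W ⊓ VS (iv n (R.left + 1) R.right)) ⊔
        (W ⊓ VS (iv n R.left (R.right - 1)))) ⊔ Submodule.span ℂ (z '' {k' | k' < k})) ∧
      W ⊓ VS (iv n R.left R.right) = ((W ⊓ VS (iv n (R.left + 1) R.right)) ⊔
        (W ⊓ VS (iv n R.left (R.right - 1)))) ⊔ Submodule.span ℂ (Set.range z) := by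
    intro R
    apply exists_triangular_family
    · exact sup_le (inf_le_inf_left _ (VS_mono (iv_mono (by omega) le_rfl)))
        (inf_le_inf_left _ (VS_mono (iv_mono le_rfl (by omega))))
    · intro x hx
      obtain ⟨u, hu, v, hv, rfl⟩ := Submodule.mem_sup.mp hx
      rw [map_add]
      exact Submodule.add_mem_sup (hst _ u hu) (hst _ v hv)
    · exact hst _
    · have e1 := D_sup W (iv n (R.left + 1) R.right) (iv n R.left (R.right - 1))
      have e2 := cnt_rec p (a := R.left) (b := R.right) R.lt
      rw [iv_inter, h1, h1, h1] at e1
      have e3 := h1 R.left R.right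
      rw [D] at e3
      rw [mult_root] at e2
      omega
  choose z hz1 hz2 hz3 using key
  set y : KLoop p → P n := fun L => z L.root L.idx with hy
  have hspan : ∀ d a b, b - a = d →
      W ⊓ VS (iv n a b) = Submodule.span ℂ (y '' loopsIn p a b) := by
    intro d
    induction d using Nat.strong_induction_on with
    | _ d ih =>
      intro a b hd
      by_cases hab : a < b
      swap
      · have : W ⊓ VS (iv n a b) = ⊥ := by
          rw [← Submodule.finrank_eq_zero (R := ℂ)]
          exact (h1 a b).trans (cnt_eq_zero p (not_lt.mp hab))
        rw [this, loopsIn_eq_empty p (not_lt.mp hab), Set.image_empty, Submodule.span_empty]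
      have i1 := ih (b - (a + 1)) (by omega) (a + 1) b rfl
      have i2 := ih (b - 1 - a) (by omega) a (b - 1) rfl
      by_cases hbn : b < n
      · set R : Root n := ⟨⟨a, hab.trans hbn⟩, ⟨b, hbn⟩, hab⟩
        have h3 := hz3 R
        change W ⊓ VS (iv n a b) = ((W ⊓ VS (iv n (a + 1) b)) ⊔ (W ⊓ VS (iv n a (b - 1)))) ⊔ _ at h3
        rw [h3, i1, i2, ← Submodule.span_union, ← Submodule.span_union, ← Set.image_union]
        congr 1
        ext v
        constructor
        · rintro (⟨L, hL | hL, rfl⟩ | ⟨k, rfl⟩)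
          · exact ⟨L, ⟨(Nat.le_succ a).trans hL.1, hL.2⟩, rfl⟩
          · exact ⟨L, ⟨hL.1, hL.2.trans (Nat.sub_le _ _)⟩, rfl⟩
          · exact ⟨⟨R, k⟩, ⟨le_rfl, le_rfl⟩, rfl⟩
        · rintro ⟨L, hL, rfl⟩
          by_cases hR : L.root = R
          · right
            obtain ⟨R', k⟩ := L
            obtain rfl : R' = R := hR
            exact ⟨k, rfl⟩
          · left
            refine ⟨L, ?_, rfl⟩
            have h4 : ¬ ((L.root.left : ℕ) = a ∧ (L.root.right : ℕ) = b) :=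
              fun h => hR (Root.ext_val h.1 h.2)
            obtain ⟨h5, h6⟩ := hL
            simp only [loopsIn, Set.mem_union, Set.mem_ofPred_eq]
            omega
      -- A block that overshoots the last column is shortened without changing its columns or loops.
      · have e1 : iv n a b = iv n a (b - 1) := by
          ext k
          have := k.2
          simp only [mem_iv]
          omega
        have e2 : loopsIn p a b = loopsIn p a (b - 1) := by
          ext L
          have := L.root.right.2
          simp only [loopsIn, Set.mem_ofPred_eq]
          omega
        rw [e1, e2, i2]
  have hW' : iv n 0 n = Set.univ := by
    ext k
    have := k.2
    simp only [mem_iv, Set.mem_univ, iff_true]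
    omega
  have hall : loopsIn p 0 n = Set.univ := by
    ext L
    have := L.root.right.2
    simp only [loopsIn, Set.mem_ofPred_eq, Set.mem_univ, iff_true]
    omega
  have hspanW : Submodule.span ℂ (Set.range y) = W := by
    have := hspan _ 0 n rfl
    rw [hW', VS_univ, inf_top_eq, hall, Set.image_univ] at this
    exact this.symm
  have hV : ∀ L, y L ∈ VS (iv n L.root.left L.root.right) := fun L => (hz1 L.root L.idx).2
  have ht : ∀ L, tau (y L) ∈ Submodule.span ℂ (y '' {L' | L'.Inside L}) := by
    intro L
    have h3 := hz2 L.root L.idx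
    rw [hspan _ _ _ rfl, hspan _ _ _ rfl, ← Submodule.span_union, ← Submodule.span_union] at h3
    refine Submodule.span_mono ?_ h3
    rintro _ ((⟨L', hL', rfl⟩ | ⟨L', hL', rfl⟩) | ⟨k, hk, rfl⟩)
    · exact ⟨L', KLoop.inside_iff.mpr (Or.inl hL'), rfl⟩
    · exact ⟨L', KLoop.inside_iff.mpr (Or.inr (Or.inl hL')), rfl⟩
    · exact ⟨⟨L.root, k⟩, Or.inr ⟨rfl, hk⟩, rfl⟩
  refine ⟨y, ?_, hspanW, hV, ht, ?_⟩
  · rw [linearIndependent_iff_card_eq_finrank_span, Set.finrank, hspanW, ← D_univ, ← hW', h1, cnt,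
      hall, Set.ncard_univ, Nat.card_eq_fintype_card]
  -- If the coefficient at the depth of `L` vanished, the projection of the block would lie in the
  -- polynomials of degree below that depth plus the span of the parallel loops outside `L`. That
  -- leaves dimension at most `maxLevel - 1`, contrary to `h2` and rank–nullity.
  · intro L i hi hc
    have e1 := finrank_map_pr_add W (iv n L.root.left L.root.right) i
    have e2 := h2 L.root i hi.1 hi.2
    rw [h1] at e1
    rw [maxLevel_root hi] at e2
    obtain ⟨s, hs⟩ : ∃ s : Finset E, s = (Finset.Ioi L.idx).image fun k => z L.root k i := ⟨_, rfl⟩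
    have hle : (W ⊓ VS (iv n L.root.left L.root.right)).map (pr i) ≤
        Polynomial.degreeLT ℂ (depth p i L) ⊔
          Submodule.span ℂ (s : Set E) := by
      rw [hspan _ _ _ rfl, Submodule.map_span, Submodule.span_le]
      rintro _ ⟨_, ⟨L', hL', rfl⟩, rfl⟩
      by_cases hR : L'.root = L.root ∧ (L.idx : ℕ) < L'.idx
      · refine Submodule.mem_sup_right (Submodule.subset_span ?_)
        obtain ⟨R, k⟩ := L
        obtain ⟨R', k'⟩ := L'
        obtain ⟨rfl, hk⟩ := hR
        simp only [hs, Finset.coe_image, Finset.coe_Ioi, Set.mem_image, Set.mem_Ioi]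
        exact ⟨k', hk, rfl⟩
      · refine Submodule.mem_sup_left ?_
        rw [mem_degreeLT_iff_coeff]
        intro j hj
        by_cases hi' : L'.Passes i
        swap
        · have := apply_eq_zero_of_not_passes hV hi'
          simp [this]
        by_cases hLL : L' = L
        · subst hLL
          rcases eq_or_lt_of_le hj with rfl | hj
          · exact hc
          · exact coeff_eq_zero_of_depth_lt hV ht hj
        · have hin : L'.Inside L := by
            by_cases hr : L'.root = L.root
            · refine Or.inr ⟨hr, lt_of_le_of_ne (not_lt.mp fun h => hR ⟨hr, h⟩) fun h => ?_⟩
              exact hLL (KLoop.ext' hr h)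
            · exact inside_of_mem_loopsIn hr hL'
          exact coeff_eq_zero_of_depth_lt hV ht ((depth_lt_of_inside hi' hin).trans_le hj)
    have f1 := Submodule.finrank_mono hle
    have f2 := Submodule.finrank_add_le_finrank_add_finrank (Polynomial.degreeLT ℂ (depth p i L))
      (Submodule.span ℂ (s : Set E))
    have f3 := (finrank_span_finset_le_card (R := ℂ) s)
    have f4 : s.card ≤ _ := hs ▸ Finset.card_image_le
    rw [Set.finrank] at f3
    rw [Fin.card_Ioi] at f4
    rw [finrank_degreeLT] at f2
    have f5 := f1.trans (f2.trans (Nat.add_le_add_left (f3.trans f4) _))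
    rw [depth] at f5
    have := L.idx.2
    omega

end

section

/-! ### The number of loops of a collapse -/

variable {n : ℕ}

/-- The original number of a column after the removal of column `i`. -/
def lift (i x : ℕ) : ℕ := if x < i then x else x + 1

lemma val_succAbove (i : Fin (n + 1)) (k : Fin n) : (i.succAbove k : ℕ) = lift i k := by
  rw [lift, Fin.succAbove]
  by_cases h : k.castSucc < i
  · rw [if_pos h, if_pos (by simpa [Fin.lt_def] using h)]; rfl
  · rw [if_neg h, if_neg (by simpa [Fin.lt_def] using h)]; rfl

lemma lift_le_lift {i x y : ℕ} : lift i x ≤ lift i y ↔ x ≤ y := by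
  unfold lift
  split_ifs <;> omega

/-- The loops through column `i` in a block are counted by the consecutive pairs and the levels. -/
lemma ncard_consecutive_add_maxLevel (p : KostantPicture n) (i : Fin n) (a b : ℕ) :
    {q : KLoop p × KLoop p | Consecutive p i q.1 q.2 ∧ a ≤ (q.1.root.left : ℕ) ∧
      (q.2.root.right : ℕ) ≤ b}.ncard + maxLevel p i a b
      = {L : KLoop p | L.Passes i ∧ L ∈ loopsIn p a b}.ncard := by
  classical
  set C := {q : KLoop p × KLoop p | Consecutive p i q.1 q.2 ∧ a ≤ (q.1.root.left : ℕ) ∧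
      (q.2.root.right : ℕ) ≤ b} with hC
  set Q := {L : KLoop p | L.Passes i ∧ L ∈ loopsIn p a b} with hQ
  -- The leftmost loops of their levels within the block. There is one for each of the `maxLevel`
  -- levels, and every other loop of `Q` is the second member of exactly one consecutive pair.
  set F := {L' ∈ Q | ∀ L ∈ Q, depth p i L = depth p i L' → L'.root.left ≤ L.root.left} with hF
  have hcons : ∀ L L', Consecutive p i L L' ↔ L.Passes i ∧ L'.Passes i ∧
      depth p i L = depth p i L' ∧ L.root.left < L'.root.left ∧
      ∀ L'' : KLoop p, L''.Passes i → depth p i L'' = depth p i L' →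
        L.root.left < L''.root.left → ¬ L''.root.left < L'.root.left := by
    intro L L'
    simp only [Consecutive, hasLevel_iff]
    constructor
    · rintro ⟨k, ⟨h1, h2⟩, ⟨h3, h4⟩, h5, h6⟩
      exact ⟨h1, h3, h2.trans h4.symm, h5, fun L'' g1 g2 g3 g4 =>
        h6 ⟨L'', ⟨g1, g2.trans h4⟩, g3, g4⟩⟩
    · rintro ⟨h1, h2, h3, h4, h5⟩
      exact ⟨_, ⟨h1, h3⟩, ⟨h2, rfl⟩, h4, fun ⟨L'', ⟨g1, g2⟩, g3, g4⟩ => h5 L'' g1 g2 g3 g4⟩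
  have hright : ∀ L L' : KLoop p, L.Passes i → L'.Passes i → depth p i L = depth p i L' →
      L.root.left < L'.root.left → L.root.right < L'.root.right := by
    intro L L' h1 h2 h3 h4
    rcases eq_or_lt_of_depth_eq h1 h2 h3 with e | e | e
    · rw [e] at h4; exact absurd h4 (lt_irrefl _)
    · exact e.2
    · exact absurd h4 e.1.not_gt
  have hmemQ : ∀ q ∈ C, q.1 ∈ Q ∧ q.2 ∈ Q := by
    rintro ⟨L, L'⟩ ⟨hc, h1, h2⟩
    rw [hcons] at hc
    obtain ⟨c1, c2, c3, c4, -⟩ := hc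
    have c5 := hright L L' c1 c2 c3 c4
    simp only at h1 h2 c4 c5
    exact ⟨⟨c1, h1, (Fin.lt_def.mp c5).le.trans h2⟩, c2, h1.trans (Fin.lt_def.mp c4).le, h2⟩
  have hinj : Set.InjOn Prod.snd C := by
    rintro ⟨L₁, L⟩ h1 ⟨L₂, L'⟩ h2 h
    obtain rfl : L = L' := h
    obtain ⟨c1, -, c3, c4, c5⟩ := (hcons _ _).mp h1.1
    obtain ⟨d1, -, d3, d4, d5⟩ := (hcons _ _).mp h2.1
    rcases eq_or_lt_of_depth_eq c1 d1 (c3.trans d3.symm) with e | e | e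
    · simp only at e; rw [e]
    · exact absurd d4 (c5 L₂ d1 d3 e.1)
    · exact absurd c4 (d5 L₁ c1 c3 e.1)
  have himg : Q \ F = Prod.snd '' C := by
    ext L'
    constructor
    · rintro ⟨h1, h2⟩
      have h3 : ∃ L ∈ Q, depth p i L = depth p i L' ∧ L.root.left < L'.root.left := by
        by_contra! h
        exact h2 ⟨h1, h⟩
      obtain ⟨L₀, h4, h5, h6⟩ := h3
      -- `M` is the immediate left neighbour of `L'`. It starts no further left than `L₀`, hence the
      -- pair stays in the block.
      obtain ⟨M, hM, hmax⟩ := Finset.exists_max_image (Finset.univ.filter fun L : KLoop p =>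
        L.Passes i ∧ depth p i L = depth p i L' ∧ L.root.left < L'.root.left)
        (fun L => L.root.left) ⟨L₀, by simpa using ⟨h4.1, h5, h6⟩⟩
      simp only [Finset.mem_filter, Finset.mem_univ, true_and] at hM hmax
      refine ⟨(M, L'), ⟨(hcons _ _).mpr ⟨hM.1, h1.1, hM.2.1, hM.2.2, ?_⟩, ?_, h1.2.2⟩, rfl⟩
      · intro L'' g1 g2 g3 g4
        exact absurd g3 (hmax L'' ⟨g1, g2, g4⟩).not_gt
      · exact h4.2.1.trans (Fin.le_def.mp (hmax L₀ ⟨h4.1, h5, h6⟩))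
    · rintro ⟨⟨L, L'⟩, hq, rfl⟩
      obtain ⟨h1, h2⟩ := hmemQ _ hq
      obtain ⟨c1, -, c3, c4, -⟩ := (hcons _ _).mp hq.1
      exact ⟨h2, fun h3 => absurd c4 (h3.2 L h1 c3).not_gt⟩
  have hFcard : F.ncard = maxLevel p i a b := by
    have hinjF : Set.InjOn (depth p i) F := by
      intro L h1 L' h2 h
      rcases eq_or_lt_of_depth_eq h1.1.1 h2.1.1 h with e | e | e
      · exact e
      · exact absurd e.1 (h2.2 L h1.1 h).not_gt
      · exact absurd e.1 (h1.2 L' h2.1 h.symm).not_gt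
    have hF' : depth p i '' F = Set.Iio (maxLevel p i a b) := by
      ext k
      constructor
      · rintro ⟨L, hL, rfl⟩
        exact depth_lt_maxLevel hL.1.1 hL.1.2
      · intro hk
        obtain ⟨L, h1, h2, h3⟩ := exists_depth_eq hk
        obtain ⟨M, hM, hmin⟩ := Finset.exists_min_image (Finset.univ.filter fun L : KLoop p =>
          L ∈ Q ∧ depth p i L = k) (fun L => L.root.left) ⟨L, by simpa using ⟨⟨h1, h2⟩, h3⟩⟩
        simp only [Finset.mem_filter, Finset.mem_univ, true_and] at hM hmin
        exact ⟨M, ⟨hM.1, fun L' g1 g2 => hmin L' ⟨g1, g2.trans hM.2⟩⟩, hM.2⟩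
    rw [← Set.InjOn.ncard_image hinjF, hF', ← Finset.coe_Iio, Set.ncard_coe_finset, Nat.card_Iio]
  rw [← Set.InjOn.ncard_image hinj, ← himg, ← hFcard]
  exact Set.ncard_sdiff_add_ncard_of_subset fun L hL => hL.1

instance (a b : ℕ) : Fintype {R : Root n // a ≤ (R.left : ℕ) ∧ (R.right : ℕ) ≤ b} :=
  Fintype.ofFinite _

lemma cnt_eq_sum (p : KostantPicture n) (a b : ℕ) : cnt p a b =
    ∑ R : {R : Root n // a ≤ (R.left : ℕ) ∧ (R.right : ℕ) ≤ b}, p R.1 := by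
  have e : loopsIn p a b ≃ Σ R : {R : Root n // a ≤ (R.left : ℕ) ∧ (R.right : ℕ) ≤ b}, Fin (p R.1) :=
    { toFun := fun L => ⟨⟨L.1.root, L.2⟩, L.1.idx⟩
      invFun := fun q => ⟨⟨q.1.1, q.2⟩, q.1.2⟩
      left_inv := fun _ => rfl
      right_inv := fun _ => rfl }
  rw [cnt, ← Nat.card_coe_set_eq, Nat.card_congr e, Nat.card_sigma]
  simp

lemma sum_card_fiber {α ι : Type*} [Finite α] [Fintype ι] (s : Set α) (f : ι → Set α)
    (hd : ∀ x i j, x ∈ f i → x ∈ f j → i = j) (hs : ∀ x, x ∈ s ↔ ∃ i, x ∈ f i) :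
    ∑ i, Nat.card (f i) = s.ncard := by
  have e : (Σ i, f i) ≃ s := Equiv.ofBijective (fun q => ⟨q.2.1, (hs _).mpr ⟨q.1, q.2.2⟩⟩) (by
    constructor
    · rintro ⟨i, x, hx⟩ ⟨j, y, hy⟩ h
      obtain rfl : x = y := congrArg Subtype.val h
      obtain rfl := hd x i j hx hy
      rfl
    · rintro ⟨x, hx⟩
      obtain ⟨i, hi⟩ := (hs x).mp hx
      exact ⟨⟨i, x, hi⟩, rfl⟩)
  rw [← Nat.card_coe_set_eq, ← Nat.card_congr e, Nat.card_sigma]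

/-- A level with `m` loops in the block yields `m - 1` joins in the block, so exactly one loop is
lost per level. Loops not passing through `i` are kept. -/
lemma cnt_collapse (p : KostantPicture (n + 1)) (i : Fin (n + 1)) (a b : ℕ) :
    cnt (p.collapse i) a b + maxLevel p i (lift i a) (lift i b) = cnt p (lift i a) (lift i b) := by
  classical
  have hle : ∀ (k : Fin n) (x : ℕ), x ≤ k ↔ lift i x ≤ (i.succAbove k : ℕ) := fun k x => by
    rw [val_succAbove, lift_le_lift]
  have hle' : ∀ (k : Fin n) (x : ℕ), (k : ℕ) ≤ x ↔ (i.succAbove k : ℕ) ≤ lift i x := fun k x => by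
    rw [val_succAbove, lift_le_lift]
  have hRR : ∀ l r : Fin (n + 1), l ≠ i → r ≠ i → l < r → lift i a ≤ l → (r : ℕ) ≤ lift i b →
      ∃ R : {R : Root n // a ≤ (R.left : ℕ) ∧ (R.right : ℕ) ≤ b},
        l = i.succAbove R.1.left ∧ r = i.succAbove R.1.right := by
    intro l r hl hr hlr h1 h2
    obtain ⟨l', rfl⟩ := Fin.exists_succAbove_eq hl
    obtain ⟨r', rfl⟩ := Fin.exists_succAbove_eq hr
    exact ⟨⟨⟨l', r', Fin.succAbove_lt_succAbove_iff.mp hlr⟩, (hle _ _).mpr h1, (hle' _ _).mpr h2⟩,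
      rfl, rfl⟩
  rw [cnt_eq_sum]
  simp only [KostantPicture.collapse]
  rw [Finset.sum_add_distrib]
  have s1 := sum_card_fiber {L : KLoop p | ¬ L.Passes i ∧ L ∈ loopsIn p (lift i a) (lift i b)}
    (fun R : {R : Root n // a ≤ (R.left : ℕ) ∧ (R.right : ℕ) ≤ b} =>
      {L : KLoop p | ¬ L.Passes i ∧ L.root.left = i.succAbove R.1.left ∧
        L.root.right = i.succAbove R.1.right})
    (fun L R R' h h' => Subtype.ext (Root.ext
      (Fin.succAbove_right_injective (h.2.1.symm.trans h'.2.1))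
      (Fin.succAbove_right_injective (h.2.2.symm.trans h'.2.2))))
    (fun L => by
      constructor
      · rintro ⟨h1, h2, h3⟩
        obtain ⟨R, hR1, hR2⟩ := hRR L.root.left L.root.right
          (fun h => h1 ⟨h.le, h ▸ L.root.lt.le⟩) (fun h => h1 ⟨h ▸ L.root.lt.le, h.ge⟩) L.root.lt h2 h3
        exact ⟨R, h1, hR1, hR2⟩
      · rintro ⟨R, h1, h2, h3⟩
        refine ⟨h1, ?_, ?_⟩
        · rw [h2]; exact (hle _ _).mp R.2.1
        · rw [h3]; exact (hle' _ _).mp R.2.2)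
  have s2 := sum_card_fiber {q : KLoop p × KLoop p | Consecutive p i q.1 q.2 ∧
      lift i a ≤ (q.1.root.left : ℕ) ∧ (q.2.root.right : ℕ) ≤ lift i b}
    (fun R : {R : Root n // a ≤ (R.left : ℕ) ∧ (R.right : ℕ) ≤ b} =>
      {q : KLoop p × KLoop p | Consecutive p i q.1 q.2 ∧ q.1.root.left = i.succAbove R.1.left ∧
        q.2.root.right = i.succAbove R.1.right})
    (fun L R R' h h' => Subtype.ext (Root.ext
      (Fin.succAbove_right_injective (h.2.1.symm.trans h'.2.1))
      (Fin.succAbove_right_injective (h.2.2.symm.trans h'.2.2))))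
    (fun q => by
      constructor
      · rintro ⟨h1, h2, h3⟩
        have h0 := h1
        obtain ⟨k, g1, g2, g3, -⟩ := h0
        rw [hasLevel_iff] at g1 g2
        -- Of two neighbours at one level, the first starts strictly left of `i` and the second ends
        -- strictly right of `i`; thus the join has neither end at the deleted column.
        have g4 : q.1.root.left < i := lt_of_lt_of_le g3 g2.1.1
        have g5 : i < q.2.root.right := by
          rcases eq_or_lt_of_depth_eq g1.1 g2.1 (g1.2.trans g2.2.symm) with e | e | e
          · rw [e] at g3; exact absurd g3 (lt_irrefl _)
          · exact lt_of_le_of_lt g1.1.2 e.2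
          · exact absurd g3 e.1.not_gt
        obtain ⟨R, hR1, hR2⟩ := hRR q.1.root.left q.2.root.right g4.ne g5.ne' (g4.trans g5) h2 h3
        exact ⟨R, h1, hR1, hR2⟩
      · rintro ⟨R, h1, h2, h3⟩
        refine ⟨h1, ?_, ?_⟩
        · rw [h2]; exact (hle _ _).mp R.2.1
        · rw [h3]; exact (hle' _ _).mp R.2.2)
  have s3 := ncard_consecutive_add_maxLevel p i (lift i a) (lift i b)
  have s4 : cnt p (lift i a) (lift i b) =
      {L : KLoop p | ¬ L.Passes i ∧ L ∈ loopsIn p (lift i a) (lift i b)}.ncard +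
      {L : KLoop p | L.Passes i ∧ L ∈ loopsIn p (lift i a) (lift i b)}.ncard := by
    rw [cnt, ← Set.ncard_union_eq]
    · congr 1
      ext L
      simp only [Set.mem_union, Set.mem_ofPred_eq]
      tauto
    · rw [Set.disjoint_left]
      rintro L ⟨h, -⟩ ⟨h', -⟩
      exact h h'
  rw [s4, ← s3, ← s1, ← s2, add_assoc]
  rfl

end

section

/-! ### Matrices of polynomials in `t` acting on columns -/

/-- The action of a polynomial in `t` on a column modulo its part in `Y_0`. -/
def act : Polynomial ℂ →ₐ[ℂ] Module.End ℂ E := Polynomial.aeval dX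

@[simp] lemma act_X : act Polynomial.X = dX := Polynomial.aeval_X _

lemma act_X_pow (k : ℕ) : act (Polynomial.X ^ k) = dX ^ k := by rw [map_pow, act_X]

lemma act_dX (f : Polynomial ℂ) (x : E) : act f (dX x) = dX (act f x) := by
  rw [← act_X, ← Module.End.mul_apply, ← Module.End.mul_apply, ← map_mul, ← map_mul, mul_comm]

lemma coeff_act (f : Polynomial ℂ) (x : E) (k : ℕ) :
    (act f x).coeff k = f.sum fun j c => c * x.coeff (k + j) := by
  rw [act, Polynomial.aeval_eq_sum_range, Polynomial.sum_over_range _ (by simp),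
    LinearMap.sum_apply, Polynomial.finsetSum_coeff]
  simp [coeff_dX_pow]

/-- A polynomial with nonzero constant term acts injectively. -/
lemma eq_zero_of_act_eq_zero {f : Polynomial ℂ} (hf : f.coeff 0 ≠ 0) {x : E} (h : act f x = 0) :
    x = 0 := by
  by_contra hx
  have h1 := congrArg (fun g : E => g.coeff x.natDegree) h
  simp only [coeff_act, Polynomial.coeff_zero] at h1
  rw [Polynomial.sum_def, Finset.sum_eq_single 0] at h1
  · rcases mul_eq_zero.mp h1 with h1 | h1
    · exact hf h1
    · exact hx (by simpa using h1)
  · intro j _ hj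
    rw [Polynomial.coeff_eq_zero_of_natDegree_lt (Nat.lt_add_of_pos_right (Nat.pos_of_ne_zero hj)),
      mul_zero]
  · intro h0
    exact absurd (Polynomial.notMem_support_iff.mp h0) hf

lemma dX_pow_surjective (k : ℕ) : Function.Surjective (dX ^ k) := fun x =>
  ⟨Polynomial.X ^ k * x, by ext j; rw [coeff_dX_pow, Polynomial.coeff_X_pow_mul]⟩

variable {m : ℕ}

/-- The row `a` applied to the vector `x`. -/
def rowAct (a : Fin m → Polynomial ℂ) : P m →ₗ[ℂ] E := ∑ j, (act (a j)).comp (pr j)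

lemma rowAct_apply (a : Fin m → Polynomial ℂ) (x : P m) : rowAct a x = ∑ j, act (a j) (x j) := by
  simp [rowAct]

lemma rowAct_smul (f : Polynomial ℂ) (a : Fin m → Polynomial ℂ) (x : P m) :
    rowAct (f • a) x = act f (rowAct a x) := by
  simp [rowAct_apply]

lemma rowAct_sum {ι : Type*} (s : Finset ι) (a : ι → Fin m → Polynomial ℂ) (x : P m) :
    rowAct (∑ i ∈ s, a i) x = ∑ i ∈ s, rowAct (a i) x := by
  simp only [rowAct_apply, Finset.sum_apply, map_sum, LinearMap.sum_apply]
  rw [Finset.sum_comm]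

lemma rowAct_tau (a : Fin m → Polynomial ℂ) (x : P m) : rowAct a (tau x) = dX (rowAct a x) := by
  simp [rowAct_apply, act_dX]

/-- The common kernel of a family of rows. -/
def rowKer {ι : Type*} (A : ι → Fin m → Polynomial ℂ) : Submodule ℂ (P m) :=
  ⨅ k, LinearMap.ker (rowAct (A k))

lemma mem_rowKer {ι : Type*} {A : ι → Fin m → Polynomial ℂ} {x : P m} :
    x ∈ rowKer A ↔ ∀ k, rowAct (A k) x = 0 := by
  simp [rowKer]

/-- Multiplying by the adjugate reduces the equations to the determinant acting on each coordinate,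
and a nonzero constant term makes this action injective. -/
lemma rowKer_eq_bot (A : Matrix (Fin m) (Fin m) (Polynomial ℂ)) (h : A.det.coeff 0 ≠ 0) :
    rowKer A.row = ⊥ := by
  rw [eq_bot_iff]
  intro x hx
  have hx : ∀ k, rowAct (A k) x = 0 := mem_rowKer.mp hx
  ext1 i
  apply eq_zero_of_act_eq_zero h
  have h1 : rowAct ((A.adjugate * A) i) x = 0 := by
    have : (A.adjugate * A) i = ∑ k, A.adjugate i k • A k := by
      ext1 j
      simp [Matrix.mul_apply]
    rw [this, rowAct_sum]
    exact Finset.sum_eq_zero fun k _ => by rw [rowAct_smul, hx, map_zero]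
  rw [Matrix.adjugate_mul, rowAct_apply, Finset.sum_eq_single i] at h1
  · simpa using h1
  · intro j _ hj
    simp [Matrix.one_apply_ne hj.symm]
  · simp

/-- Dividing a row by `t` decreases the dimension of the common kernel at most by one. -/
lemma rank_rowKer_le_add_one (A A' : Fin m → Fin m → Polynomial ℂ) (r : Fin m)
    (hA' : ∀ k, k ≠ r → A' k = A k) (hrow : ∀ x ∈ rowKer A, dX (rowAct (A' r) x) = 0) :
    Module.rank ℂ (rowKer A) ≤ Module.rank ℂ (rowKer A') + 1 := by
  have h3 := LinearMap.rank_range_add_rank_ker ((rowAct (A' r)).domRestrict (rowKer A))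
  have h4 : Module.rank ℂ (LinearMap.range ((rowAct (A' r)).domRestrict (rowKer A))) ≤ 1 := by
    rw [LinearMap.range_domRestrict]
    -- Only constants are killed by `dX`, so the divided row maps the kernel into a line.
    have : (rowKer A).map (rowAct (A' r)) ≤ Polynomial.degreeLT ℂ 1 := by
      rintro _ ⟨x, hx, rfl⟩
      rw [mem_degreeLT_iff_coeff]
      intro j hj
      have := congrArg (fun g : E => g.coeff (j - 1)) (hrow x hx)
      simp only [coeff_dX, Polynomial.coeff_zero] at this
      rwa [Nat.sub_add_cancel hj] at this
    refine (Submodule.rank_mono this).trans ?_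
    rw [← Module.finrank_eq_rank, finrank_degreeLT, Nat.cast_one]
  have h5 : Module.rank ℂ (LinearMap.ker ((rowAct (A' r)).domRestrict (rowKer A)))
      ≤ Module.rank ℂ (rowKer A') := by
    rw [(Submodule.equivSubtypeMap (rowKer A) _).rank_eq]
    apply Submodule.rank_mono
    rintro _ ⟨⟨x, hx⟩, hx', rfl⟩
    rw [SetLike.mem_coe, LinearMap.mem_ker, LinearMap.domRestrict_apply] at hx'
    rw [mem_rowKer] at hx
    rw [Submodule.subtype_apply, mem_rowKer]
    intro k
    by_cases hk : k = r
    · rw [hk]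
      exact hx'
    · rw [hA' k hk]
      exact hx k
  rw [← h3, add_comm]
  exact add_le_add h5 h4

/-- A matrix that is singular modulo `t` has a combination of rows divisible by `t`. -/
lemma exists_row_divisible (A : Matrix (Fin m) (Fin m) (Polynomial ℂ)) (h : A.det.coeff 0 = 0) :
    ∃ (c : Fin m → ℂ) (r : Fin m) (w : Fin m → Polynomial ℂ), c r ≠ 0 ∧
      ∑ k, Polynomial.C (c k) • A k = (Polynomial.X : Polynomial ℂ) • w := by
  have h0 : ((Polynomial.evalRingHom (0 : ℂ)).mapMatrix A).det = 0 := by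
    rw [← RingHom.map_det, Polynomial.coe_evalRingHom, ← Polynomial.coeff_zero_eq_eval_zero, h]
  obtain ⟨c, hc0, hc⟩ := Matrix.exists_vecMul_eq_zero_iff.mpr h0
  obtain ⟨r, hr⟩ : ∃ r, c r ≠ 0 := by
    by_contra! h
    exact hc0 (funext h)
  have hdvd : ∀ j, ∃ f : Polynomial ℂ, ∑ k, Polynomial.C (c k) * A k j = Polynomial.X * f := by
    intro j
    have h1 : Polynomial.X ∣ ∑ k, Polynomial.C (c k) * A k j := by
      rw [Polynomial.X_dvd_iff, Polynomial.coeff_zero_eq_eval_zero]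
      have := congrFun hc j
      simp only [Matrix.vecMul, dotProduct, RingHom.mapMatrix_apply, Matrix.map_apply,
        Polynomial.coe_evalRingHom, Pi.zero_apply] at this
      simp only [Polynomial.eval_finsetSum, Polynomial.eval_mul, Polynomial.eval_C, this]
    exact h1
  choose w hw using hdvd
  refine ⟨c, r, w, hr, ?_⟩
  ext1 j
  rw [Finset.sum_apply]
  exact hw j

/-- The dimension of the kernel of a matrix is bounded by the order of vanishing of its
determinant. -/
lemma rank_rowKer_le {v : ℕ} (A : Matrix (Fin m) (Fin m) (Polynomial ℂ)) (u : Polynomial ℂ)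
    (hA : A.det = Polynomial.X ^ v * u) (hu : u.coeff 0 ≠ 0) :
    Module.rank ℂ (rowKer A.row) ≤ v := by
  induction v generalizing A u with
  | zero =>
    rw [rowKer_eq_bot A (by simpa [hA] using hu)]
    simp
  | succ v ih =>
    obtain ⟨c, r, w, hr, hw⟩ := exists_row_divisible A (by
      rw [hA, pow_succ', mul_assoc, Polynomial.coeff_X_mul_zero])
    -- Replacing row `r` by `w`, where `X w` is the divisible combination, removes one factor `X`
    -- from the determinant and multiplies it by the nonzero constant `c r`.
    have hdet : (A.updateRow r w).det = Polynomial.X ^ v * (Polynomial.C (c r) * u) := by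
      have h1 := Matrix.det_updateRow_sum A r fun k => Polynomial.C (c k)
      rw [hw, Matrix.det_updateRow_smul, hA, smul_eq_mul] at h1
      apply mul_left_cancel₀ (Polynomial.X_ne_zero (R := ℂ))
      rw [h1]
      ring
    have h2 := ih _ _ hdet (by rw [Polynomial.coeff_C_mul]; exact mul_ne_zero hr hu)
    rw [Nat.cast_succ]
    refine (rank_rowKer_le_add_one A.row (A.updateRow r w).row r ?_ ?_).trans (add_le_add_left h2 1)
    · intro k hk
      exact Matrix.updateRow_ne hk
    · intro x hx
      have hx : ∀ k, rowAct (A k) x = 0 := mem_rowKer.mp hx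
      have hw' : (A.updateRow r w).row r = w := Matrix.updateRow_self
      rw [hw', ← act_X, ← rowAct_smul, ← hw, rowAct_sum]
      exact Finset.sum_eq_zero fun k _ => by rw [rowAct_smul, hx, map_zero]

lemma finiteDimensional_of_rank_le {U : Submodule ℂ (P m)} {v : ℕ} (h : Module.rank ℂ U ≤ v) :
    FiniteDimensional ℂ U :=
  Module.rank_lt_aleph0_iff.mp (h.trans_lt Cardinal.natCast_lt_aleph0)

lemma finrank_map_of_forall {V V' : Type*} [AddCommGroup V] [Module ℂ V] [AddCommGroup V']
    [Module ℂ V'] (f : V →ₗ[ℂ] V') (U : Submodule ℂ V) (h : ∀ x ∈ U, f x = 0 → x = 0) :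
    Module.finrank ℂ (U.map f) = Module.finrank ℂ U := by
  rw [← LinearMap.range_domRestrict]
  apply LinearMap.finrank_range_of_inj
  rw [← LinearMap.ker_eq_bot, eq_bot_iff]
  rintro ⟨x, hx⟩ hx'
  exact Subtype.ext (h x hx hx')

variable {n : ℕ}

/-- The part of a common kernel that is supported on the columns in the range of `c`. -/
lemma D_rowKer_range {ι : Type*} (A : ι → Fin n → Polynomial ℂ) {c : Fin m → Fin n}
    (hc : Function.Injective c) :
    D (rowKer A) (Set.range c) = Module.finrank ℂ (rowKer fun k => A k ∘ c) := by
  have hsum : ∀ (k : ι) (x : P n), x ∈ VS (Set.range c) →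
      rowAct (A k) x = rowAct (A k ∘ c) (x ∘ c) := by
    intro k x hx
    rw [rowAct_apply, rowAct_apply]
    simp only [Function.comp_apply]
    classical
    rw [← Finset.sum_image (s := Finset.univ) (g := c)
      (f := fun j => act (A k j) (x j)) (fun a _ b _ h => hc h)]
    symm
    apply Finset.sum_subset (Finset.subset_univ _)
    intro j _ hj
    rw [hx j (by simpa using hj), map_zero]
  have e : (rowKer A ⊓ VS (Set.range c)).map (LinearMap.funLeft ℂ E c) = rowKer fun k => A k ∘ c := by
    ext y
    constructor
    · rintro ⟨x, ⟨hx, hxV⟩, rfl⟩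
      rw [mem_rowKer]
      intro k
      exact (hsum k x hxV).symm.trans (mem_rowKer.mp hx k)
    · intro hy
      have hV : Function.extend c y 0 ∈ VS (Set.range c) := fun k hk => by
        rw [Function.extend_apply' _ _ _ (by simpa using hk)]; rfl
      have hcomp : Function.extend c y 0 ∘ c = y := funext fun s => hc.extend_apply _ _ _
      refine ⟨Function.extend c y 0, ⟨?_, hV⟩, hcomp⟩
      rw [SetLike.mem_coe, mem_rowKer] at *
      intro k
      rw [hsum k _ hV, hcomp]
      exact hy k
  rw [D, ← e]
  refine (finrank_map_of_forall _ _ ?_).symm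
  intro x hx h0
  ext1 k
  by_cases hk : k ∈ Set.range c
  · obtain ⟨s, rfl⟩ := hk
    exact congrFun h0 s
  · exact hx.2 k hk

end

section

/-! ### Flag minors -/

section FlagMinor

variable {R : Type*} [CommRing R] {m : ℕ}

/-- The minor of the first rows of some columns. -/
def flagMinor (v : Fin m → ℕ → R) : R := (Matrix.of fun r s : Fin m => v s r).det

/-- Expansion along the inserted column: the cofactors depend on its position only through the sign.
-/
lemma flagMinor_insertNth (r : Fin (m + 1)) (x : ℕ → R) (v : Fin m → ℕ → R) :
    flagMinor (Fin.insertNth r x v : Fin (m + 1) → ℕ → R) =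
      (-1) ^ (r : ℕ) * flagMinor (Fin.cons x v : Fin (m + 1) → ℕ → R) := by
  rw [← Fin.insertNth_zero', flagMinor, flagMinor, Matrix.det_succ_column _ r,
    Matrix.det_succ_column _ 0, Finset.mul_sum]
  refine Finset.sum_congr rfl fun i _ => ?_
  have e : ∀ r : Fin (m + 1), (Matrix.of fun a s : Fin (m + 1) =>
      (Fin.insertNth r x v : Fin (m + 1) → ℕ → R) s a).submatrix i.succAbove r.succAbove =
      Matrix.of fun a s : Fin m => v s (i.succAbove a) := by
    intro r
    ext a s
    simp
  rw [e, e]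
  simp only [Matrix.of_apply, Fin.insertNth_apply_same, Fin.val_zero, add_zero, pow_add]
  ring

lemma flagMinor_eq_zero {v : Fin m → ℕ → R} {i j : Fin m} (hij : i ≠ j) (h : v i = v j) :
    flagMinor v = 0 :=
  Matrix.det_zero_of_column_eq hij fun r => by simp [h]

/-- The flag minor as a linear function of its first column. -/
lemma exists_flagMinor_cons_eq (v : Fin m → ℕ → R) : ∃ K : Fin (m + 1) → R, ∀ x : ℕ → R,
    flagMinor (Fin.cons x v : Fin (m + 1) → ℕ → R) = ∑ r, K r * x r := by
  refine ⟨fun i => (-1) ^ (i : ℕ) * (Matrix.of fun a s : Fin m => v s (i.succAbove a)).det,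
    fun x => ?_⟩
  rw [flagMinor, Matrix.det_succ_column _ 0]
  refine Finset.sum_congr rfl fun i _ => ?_
  have e : (Matrix.of fun a s : Fin (m + 1) =>
      (Fin.cons x v : Fin (m + 1) → ℕ → R) s a).submatrix i.succAbove (Fin.succAbove 0) =
      Matrix.of fun a s : Fin m => v s (i.succAbove a) := by
    ext a s
    simp
  rw [e]
  simp
  ring

/-- The exchange relation between flag minors with two and with one additional column. -/
lemma flagMinor_exchange (x y z : ℕ → R) (v : Fin m → ℕ → R) :
    flagMinor (Fin.cons x (Fin.cons y v : Fin (m + 1) → ℕ → R) : Fin (m + 2) → ℕ → R) *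
        flagMinor (Fin.cons z v : Fin (m + 1) → ℕ → R) =
      flagMinor (Fin.cons z (Fin.cons y v : Fin (m + 1) → ℕ → R) : Fin (m + 2) → ℕ → R) *
        flagMinor (Fin.cons x v : Fin (m + 1) → ℕ → R) +
      flagMinor (Fin.cons x (Fin.cons z v : Fin (m + 1) → ℕ → R) : Fin (m + 2) → ℕ → R) *
        flagMinor (Fin.cons y v : Fin (m + 1) → ℕ → R) := by
  obtain ⟨K, hK⟩ := exists_flagMinor_cons_eq v
  set u : Fin (m + 2) → ℕ → R := Fin.cons x (Fin.cons y v : Fin (m + 1) → ℕ → R) with hu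
  set B : Matrix (Fin (m + 2)) (Fin (m + 2)) R := Matrix.of fun r s => u s r with hB
  -- Cramer's rule writes `det B • z` in terms of the columns `u`, all with `m + 2` rows. Applying
  -- the linear form `K`, which uses only the first `m + 1` rows, kills every column taken from `v`;
  -- two terms remain.
  have h1 := Matrix.mulVec_cramer B fun r => z r
  have h2 : ∀ r : Fin (m + 2), ∑ i, u i r * B.cramer (fun r => z r) i = B.det * z r := fun r => by
    have := congrFun h1 r
    simpa [Matrix.mulVec, dotProduct, hB] using this
  have h3 : B.det * flagMinor (Fin.cons z v : Fin (m + 1) → ℕ → R) =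
      ∑ i, B.cramer (fun r => z r) i * flagMinor (Fin.cons (u i) v : Fin (m + 1) → ℕ → R) := by
    simp only [hK, Finset.mul_sum]
    rw [Finset.sum_comm]
    refine Finset.sum_congr rfl fun r _ => ?_
    have h4 := h2 r.castSucc
    simp only [Fin.val_castSucc] at h4
    rw [mul_left_comm, ← h4, Finset.mul_sum]
    exact Finset.sum_congr rfl fun i _ => by ring
  have h5 : ∀ i, B.cramer (fun r => z r) i = flagMinor (Function.update u i z) := by
    intro i
    rw [Matrix.cramer_apply, flagMinor]
    congr 1
    ext r s
    by_cases hs : s = i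
    · subst hs; simp
    · simp [hs, hB]
  change B.det * _ = _
  rw [h3, Fin.sum_univ_succ, Fin.sum_univ_succ]
  have h6 : ∀ i : Fin m, flagMinor (Fin.cons (u i.succ.succ) v : Fin (m + 1) → ℕ → R) = 0 :=
    fun i => flagMinor_eq_zero (i := 0) (j := i.succ) (Fin.succ_ne_zero i).symm (by simp [hu])
  rw [Finset.sum_eq_zero fun i _ => by rw [h6, mul_zero], h5, h5, add_zero]
  have h7 : Function.update u 0 z = Fin.cons z (Fin.cons y v : Fin (m + 1) → ℕ → R) := by
    rw [hu, Fin.update_cons_zero]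
  have h8 : Function.update u (Fin.succ 0) z = Fin.cons x (Fin.cons z v : Fin (m + 1) → ℕ → R) := by
    rw [hu, ← Fin.cons_update, Fin.update_cons_zero]
  rw [h7, h8]
  rfl

/-- The three-term relation between flag minors of columns `a`, `b` and a column `k` between them,
given in increasing order. -/
lemma flagMinor_three_term (a b k : ℕ → R) (v : Fin m → ℕ → R) (r : Fin (m + 1)) :
    flagMinor (Fin.cons a (Fin.snoc v b : Fin (m + 1) → ℕ → R) : Fin (m + 2) → ℕ → R) *
        flagMinor (Fin.insertNth r k v : Fin (m + 1) → ℕ → R) =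
      flagMinor (Fin.cons a v : Fin (m + 1) → ℕ → R) *
        flagMinor (Fin.snoc (Fin.insertNth r k v : Fin (m + 1) → ℕ → R) b : Fin (m + 2) → ℕ → R) +
      flagMinor (Fin.snoc v b : Fin (m + 1) → ℕ → R) *
        flagMinor (Fin.cons a (Fin.insertNth r k v : Fin (m + 1) → ℕ → R) :
          Fin (m + 2) → ℕ → R) := by
  have swap : ∀ x y : ℕ → R,
      flagMinor (Fin.cons x (Fin.cons y v : Fin (m + 1) → ℕ → R) : Fin (m + 2) → ℕ → R) =
      - flagMinor (Fin.cons y (Fin.cons x v : Fin (m + 1) → ℕ → R) : Fin (m + 2) → ℕ → R) := by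
    intro x y
    have h := flagMinor_insertNth (1 : Fin (m + 2)) y (Fin.cons x v : Fin (m + 1) → ℕ → R)
    rw [← Fin.succ_zero_eq_one, Fin.insertNth_succ_cons, Fin.insertNth_zero'] at h
    rw [h]
    simp
  -- The columns `a`, `b`, `k` are moved to the front in all minors; the signs agree in the three
  -- products, so the exchange relation applies.
  have e1 : flagMinor (Fin.cons a (Fin.snoc v b : Fin (m + 1) → ℕ → R) : Fin (m + 2) → ℕ → R) =
      (-1) ^ m * flagMinor (Fin.cons a (Fin.cons b v : Fin (m + 1) → ℕ → R) : Fin (m + 2) → ℕ → R) := by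
    rw [← Fin.insertNth_last', ← Fin.insertNth_succ_cons, flagMinor_insertNth, swap]
    simp [pow_succ]
  have e2 := flagMinor_insertNth r k v
  have e3 : flagMinor (Fin.snoc (Fin.insertNth r k v : Fin (m + 1) → ℕ → R) b :
      Fin (m + 2) → ℕ → R) = (-1) ^ (m + r : ℕ) *
      flagMinor (Fin.cons k (Fin.cons b v : Fin (m + 1) → ℕ → R) : Fin (m + 2) → ℕ → R) := by
    rw [← Fin.insertNth_last', flagMinor_insertNth, ← Fin.insertNth_succ_cons, flagMinor_insertNth]
    simp only [Fin.val_last, Fin.val_succ, pow_succ, pow_add]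
    ring
  have e4 : flagMinor (Fin.snoc v b : Fin (m + 1) → ℕ → R) =
      (-1) ^ m * flagMinor (Fin.cons b v : Fin (m + 1) → ℕ → R) := by
    rw [← Fin.insertNth_last', flagMinor_insertNth, Fin.val_last]
  have e5 : flagMinor (Fin.cons a (Fin.insertNth r k v : Fin (m + 1) → ℕ → R) :
      Fin (m + 2) → ℕ → R) = (-1) ^ (r : ℕ) *
      flagMinor (Fin.cons a (Fin.cons k v : Fin (m + 1) → ℕ → R) : Fin (m + 2) → ℕ → R) := by
    rw [← Fin.insertNth_succ_cons, flagMinor_insertNth, swap]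
    simp [pow_succ]
  rw [e1, e2, e3, e4, e5, pow_add]
  have := flagMinor_exchange a b k v
  linear_combination ((-1) ^ m * (-1) ^ (r : ℕ)) * this

end FlagMinor

/-! ### A matrix with prescribed interval minors -/

/-- The entries of a matrix, the minors of which with the first rows and an interval of columns are
powers of the variable, the exponents of which are the numbers of loops in the interval. -/
def entry : ℕ → (ℕ → ℕ → ℕ) → ℕ → Polynomial ℝ
  | 0, _, _ => 1
  | k + 1, p, j => ∑ c ∈ Finset.range j,
      Polynomial.X ^ p c (c + 1) * entry k (fun a b => p a (b + 1)) c

/-- Differences of neighbouring columns are columns for the array shifted by one, multiplied by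
powers of the variable. Both the determinants and the kernels on intervals are computed by this
reduction. -/
lemma entry_succ_succ (k : ℕ) (p : ℕ → ℕ → ℕ) (j : ℕ) : entry (k + 1) p (j + 1) =
    entry (k + 1) p j + Polynomial.X ^ p j (j + 1) * entry k (fun a b => p a (b + 1)) j := by
  rw [entry, Finset.sum_range_succ, ← entry]

/-- A column of the matrix. -/
def column (p : ℕ → ℕ → ℕ) (j k : ℕ) : Polynomial ℝ := entry k p j

/-- The exponents of the interval minors. -/
def intervalExp : (ℕ → ℕ → ℕ) → ℕ → ℕ → ℕ
  | _, _, 0 => 0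
  | p, a, m + 1 => (∑ j ∈ Finset.range m, p (a + j) (a + j + 1)) +
      intervalExp (fun a b => p a (b + 1)) a m

lemma intervalExp_zero (p : ℕ → ℕ → ℕ) (a : ℕ) : intervalExp p a 0 = 0 := by rw [intervalExp]

lemma intervalExp_succ (p : ℕ → ℕ → ℕ) (a m : ℕ) : intervalExp p a (m + 1) =
    (∑ j ∈ Finset.range m, p (a + j) (a + j + 1)) + intervalExp (fun a b => p a (b + 1)) a m := by
  rw [intervalExp]

lemma intervalExp_rec (p : ℕ → ℕ → ℕ) (a m : ℕ) :
    intervalExp p a (m + 2) + intervalExp p (a + 1) m =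
      intervalExp p (a + 1) (m + 1) + intervalExp p a (m + 1) + p a (a + m + 1) := by
  induction m generalizing p with
  | zero => simp [intervalExp_succ, intervalExp_zero]
  | succ m ih =>
    have h := ih fun a b => p a (b + 1)
    rw [intervalExp_succ p a (m + 2), intervalExp_succ p (a + 1) m,
      intervalExp_succ p (a + 1) (m + 1), intervalExp_succ p a (m + 1),
      Finset.sum_range_succ (fun j => p (a + j) (a + j + 1)) (m + 1),
      Finset.sum_range_succ (fun j => p (a + 1 + j) (a + 1 + j + 1)) m]
    have e1 : a + 1 + m = a + (m + 1) := by omega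
    have e2 : a + m + 1 + 1 = a + (m + 1) + 1 := by omega
    rw [e1]
    simp only [e2] at h
    omega

/-- Both sides obey the same inclusion–exclusion recursion, `intervalExp_rec` and `cnt_rec`. The `m
+ 1` columns are those from `a` to `a + m`. -/
lemma intervalExp_mult {n : ℕ} (p : KostantPicture n) (a m : ℕ) :
    intervalExp (mult p) a (m + 1) = cnt p a (a + m) := by
  induction m using Nat.strong_induction_on generalizing a with
  | _ m ih =>
    match m with
    | 0 => rw [intervalExp_succ, intervalExp_zero, cnt_eq_zero p (a := a) (b := a + 0) le_rfl]; simp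
    | 1 =>
      have h1 := intervalExp_rec (mult p) a 0
      have h2 := cnt_rec p (a := a) (b := a + 1) (by omega)
      have h3 := ih 0 (by omega) a
      have h4 := ih 0 (by omega) (a + 1)
      rw [intervalExp_zero] at h1
      rw [cnt_eq_zero p (a := a + 1) (b := a + 1 - 1) (by omega)] at h2
      simp only [add_zero, zero_add, add_tsub_cancel_right] at h1 h2 h3 h4
      change intervalExp (mult p) a 2 = _
      omega
    | m + 2 =>
      have h1 := intervalExp_rec (mult p) a (m + 1)
      have h2 := cnt_rec p (a := a) (b := a + (m + 2)) (by omega)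
      have h3 := ih (m + 1) (by omega) a
      have h4 := ih (m + 1) (by omega) (a + 1)
      have h5 := ih m (by omega) (a + 1)
      have e1 : a + (m + 2) - 1 = a + (m + 1) := by omega
      have e2 : a + 1 + (m + 1) = a + (m + 2) := by omega
      have e3 : a + 1 + m = a + (m + 1) := by omega
      have e4 : a + (m + 1) + 1 = a + (m + 2) := by omega
      rw [e1] at h2
      rw [e2] at h4
      rw [e3] at h5
      rw [e4] at h1
      change intervalExp (mult p) a (m + 1 + 2) = _
      omega

/-- The interval minors are powers of the variable. -/
lemma flagMinor_interval (p : ℕ → ℕ → ℕ) (a m : ℕ) :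
    flagMinor (fun s : Fin m => column p (a + s)) = Polynomial.X ^ intervalExp p a m := by
  induction m generalizing p with
  | zero => simp [flagMinor, intervalExp_zero]
  | succ m ih =>
    -- Subtracting from each column its predecessor makes the first row `(1, 0, …, 0)`. What remains
    -- is the matrix of the shifted array with columns scaled by powers of the variable.
    have h1 : flagMinor (fun s : Fin (m + 1) => column p (a + s)) =
        (Matrix.of fun r s : Fin (m + 1) => Fin.cases (entry r p a) (fun j : Fin m =>
          entry r p (a + j + 1) - entry r p (a + j)) s).det := by
      rw [flagMinor]
      apply Matrix.det_eq_of_forall_col_eq_smul_add_pred (fun _ => 1)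
      · intro i; simp [column]
      · intro i j; simp [column, add_assoc]
    rw [h1, Matrix.det_succ_row_zero, Fin.sum_univ_succ, Finset.sum_eq_zero, add_zero]
    · have h2 : ((Matrix.of fun r s : Fin (m + 1) => (Fin.cases (entry r p a) (fun j : Fin m =>
          entry r p (a + j + 1) - entry r p (a + j)) s : Polynomial ℝ)).submatrix Fin.succ
          (Fin.succAbove 0)) = Matrix.of fun r s : Fin m => Polynomial.X ^ p (a + s) (a + s + 1) *
          (Matrix.of fun r s : Fin m => column (fun a b => p a (b + 1)) (a + s) r) r s := by
        ext1 r s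
        simp [column, entry_succ_succ]
      rw [h2, Matrix.det_mul_row, ← flagMinor, ih, intervalExp_succ, pow_add,
        Finset.prod_pow_eq_pow_sum, Finset.sum_range]
      simp [entry]
    · intro i _
      simp [entry]

end

section

/-! ### A lattice with tropical dimensions -/

/-- The polynomial vanishes at zero of order `v`, with positive leading coefficient. -/
def HasPosOrder (f : Polynomial ℝ) (v : ℕ) : Prop :=
  ∃ u : Polynomial ℝ, f = Polynomial.X ^ v * u ∧ 0 < u.coeff 0

lemma X_pow_mul_unique {f g : Polynomial ℝ} {a b : ℕ} (hf : f.coeff 0 ≠ 0) (hg : g.coeff 0 ≠ 0)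
    (h : Polynomial.X ^ a * f = Polynomial.X ^ b * g) : a = b ∧ f = g := by
  have key : ∀ {f g : Polynomial ℝ} {a b : ℕ}, f.coeff 0 ≠ 0 → a ≤ b →
      Polynomial.X ^ a * f = Polynomial.X ^ b * g → a = b := by
    intro f g a b hf hab h
    obtain ⟨c, rfl⟩ := Nat.exists_eq_add_of_le hab
    rw [pow_add, mul_assoc] at h
    have h1 := mul_left_cancel₀ (pow_ne_zero a Polynomial.X_ne_zero) h
    rcases Nat.eq_zero_or_pos c with rfl | hc
    · rfl
    · obtain ⟨c, rfl⟩ := Nat.exists_eq_succ_of_ne_zero hc.ne'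
      rw [h1, pow_succ', mul_assoc, Polynomial.coeff_X_mul_zero] at hf
      exact absurd rfl hf
  have hab : a = b := by
    rcases le_total a b with h' | h'
    · exact key hf h' h
    · exact (key hg h' h.symm).symm
  subst hab
  exact ⟨rfl, mul_left_cancel₀ (pow_ne_zero a Polynomial.X_ne_zero) h⟩

namespace HasPosOrder

variable {f g : Polynomial ℝ} {a b : ℕ}

lemma mul (h : HasPosOrder f a) (h' : HasPosOrder g b) : HasPosOrder (f * g) (a + b) := by
  obtain ⟨u, rfl, hu0⟩ := h
  obtain ⟨u', rfl, hu0'⟩ := h'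
  exact ⟨u * u', by ring, by rw [Polynomial.mul_coeff_zero]; exact mul_pos hu0 hu0'⟩

/-- Positive lowest coefficients cannot cancel, so the order of a sum is exactly the minimum. For
this reason the matrix is real rather than complex. -/
lemma add (h : HasPosOrder f a) (h' : HasPosOrder g b) : HasPosOrder (f + g) (min a b) := by
  have key : ∀ {f g : Polynomial ℝ} {a b : ℕ}, HasPosOrder f a → HasPosOrder g b → a ≤ b →
      HasPosOrder (f + g) a := by
    rintro _ _ a b ⟨u, rfl, hu0⟩ ⟨u', rfl, hu0'⟩ hab
    obtain ⟨c, rfl⟩ := Nat.exists_eq_add_of_le hab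
    refine ⟨u + Polynomial.X ^ c * u', by ring, ?_⟩
    rw [Polynomial.coeff_add, Polynomial.mul_coeff_zero, Polynomial.coeff_X_pow]
    split_ifs
    · linarith
    · linarith
  rcases le_total a b with h1 | h1
  · rw [min_eq_left h1]; exact key h h' h1
  · rw [min_eq_right h1, add_comm]; exact key h' h h1

lemma of_mul (h : HasPosOrder (f * g) a) (h' : HasPosOrder g b) :
    ∃ c, HasPosOrder f c ∧ c + b = a := by
  obtain ⟨u, hu, hu0⟩ := h
  obtain ⟨u', rfl, hu0'⟩ := h'
  have hf : f ≠ 0 := by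
    rintro rfl
    rw [zero_mul] at hu
    have : u = 0 := by
      rcases mul_eq_zero.mp hu.symm with h | h
      · exact absurd h (pow_ne_zero a Polynomial.X_ne_zero)
      · exact h
    rw [this] at hu0
    exact lt_irrefl _ hu0
  obtain ⟨q, hq, hq0⟩ := Polynomial.exists_eq_pow_rootMultiplicity_mul_and_not_dvd f hf 0
  rw [Polynomial.C_0, sub_zero] at hq hq0
  rw [Polynomial.X_dvd_iff] at hq0
  set c := f.rootMultiplicity 0
  have h1 : Polynomial.X ^ (c + b) * (q * u') = Polynomial.X ^ a * u := by
    rw [← hu, hq]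
    ring
  have h2 : (q * u').coeff 0 ≠ 0 := by
    rw [Polynomial.mul_coeff_zero]
    exact mul_ne_zero hq0 hu0'.ne'
  obtain ⟨h3, h4⟩ := X_pow_mul_unique h2 hu0.ne' h1
  rw [← h4, Polynomial.mul_coeff_zero] at hu0
  exact ⟨c, ⟨q, hq, pos_of_mul_pos_left hu0 hu0'.le⟩, h3⟩

end HasPosOrder

/-- The common kernel of some columns of the matrix. -/
def columnKer (p : ℕ → ℕ → ℕ) {m : ℕ} (c : Fin m → ℕ) : Submodule ℂ (P m) :=
  rowKer fun (k : ℕ) (s : Fin m) => (column p (c s) k).map (algebraMap ℝ ℂ)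

/-- The first `m` rows alone already cut out a space of dimension at most the order of their
determinant. -/
lemma rank_columnKer_le {p : ℕ → ℕ → ℕ} {m v : ℕ} {c : Fin m → ℕ}
    (h : HasPosOrder (flagMinor fun s => column p (c s)) v) :
    Module.rank ℂ (columnKer p c) ≤ v := by
  obtain ⟨u, hu, hu0⟩ := h
  set A : Matrix (Fin m) (Fin m) (Polynomial ℝ) := Matrix.of fun r s => column p (c s) r with hA
  have h1 : ((Polynomial.mapRingHom (algebraMap ℝ ℂ)).mapMatrix A).det =
      Polynomial.X ^ v * u.map (algebraMap ℝ ℂ) := by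
    rw [← RingHom.map_det]
    change (Polynomial.mapRingHom (algebraMap ℝ ℂ)) (flagMinor fun s => column p (c s)) = _
    rw [hu]
    simp
  refine le_trans (Submodule.rank_mono ?_) (rank_rowKer_le _ _ h1 (by simpa using hu0.ne'))
  intro x hx
  rw [columnKer, mem_rowKer] at hx
  rw [mem_rowKer]
  exact fun k => hx k

lemma hasPosOrder_X_pow (v : ℕ) : HasPosOrder (Polynomial.X ^ v) v := ⟨1, by simp, by simp⟩

lemma finiteDimensional_columnKer_interval (p : ℕ → ℕ → ℕ) (a m : ℕ) :
    FiniteDimensional ℂ (columnKer p fun s : Fin m => a + s) := by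
  apply finiteDimensional_of_rank_le (v := intervalExp p a m)
  apply rank_columnKer_le
  rw [flagMinor_interval]
  exact hasPosOrder_X_pow _

/-- The coordinatewise action of powers of `t`. -/
def powAct {m : ℕ} (e : Fin m → ℕ) : P m →ₗ[ℂ] P m := LinearMap.pi fun j => (dX ^ e j).comp (pr j)

/-- The operator `dX ^ e j` is surjective and kills the `e j`-dimensional space of polynomials of
degree below `e j`. -/
lemma finrank_comap_powAct {m : ℕ} (e : Fin m → ℕ) (K : Submodule ℂ (P m))
    [FiniteDimensional ℂ (K.comap (powAct e))] :
    ∑ j, e j + Module.finrank ℂ K ≤ Module.finrank ℂ (K.comap (powAct e)) := by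
  have h := LinearMap.finrank_range_add_finrank_ker ((powAct e).domRestrict (K.comap (powAct e)))
  have h1 : LinearMap.range ((powAct e).domRestrict (K.comap (powAct e))) = K := by
    rw [LinearMap.range_domRestrict, Submodule.map_comap_eq, inf_eq_right]
    intro x _
    choose g hg using fun j => dX_pow_surjective (e j) (x j)
    exact ⟨g, funext hg⟩
  rw [h1] at h
  have h2 : ∑ j, e j ≤
      Module.finrank ℂ (LinearMap.ker ((powAct e).domRestrict (K.comap (powAct e)))) := by
    have hker : ∀ x : ∀ j, Polynomial.degreeLT ℂ (e j), powAct e (fun j => (x j : E)) = 0 := by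
      intro x
      ext j k
      have := mem_degreeLT_iff_coeff.mp (x j).2 (k + e j) (by omega)
      simpa [powAct, coeff_dX_pow] using this
    let f : (∀ j, Polynomial.degreeLT ℂ (e j)) →ₗ[ℂ]
        LinearMap.ker ((powAct e).domRestrict (K.comap (powAct e))) :=
      { toFun := fun x => ⟨⟨fun j => (x j : E), by
          rw [Submodule.mem_comap, hker]; exact zero_mem K⟩, hker x⟩
        map_add' := fun _ _ => rfl
        map_smul' := fun _ _ => rfl }
    have hf : Function.Injective f := by
      intro x y hxy
      have h3 : (fun j => (x j : E)) = fun j => (y j : E) :=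
        congrArg (fun z => ((z.1.1 : P m))) hxy
      funext j
      exact Subtype.ext (congrFun h3 j)
    have h4 := LinearMap.finrank_le_finrank_of_injective hf
    rw [Module.finrank_pi_fintype] at h4
    simpa only [finrank_degreeLT] using h4
  omega

/-- Summation by parts: the vectors `f s` satisfy the constant first row, and on them every other
row becomes a row of the shifted array composed with the powers `t^{e j}`. So the kernel for the
shifted array, pulled back along these powers, embeds. -/
lemma le_finrank_columnKer_interval (p : ℕ → ℕ → ℕ) (a m : ℕ) :
    intervalExp p a m ≤ Module.finrank ℂ (columnKer p fun s : Fin m => a + s) := by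
  induction m generalizing p with
  | zero => rw [intervalExp_zero]; exact Nat.zero_le _
  | succ m ih =>
    set p' : ℕ → ℕ → ℕ := fun a b => p a (b + 1) with hp'
    set e : Fin m → ℕ := fun j => p (a + j) (a + j + 1) with he
    -- In coordinates `(f s)_j = s_{j-1} - s_j`, with zeros beyond both ends.
    set f : P m →ₗ[ℂ] P (m + 1) :=
      LinearMap.pi (Fin.cons 0 pr : Fin (m + 1) → P m →ₗ[ℂ] E) -
        LinearMap.pi (Fin.snoc pr 0 : Fin (m + 1) → P m →ₗ[ℂ] E) with hfdef
    have hf : Function.Injective f := by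
      rw [← LinearMap.ker_eq_bot, eq_bot_iff]
      intro s hs
      -- The equations `f s = 0` read `s_j = s_{j-1}` with `s_{-1} = 0`.
      have h0 : ∀ j : Fin m, (Fin.cons 0 pr : Fin (m + 1) → P m →ₗ[ℂ] E) j.castSucc s = s j := by
        intro j
        have := congrFun (LinearMap.mem_ker.mp hs) j.castSucc
        simpa [hfdef, sub_eq_zero] using this
      have h1 : ∀ (k : ℕ) (hk : k < m), s ⟨k, hk⟩ = 0 := by
        intro k
        induction k with
        | zero =>
          intro hk
          rw [← h0]
          obtain ⟨m, rfl⟩ := Nat.exists_eq_succ_of_ne_zero hk.ne'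
          rfl
        | succ k ih =>
          intro hk
          rw [← h0]
          exact ih (by omega)
      exact funext fun j => h1 j j.2
    have hmem : ((columnKer p' fun s : Fin m => a + s).comap (powAct e)).map f ≤
        columnKer p fun s : Fin (m + 1) => a + s := by
      rintro _ ⟨s, hs, rfl⟩
      rw [SetLike.mem_coe, Submodule.mem_comap, columnKer, mem_rowKer] at hs
      rw [columnKer, mem_rowKer]
      intro k
      have h1 : ∀ b : Fin (m + 1) → Polynomial ℂ, rowAct b (f s) =
          rowAct (fun j : Fin m => b j.succ - b j.castSucc) s := by
        intro b
        rw [hfdef, LinearMap.sub_apply, map_sub, rowAct_apply, rowAct_apply, rowAct_apply,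
          Fin.sum_univ_succ, Fin.sum_univ_castSucc (n := m)]
        simp [Finset.sum_sub_distrib]
      rw [h1]
      cases k with
      | zero => simp [column, entry, rowAct_apply]
      | succ k =>
        have h2 := hs k
        rw [rowAct_apply] at h2 ⊢
        rw [← h2]
        refine Finset.sum_congr rfl fun j _ => ?_
        simp only [Fin.val_succ, Fin.val_castSucc, column, ← add_assoc, entry_succ_succ]
        simp only [Polynomial.map_add, Polynomial.map_mul, Polynomial.map_pow, Polynomial.map_X,
          add_sub_cancel_left, map_mul, act_X_pow, powAct, LinearMap.pi_apply,
          LinearMap.coe_comp, Function.comp_apply, LinearMap.proj_apply, Module.End.mul_apply]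
        rw [← act_X_pow, ← Module.End.mul_apply, ← Module.End.mul_apply, ← map_mul, ← map_mul,
          mul_comm]
    have : FiniteDimensional ℂ (columnKer p fun s : Fin (m + 1) => a + s) :=
      finiteDimensional_columnKer_interval p a (m + 1)
    have h3 := Submodule.finrank_mono hmem
    have : FiniteDimensional ℂ
        (((columnKer p' fun s : Fin m => a + s).comap (powAct e)).map f) :=
      Submodule.finiteDimensional_of_le hmem
    have : FiniteDimensional ℂ ((columnKer p' fun s : Fin m => a + s).comap (powAct e)) :=
      Module.Finite.equiv (Submodule.equivMapOfInjective f hf _).symm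
    have h4 := finrank_comap_powAct e (columnKer p' fun s : Fin m => a + s)
    rw [(Submodule.equivMapOfInjective f hf
      ((columnKer p' fun s : Fin m => a + s).comap (powAct e))).finrank_eq] at h4
    have h5 := ih p'
    rw [intervalExp_succ, Finset.sum_range]
    change ∑ j, e j + intervalExp p' a m ≤ _
    omega

end

section

variable {n : ℕ}

/-! ### Strictly increasing families of columns -/

lemma strictMono_cons {m : ℕ} {a : Fin n} {c : Fin m → Fin n} (hc : StrictMono c)
    (ha : ∀ s, a < c s) : StrictMono (Fin.cons a c : Fin (m + 1) → Fin n) := by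
  intro i j hij
  induction j using Fin.cases with
  | zero => exact absurd hij (Fin.not_lt_zero i)
  | succ j =>
    induction i using Fin.cases with
    | zero => simpa using ha j
    | succ i => simpa using hc (Fin.succ_lt_succ_iff.mp hij)

lemma strictMono_snoc {m : ℕ} {b : Fin n} {c : Fin m → Fin n} (hc : StrictMono c)
    (hb : ∀ s, c s < b) : StrictMono (Fin.snoc c b : Fin (m + 1) → Fin n) := by
  intro i j hij
  induction i using Fin.lastCases with
  | last => exact absurd hij (Fin.le_last j).not_gt
  | cast i =>
    induction j using Fin.lastCases with
    | last => simpa using hb i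
    | cast j => simpa using hc (Fin.castSucc_lt_castSucc_iff.mp hij)

lemma range_insertNth {α : Type*} {m : ℕ} (r : Fin (m + 1)) (x : α) (c : Fin m → α) :
    Set.range (Fin.insertNth r x c : Fin (m + 1) → α) = insert x (Set.range c) := by
  ext y
  simp only [Set.mem_range, Set.mem_insert_iff, Fin.exists_iff_succAbove r,
    Fin.insertNth_apply_same, Fin.insertNth_apply_succAbove]
  rw [eq_comm]

lemma range_cons' {α : Type*} {m : ℕ} (x : α) (c : Fin m → α) :
    Set.range (Fin.cons x c : Fin (m + 1) → α) = insert x (Set.range c) := by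
  rw [← Fin.insertNth_zero', range_insertNth]

lemma range_snoc' {α : Type*} {m : ℕ} (x : α) (c : Fin m → α) :
    Set.range (Fin.snoc c x : Fin (m + 1) → α) = insert x (Set.range c) := by
  rw [← Fin.insertNth_last', range_insertNth]

lemma comp_insertNth {α β : Type*} {m : ℕ} (g : α → β) (r : Fin (m + 1)) (x : α) (c : Fin m → α) :
    (fun s => g ((Fin.insertNth r x c : Fin (m + 1) → α) s)) =
      (Fin.insertNth r (g x) (fun s => g (c s)) : Fin (m + 1) → β) := by
  funext s
  induction s using Fin.succAboveCases r with
  | x => simp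
  | p s => simp

lemma comp_cons' {α β : Type*} {m : ℕ} (g : α → β) (x : α) (c : Fin m → α) :
    (fun s => g ((Fin.cons x c : Fin (m + 1) → α) s)) =
      (Fin.cons (g x) (fun s => g (c s)) : Fin (m + 1) → β) := Fin.comp_cons g x c

lemma comp_snoc' {α β : Type*} {m : ℕ} (g : α → β) (x : α) (c : Fin m → α) :
    (fun s => g ((Fin.snoc c x : Fin (m + 1) → α) s)) =
      (Fin.snoc (fun s => g (c s)) (g x) : Fin (m + 1) → β) := Fin.comp_snoc g c x

lemma exists_strictMono_range_eq (S : Set (Fin n)) :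
    ∃ (m : ℕ) (c : Fin m → Fin n), StrictMono c ∧ Set.range c = S := by
  classical
  refine ⟨S.toFinset.card, S.toFinset.orderEmbOfFin rfl, OrderEmbedding.strictMono _, ?_⟩
  rw [Finset.range_orderEmbOfFin, Set.coe_toFinset]

/-- The position `r` is found by sorting the enlarged set; the sorted enumeration without `k` must
be `c`. -/
lemma exists_strictMono_insertNth {m : ℕ} {c : Fin m → Fin n} (hc : StrictMono c) {k : Fin n}
    (hk : k ∉ Set.range c) :
    ∃ r : Fin (m + 1), StrictMono (Fin.insertNth r k c : Fin (m + 1) → Fin n) := by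
  classical
  set T : Finset (Fin n) := insert k (Finset.univ.image c) with hT
  have hcard : T.card = m + 1 := by
    rw [hT, Finset.card_insert_of_notMem (by simpa using hk),
      Finset.card_image_of_injective _ hc.injective, Finset.card_univ, Fintype.card_fin]
  set F := T.orderEmbOfFin hcard
  have hF : Set.range F = insert k (Set.range c) := by
    rw [Finset.range_orderEmbOfFin, hT]
    simp
  obtain ⟨r, hr⟩ : k ∈ Set.range F := hF ▸ Set.mem_insert _ _
  refine ⟨r, ?_⟩
  have h1 : Fin.insertNth r k (fun s => F (r.succAbove s)) = F := by
    rw [← hr]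
    exact Fin.insertNth_self_removeNth r F
  have h2 : StrictMono fun s => F (r.succAbove s) :=
    F.strictMono.comp (Fin.strictMono_succAbove r)
  have h3 : (fun s => F (r.succAbove s)) = c := by
    rw [← StrictMono.range_inj h2 hc]
    have h4 : k ∉ Set.range fun s => F (r.succAbove s) := by
      rintro ⟨s, hs⟩
      exact Fin.succAbove_ne r s (F.injective (hs.trans hr.symm))
    have h5 := range_insertNth r k fun s => F (r.succAbove s)
    rw [h1, hF] at h5
    ext y
    have h6 := Set.ext_iff.mp h5 y
    simp only [Set.mem_insert_iff] at h6
    by_cases hy : y = k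
    · subst hy
      exact iff_of_false h4 hk
    · simpa [hy] using h6.symm
  rw [← h3, h1]
  exact F.strictMono

/-- A strictly increasing family of columns that is not an interval leaves out a column. -/
lemma exists_gap {m : ℕ} {c : Fin (m + 1) → Fin n} (hc : StrictMono c)
    (h : ¬ ∃ a : ℕ, ∀ s, (c s : ℕ) = a + s) :
    ∃ k, k ∉ Set.range c ∧ c 0 < k ∧ k < c (Fin.last m) := by
  by_contra! hk
  apply h
  refine ⟨c 0, fun s => ?_⟩
  induction s using Fin.induction with
  | zero => simp
  | succ s ih =>
    have h1 : c s.castSucc < c s.succ := hc (Fin.castSucc_lt_succ)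
    have h2 : (c s.castSucc : ℕ) < c s.succ := h1
    by_contra h3
    simp only [Fin.val_castSucc, Fin.val_succ] at ih h3
    have h4 : (c s.castSucc : ℕ) + 1 < n := by have := (c s.succ).2; omega
    have h5 : (⟨c s.castSucc + 1, h4⟩ : Fin n) ∉ Set.range c := by
      rintro ⟨t, ht⟩
      have h6 : c s.castSucc < c t := by rw [ht, Fin.lt_def]; simp
      have h7 : c t < c s.succ := by rw [ht, Fin.lt_def]; simp only; omega
      have h8 := hc.lt_iff_lt.mp h6
      have h9 := hc.lt_iff_lt.mp h7
      rw [Fin.lt_def] at h8 h9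
      simp only [Fin.val_castSucc, Fin.val_succ] at h8 h9
      omega
    have h6 := hk _ h5 (lt_of_le_of_lt (hc.monotone (Fin.zero_le s.castSucc))
      (by rw [Fin.lt_def]; simp))
    have h8 := hc.monotone (Fin.le_last s.succ)
    rw [Fin.le_def] at h6 h8
    simp only at h6
    omega

end

/-! ### The kernel of the matrix and its tropical dimensions -/

section

variable {n : ℕ}

/-- The common kernel of the matrix with `n` columns. -/
def star (n : ℕ) (p : ℕ → ℕ → ℕ) : Submodule ℂ (P n) := columnKer p fun j : Fin n => (j : ℕ)

lemma tau_mem_star {p : ℕ → ℕ → ℕ} {x : P n} (hx : x ∈ star n p) : tau x ∈ star n p := by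
  rw [star, columnKer, mem_rowKer] at *
  intro k
  rw [rowAct_tau, hx k, map_zero]

instance (p : ℕ → ℕ → ℕ) : FiniteDimensional ℂ (star n p) := by
  have := finiteDimensional_columnKer_interval p 0 n
  have e : (fun s : Fin n => 0 + (s : ℕ)) = fun s : Fin n => (s : ℕ) :=
    funext fun s => Nat.zero_add _
  rwa [e] at this

lemma D_star_range (p : ℕ → ℕ → ℕ) {m : ℕ} {c : Fin m → Fin n} (hc : StrictMono c) :
    D (star n p) (Set.range c) = Module.finrank ℂ (columnKer p fun s => (c s : ℕ)) :=
  D_rowKer_range _ hc.injective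

lemma D_star_le {p : ℕ → ℕ → ℕ} {m v : ℕ} {c : Fin m → Fin n} (hc : StrictMono c)
    (h : HasPosOrder (flagMinor fun s => column p (c s)) v) : D (star n p) (Set.range c) ≤ v := by
  rw [D_star_range p hc]
  exact Module.finrank_le_of_rank_le (rank_columnKer_le h)

/-- The interval minor gives the upper bound, and the kernel vectors built by summation by parts
give the lower one. -/
lemma D_star_interval {p : ℕ → ℕ → ℕ} {m a : ℕ} {c : Fin m → Fin n} (hc : StrictMono c)
    (h : ∀ s, (c s : ℕ) = a + s) : D (star n p) (Set.range c) = intervalExp p a m := by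
  apply le_antisymm
  · apply D_star_le hc
    simp only [h, flagMinor_interval]
    exact hasPosOrder_X_pow _
  · rw [D_star_range p hc]
    rw [show (fun s => (c s : ℕ)) = fun s : Fin m => a + (s : ℕ) from funext h]
    exact le_finrank_columnKer_interval p a m

/-- The condition that the flag minor of the columns determines the dimension. -/
def GoodMinor (p : ℕ → ℕ → ℕ) {m : ℕ} (c : Fin m → Fin n) : Prop :=
  HasPosOrder (flagMinor fun s => column p (c s)) (D (star n p) (Set.range c))

/-- The order of vanishing in the three-term relation. -/
lemma exists_order_of_three_term {p : ℕ → ℕ → ℕ} {m : ℕ} {c : Fin m → Fin n} {a b k : Fin n}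
    {r : Fin (m + 1)} (h1 : GoodMinor p (Fin.insertNth r k c : Fin (m + 1) → Fin n))
    (h2 : GoodMinor p (Fin.cons a c : Fin (m + 1) → Fin n))
    (h3 : GoodMinor p (Fin.snoc c b : Fin (m + 1) → Fin n))
    (h4 : GoodMinor p (Fin.snoc (Fin.insertNth r k c : Fin (m + 1) → Fin n) b :
      Fin (m + 2) → Fin n))
    (h5 : GoodMinor p (Fin.cons a (Fin.insertNth r k c : Fin (m + 1) → Fin n) :
      Fin (m + 2) → Fin n)) :
    ∃ v, HasPosOrder (flagMinor fun s => column p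
        ((Fin.cons a (Fin.snoc c b : Fin (m + 1) → Fin n) : Fin (m + 2) → Fin n) s)) v ∧
      v + D (star n p) (insert k (Set.range c)) =
        min (D (star n p) (insert a (Set.range c)) + D (star n p) (insert b (insert k (Set.range c))))
          (D (star n p) (insert b (Set.range c)) +
            D (star n p) (insert a (insert k (Set.range c)))) := by
  unfold GoodMinor at h1 h2 h3 h4 h5
  rw [range_insertNth] at h1
  rw [range_cons'] at h2
  rw [range_snoc'] at h3
  rw [range_snoc', range_insertNth] at h4
  rw [range_cons', range_insertNth] at h5
  -- The right-hand side of the three-term relation has the minimum as its order; dividing by the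
  -- minor of `S ∪ {k}` gives the order of the remaining one.
  have h := (h2.mul h4).add (h3.mul h5)
  have e := flagMinor_three_term (column p a) (column p b) (column p k) (fun s => column p (c s)) r
  simp only [comp_insertNth (fun j : Fin n => column p j), comp_cons' (fun j : Fin n => column p j),
    comp_snoc' (fun j : Fin n => column p j)] at h h1 ⊢
  rw [← e] at h
  exact h.of_mul h1

/-- Intervals are known. Otherwise a column `k` is missing between the first column `a` and the last
column `b`, and the three-term relation expresses the minor through five minors of smaller width.
Its order bounds `D` from above by the determinant estimate, while `D_diff_ge` gives the same bound
from below. -/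
lemma star_goodMinor (p : ℕ → ℕ → ℕ) {m : ℕ} {c : Fin m → Fin n} (hc : StrictMono c) :
    GoodMinor p c := by
  obtain ⟨d, lo, hd⟩ : ∃ d lo : ℕ, ∀ s, lo ≤ (c s : ℕ) ∧ (c s : ℕ) ≤ lo + d :=
    ⟨n, 0, fun s => ⟨Nat.zero_le _, by have := (c s).2; omega⟩⟩
  induction d using Nat.strong_induction_on generalizing m lo with
  | _ d ih =>
    by_cases hint : ∃ a : ℕ, ∀ s, (c s : ℕ) = a + s
    · obtain ⟨a, ha⟩ := hint
      rw [GoodMinor, D_star_interval hc ha]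
      simp only [ha, flagMinor_interval]
      exact hasPosOrder_X_pow _
    obtain ⟨m, rfl⟩ : ∃ m', m = m' + 2 := by
      rcases m with _ | _ | m
      · exact absurd ⟨0, fun s => s.elim0⟩ hint
      · refine absurd ⟨c 0, fun s => ?_⟩ hint
        obtain rfl : s = 0 := Fin.ext (by have := s.2; simp only [Fin.val_zero]; omega)
        simp
      · exact ⟨m, rfl⟩
    obtain ⟨k, hk, hk1, hk2⟩ := exists_gap hc hint
    obtain ⟨a, c', rfl⟩ : ∃ a c', c = Fin.cons a c' := ⟨c 0, Fin.tail c, (Fin.cons_self_tail c).symm⟩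
    obtain ⟨S, b, rfl⟩ : ∃ S b, c' = Fin.snoc S b :=
      ⟨Fin.init c', c' (Fin.last m), (Fin.snoc_init_self c').symm⟩
    rw [Fin.cons_zero] at hk1
    rw [← Fin.succ_last, Fin.cons_succ, Fin.snoc_last] at hk2
    rw [range_cons', range_snoc'] at hk
    have hS : StrictMono S := by
      intro i j hij
      have := hc (Fin.succ_lt_succ_iff.mpr (Fin.castSucc_lt_castSucc_iff.mpr hij))
      simpa using this
    have haS : ∀ s, a < S s := by
      intro s
      have := hc (Fin.succ_pos s.castSucc)
      simpa using this
    have hSb : ∀ s, S s < b := by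
      intro s
      have := hc (Fin.succ_lt_succ_iff.mpr (Fin.castSucc_lt_last s))
      simpa using this
    have hkS : k ∉ Set.range S := fun h => hk (Set.mem_insert_of_mem _ (Set.mem_insert_of_mem _ h))
    obtain ⟨r, hr⟩ := exists_strictMono_insertNth hS hkS
    have hcb : ∀ s, (Fin.insertNth r k S : Fin (m + 1) → Fin n) s < b := by
      intro s
      induction s using Fin.succAboveCases r with
      | x => simpa using hk2
      | p s => simpa using hSb s
    have hca : ∀ s, a < (Fin.insertNth r k S : Fin (m + 1) → Fin n) s := by
      intro s
      induction s using Fin.succAboveCases r with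
      | x => simpa using hk1
      | p s => simpa using haS s
    have hab : (a : ℕ) < b := hk1.trans hk2
    have ha0 := (hd 0).1
    have hb0 := (hd (Fin.last _)).2
    rw [Fin.cons_zero] at ha0
    rw [← Fin.succ_last, Fin.cons_succ, Fin.snoc_last] at hb0
    -- Each of the five other column sets omits `a` or `b`, so it fits into a range of width `b - a
    -- - 1`.
    have hd' : (b : ℕ) - a - 1 < d := by omega
    obtain ⟨v, hv1, hv2⟩ := exists_order_of_three_term (p := p) (c := S) (a := a) (b := b) (k := k)
      (r := r)
      (ih _ hd' hr a fun s => ⟨(hca s).le, by have : _ < (b : ℕ) := hcb s; omega⟩)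
      (ih _ hd' (strictMono_cons hS haS) a fun s => by
        induction s using Fin.cases with
        | zero => simp
        | succ s =>
          have h1 : (a : ℕ) < S s := haS s
          have h2 : (S s : ℕ) < b := hSb s
          rw [Fin.cons_succ]; omega)
      (ih _ hd' (strictMono_snoc hS hSb) (a + 1) fun s => by
        induction s using Fin.lastCases with
        | last => rw [Fin.snoc_last]; omega
        | cast s =>
          have h1 : (a : ℕ) < S s := haS s
          have h2 : (S s : ℕ) < b := hSb s
          rw [Fin.snoc_castSucc]; omega)
      (ih _ hd' (strictMono_snoc hr hcb) (a + 1) fun s => by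
        induction s using Fin.lastCases with
        | last => rw [Fin.snoc_last]; omega
        | cast s =>
          have h1 : (a : ℕ) < _ := hca s
          have h2 : _ < (b : ℕ) := hcb s
          rw [Fin.snoc_castSucc]; omega)
      (ih _ hd' (strictMono_cons hr hca) a fun s => by
        induction s using Fin.cases with
        | zero => simp
        | succ s =>
          have h1 : (a : ℕ) < _ := hca s
          have h2 : _ < (b : ℕ) := hcb s
          rw [Fin.cons_succ]; omega)
    have hle := D_star_le hc hv1
    have hak : a ≠ k := hk1.ne
    have hbk : b ≠ k := hk2.ne'
    have haS' : a ∉ Set.range S := by rintro ⟨s, hs⟩; exact (haS s).ne hs.symm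
    have hbS' : b ∉ Set.range S := by rintro ⟨s, hs⟩; exact (hSb s).ne hs
    have hab' : a ≠ b := (hk1.trans hk2).ne
    -- Removing `k` from `S ∪ {a, b, k}`, which is the union of `S ∪ {b, k}` and `S ∪ {a, k}`,
    -- bounds `D` of `S ∪ {a, b}` from below by the order `v`.
    have hge := D_diff_ge (star n p) (fun x hx => tau_mem_star hx)
      (Q := insert a (insert b (insert k (Set.range S)))) (Q₁ := insert b (insert k (Set.range S)))
      (Q₂ := insert a (insert k (Set.range S))) (Set.subset_insert _ _)
      (Set.insert_subset_insert (Set.subset_insert _ _)) k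
    have e1 : insert b (insert k (Set.range S)) \ {k} = insert b (Set.range S) := by
      ext x; by_cases hx : x = k
      · subst hx; simp [hkS, hbk.symm]
      · simp [hx]
    have e2 : insert a (insert k (Set.range S)) \ {k} = insert a (Set.range S) := by
      ext x; by_cases hx : x = k
      · subst hx; simp [hkS, hak.symm]
      · simp [hx]
    have e3 : insert a (insert b (insert k (Set.range S))) \ {k} =
        insert a (insert b (Set.range S)) := by
      ext x; by_cases hx : x = k
      · subst hx; simp [hkS, hak.symm, hbk.symm]
      · simp [hx]
    have e4 : insert b (insert k (Set.range S)) ∩ insert a (insert k (Set.range S)) =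
        insert k (Set.range S) := by
      ext x
      simp only [Set.mem_inter_iff, Set.mem_insert_iff]
      constructor
      · rintro ⟨rfl | h, h'⟩
        · rcases h' with h' | h'
          · exact absurd h'.symm hab'
          · exact h'
        · exact h
      · exact fun h => ⟨Or.inr h, Or.inr h⟩
    rw [e1, e2, e3, e4] at hge
    rw [GoodMinor]
    rw [range_cons', range_snoc'] at hle ⊢
    have : D (star n p) (insert a (insert b (Set.range S))) = v := by omega
    rw [this]
    exact hv1

/-- The tropical three-term relations for the dimensions of the parts of `W` that are supported on
sets of columns. -/
def IsTropical (W : Submodule ℂ (P n)) : Prop :=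
  ∀ (S : Set (Fin n)) (a k b : Fin n), a < k → k < b → (∀ s ∈ S, a < s ∧ s < b) → k ∉ S →
    D W (insert a (insert b S)) + D W (insert k S) ≤
      min (D W (insert a S) + D W (insert b (insert k S)))
        (D W (insert b S) + D W (insert a (insert k S)))

/-- The order of the minor on `S ∪ {a, b}` satisfies the relation with equality and bounds the
dimension from above. The reverse inequality, not included in `IsTropical`, holds for every stable
subspace by `D_diff_ge`. -/
lemma star_isTropical (n : ℕ) (p : ℕ → ℕ → ℕ) : IsTropical (star n p) := by
  intro S a k b hak hkb hS hk
  obtain ⟨m, c, hc, rfl⟩ := exists_strictMono_range_eq S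
  have haS : ∀ s, a < c s := fun s => (hS _ ⟨s, rfl⟩).1
  have hSb : ∀ s, c s < b := fun s => (hS _ ⟨s, rfl⟩).2
  obtain ⟨r, hr⟩ := exists_strictMono_insertNth hc hk
  have hcb : ∀ s, (Fin.insertNth r k c : Fin (m + 1) → Fin n) s < b := by
    intro s
    induction s using Fin.succAboveCases r with
    | x => simpa using hkb
    | p s => simpa using hSb s
  have hca : ∀ s, a < (Fin.insertNth r k c : Fin (m + 1) → Fin n) s := by
    intro s
    induction s using Fin.succAboveCases r with
    | x => simpa using hak
    | p s => simpa using haS s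
  obtain ⟨v, hv1, hv2⟩ := exists_order_of_three_term (star_goodMinor p hr)
    (star_goodMinor p (strictMono_cons hc haS)) (star_goodMinor p (strictMono_snoc hc hSb))
    (star_goodMinor p (strictMono_snoc hr hcb)) (star_goodMinor p (strictMono_cons hr hca))
  have h1 := D_star_le (strictMono_cons (strictMono_snoc hc hSb) (fun s => by
    induction s using Fin.lastCases with
    | last => simpa using hak.trans hkb
    | cast s => simpa using haS s)) hv1
  rw [range_cons', range_snoc'] at h1
  omega

lemma D_star_iv (p : KostantPicture n) (a b : ℕ) : D (star n (mult p)) (iv n a b) = cnt p a b := by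
  by_cases h : a ≤ b ∧ a < n
  -- The block is cut off at the last column `n - 1`, which changes neither its columns nor its
  -- loops.
  · obtain ⟨m, hm⟩ : ∃ m, min b (n - 1) = a + m := Nat.exists_eq_add_of_le (by omega)
    have e1 : iv n a b = iv n a (a + m) := by
      ext k
      have := k.2
      simp only [mem_iv]
      omega
    have e2 : loopsIn p a b = loopsIn p a (a + m) := by
      ext L
      have := L.root.right.2
      simp only [loopsIn, Set.mem_ofPred_eq]
      omega
    have e3 : iv n a (a + m) = Set.range fun s : Fin (m + 1) => (⟨a + s, by omega⟩ : Fin n) := by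
      ext k
      simp only [mem_iv, Set.mem_range, Fin.ext_iff]
      constructor
      · rintro ⟨h1, h2⟩
        exact ⟨⟨k - a, by omega⟩, by simp only; omega⟩
      · rintro ⟨s, hs⟩
        omega
    rw [cnt, e2, ← cnt, ← intervalExp_mult, e1, e3]
    apply D_star_interval
    · intro s t hst
      rw [Fin.lt_def] at hst ⊢
      simp only; omega
    · intro s; rfl
  · have e1 : iv n a b = ∅ := by
      ext k
      have := k.2
      simp only [mem_iv, Set.mem_empty_iff_false, iff_false]
      omega
    rw [e1, D_empty]
    by_cases hab : b ≤ a
    · exact (cnt_eq_zero p hab).symm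
    · have e2 : loopsIn p a b = ∅ := by
        ext L
        have := L.root.left.2
        simp only [loopsIn, Set.mem_ofPred_eq, Set.mem_empty_iff_false, iff_false]
        omega
      rw [cnt, e2, Set.ncard_empty]

end

section

/-! ### From lattices to vectors of polynomials -/

variable {n : ℕ}

/-- The part of a Laurent polynomial of exponents less than `-d`, read backwards. -/
def phi1 (d : ℤ) : LaurentPolynomial ℂ →ₗ[ℂ] E where
  toFun x := Polynomial.ofFinsupp (AddMonoidAlgebra.ofCoeff
    (Finsupp.comapDomain (fun k : ℕ => -d - 1 - (k : ℤ)) x.coeff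
      (fun a _ b _ h => by simpa using h)))
  map_add' x y := by
    ext k
    simp only [Polynomial.coeff_add, Polynomial.coeff_ofFinsupp]
    rfl
  map_smul' c x := by
    ext k
    simp only [Polynomial.coeff_smul, Polynomial.coeff_ofFinsupp]
    rfl

lemma coeff_phi1 (d : ℤ) (x : LaurentPolynomial ℂ) (k : ℕ) :
    (phi1 d x).coeff k = x.coeff (-d - 1 - k) := by
  change (Polynomial.ofFinsupp _).coeff k = _
  rw [Polynomial.coeff_ofFinsupp]
  rfl

lemma coeff_T (j k : ℤ) : (T j : LaurentPolynomial ℂ).coeff k = if j = k then 1 else 0 := by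
  rw [T_apply]

lemma coeff_T_smul (x : LaurentPolynomial ℂ) (k : ℤ) :
    ((T 1 : LaurentPolynomial ℂ) • x).coeff k = x.coeff (k - 1) := by
  have := AddMonoidAlgebra.coeff_single_mul_apply x (1 : ℂ) (1 : ℤ) k
  rw [one_mul] at this
  rw [smul_eq_mul, sub_eq_neg_add]
  exact this

lemma eq_sum_T (x : LaurentPolynomial ℂ) :
    x = ∑ j ∈ x.coeff.support, x.coeff j • (T j : LaurentPolynomial ℂ) := by
  ext k
  simp [T_apply]

lemma phi1_eq_zero_iff {d : ℤ} {x : LaurentPolynomial ℂ} :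
    phi1 d x = 0 ↔ ∀ j < -d, x.coeff j = 0 := by
  constructor
  · intro h j hj
    have := coeff_phi1 d x (-d - 1 - j).toNat
    rw [h, Int.toNat_of_nonneg (by omega)] at this
    rw [show j = -d - 1 - (-d - 1 - j) by ring, ← this, Polynomial.coeff_zero]
  · intro h
    ext k
    rw [coeff_phi1, h _ (by omega), Polynomial.coeff_zero]

lemma phi1_T_smul (d : ℤ) (x : LaurentPolynomial ℂ) :
    phi1 d ((T 1 : LaurentPolynomial ℂ) • x) = dX (phi1 d x) := by
  ext k
  rw [coeff_phi1, coeff_dX, coeff_phi1, coeff_T_smul]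
  congr 1
  push_cast
  ring

/-- A section of `phi1`. -/
def psi1 (d : ℤ) : E →ₗ[ℂ] LaurentPolynomial ℂ :=
  (Polynomial.basisMonomials ℂ).constr ℂ fun k : ℕ => (T (-d - 1 - k) : LaurentPolynomial ℂ)

lemma psi1_eq_sum (d : ℤ) (f : E) : psi1 d f =
    ∑ k ∈ f.support, f.coeff k • (T (-d - 1 - k) : LaurentPolynomial ℂ) := by
  rw [psi1, Module.Basis.constr_apply]
  rfl

lemma coeff_psi1 (d : ℤ) (f : E) (j : ℤ) :
    (psi1 d f).coeff j = if j < -d then f.coeff (-d - 1 - j).toNat else 0 := by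
  rw [psi1_eq_sum]
  simp only [AddMonoidAlgebra.coeff_sum, AddMonoidAlgebra.coeff_smul, Finsupp.coe_finsetSum,
    Finset.sum_apply, Finsupp.smul_apply, coeff_T, smul_eq_mul, mul_ite, mul_one, mul_zero]
  split_ifs with h
  · have e : ∀ k : ℕ, (-d - 1 - (k : ℤ) = j) ↔ (-d - 1 - j).toNat = k := by intro k; omega
    simp only [e]
    rw [Finset.sum_ite_eq]
    simp +contextual
  · refine Finset.sum_eq_zero fun k _ => if_neg ?_
    omega

lemma phi1_psi1 (d : ℤ) (f : E) : phi1 d (psi1 d f) = f := by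
  ext k
  rw [coeff_phi1, coeff_psi1, if_pos (by omega)]
  congr 1
  omega

/-- The vectors of `X` modulo the span of the `t^j e_i` with `j ≥ -δ i`. -/
def phi (δ : Fin n → ℤ) : X n →ₗ[ℂ] P n := LinearMap.pi fun i => phi1 (δ i) ∘ₗ LinearMap.proj i

@[simp] lemma phi_apply (δ : Fin n → ℤ) (x : X n) (i : Fin n) : phi δ x i = phi1 (δ i) (x i) := rfl

/-- A section of `phi`. -/
def psi (δ : Fin n → ℤ) : P n →ₗ[ℂ] X n := LinearMap.pi fun i => psi1 (δ i) ∘ₗ LinearMap.proj i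

@[simp] lemma psi_apply (δ : Fin n → ℤ) (x : P n) (i : Fin n) : psi δ x i = psi1 (δ i) (x i) := rfl

@[simp] lemma phi_psi (δ : Fin n → ℤ) (x : P n) : phi δ (psi δ x) = x := by
  ext1 i
  simp [phi1_psi1]

lemma phi_surjective (δ : Fin n → ℤ) : Function.Surjective (phi δ) := fun x => ⟨_, phi_psi δ x⟩

lemma phi_T_smul (δ : Fin n → ℤ) (x : X n) :
    phi δ ((T 1 : LaurentPolynomial ℂ) • x) = tau (phi δ x) := by
  ext1 i
  rw [phi_apply, Pi.smul_apply, phi1_T_smul]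
  rfl

lemma mem_ker_phi {δ : Fin n → ℤ} {x : X n} :
    x ∈ LinearMap.ker (phi δ) ↔ ∀ i, ∀ j < -δ i, (x i).coeff j = 0 := by
  rw [LinearMap.mem_ker, funext_iff]
  exact forall_congr' fun i => phi1_eq_zero_iff

lemma tvec_mem_ker_phi {δ : Fin n → ℤ} {i : Fin n} {j : ℤ} :
    tvec i j ∈ LinearMap.ker (phi δ) ↔ -δ i ≤ j := by
  rw [mem_ker_phi]
  constructor
  · intro h
    by_contra hj
    have := h i j (by omega)
    simp [tvec] at this
  · intro h k m hm
    rcases eq_or_ne k i with rfl | hk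
    · simp only [tvec, Pi.single_eq_same, coeff_T]
      rw [if_neg (by omega)]
    · simp [tvec, hk]

lemma eq_sum_tvec (x : X n) : x = ∑ i, ∑ j ∈ (x i).coeff.support, (x i).coeff j • tvec i j := by
  conv_lhs => rw [← Finset.univ_sum_single x]
  refine Finset.sum_congr rfl fun i _ => ?_
  conv_lhs => rw [eq_sum_T (x i)]
  simp only [tvec, ← Pi.single_smul]
  exact map_sum (LinearMap.single ℂ (fun _ : Fin n => LaurentPolynomial ℂ) i) _ _

lemma span_tvec (δ : Fin n → ℤ) :
    Submodule.span ℂ {x | ∃ (i : Fin n) (j : ℤ), -δ i ≤ j ∧ x = tvec i j} =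
      LinearMap.ker (phi δ) := by
  apply le_antisymm
  · rw [Submodule.span_le]
    rintro _ ⟨i, j, h, rfl⟩
    exact tvec_mem_ker_phi.mpr h
  · intro x hx
    rw [mem_ker_phi] at hx
    rw [eq_sum_tvec x]
    refine Submodule.sum_mem _ fun i _ => Submodule.sum_mem _ fun j hj => Submodule.smul_mem _ _ ?_
    refine Submodule.subset_span ⟨i, j, ?_, rfl⟩
    by_contra h
    exact (Finsupp.mem_support_iff.mp hj) (hx i j (by omega))

lemma tX₀_eq_ker (n : ℕ) (N : ℤ) : tX₀ n N = LinearMap.ker (phi fun _ : Fin n => -N) := by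
  rw [← span_tvec, tX₀]
  simp only [neg_neg]

lemma mem_tX₀ {N : ℤ} {x : X n} : x ∈ tX₀ n N ↔ ∀ i, ∀ j < N, (x i).coeff j = 0 := by
  rw [tX₀_eq_ker, mem_ker_phi]
  simp only [neg_neg]

lemma T_smul_tvec (i : Fin n) (j : ℤ) :
    (T 1 : LaurentPolynomial ℂ) • tvec i j = tvec i (j + 1) := by
  rw [tvec, ← Pi.single_smul, smul_eq_mul, ← T_add, add_comm, tvec]

namespace Lat

lemma tvec_mem_of_le (Y : Lat n) {i : Fin n} {j k : ℤ} (h : tvec i j ∈ Y.space) (hk : j ≤ k) :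
    tvec i k ∈ Y.space := by
  obtain ⟨m, rfl⟩ := Int.le.dest hk
  clear hk
  induction m with
  | zero => simpa using h
  | succ m ih =>
    have := Y.t_mem _ ih
    rwa [T_smul_tvec, add_assoc] at this

lemma tvec_mem_iff (Y : Lat n) {i : Fin n} {j : ℤ} : tvec i j ∈ Y.space ↔ -Y.delta i ≤ j := by
  obtain ⟨N, h1, h2⟩ := Y.bounded
  have hne : {j : ℤ | tvec i (-j) ∈ Y.space}.Nonempty :=
    ⟨-N, h1 (Submodule.subset_span ⟨i, _, by omega, rfl⟩)⟩
  have hb : BddAbove {j : ℤ | tvec i (-j) ∈ Y.space} := by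
    refine ⟨N, fun j hj => ?_⟩
    have := h2 hj
    rw [tX₀_eq_ker, tvec_mem_ker_phi] at this
    omega
  constructor
  · intro h
    have := le_csSup hb (show -j ∈ {j : ℤ | tvec i (-j) ∈ Y.space} by
      change tvec i (- -j) ∈ Y.space; rwa [neg_neg])
    change -j ≤ Y.delta i at this
    omega
  · exact Y.tvec_mem_of_le (Int.csSup_mem hne hb)

lemma zeroPart_eq_ker (Y : Lat n) : Y.zeroPart = LinearMap.ker (phi Y.delta) := by
  rw [← span_tvec, zeroPart]
  simp only [Y.tvec_mem_iff]

lemma ker_phi_le (Y : Lat n) : LinearMap.ker (phi Y.delta) ≤ Y.space := by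
  rw [← Y.zeroPart_eq_ker, zeroPart, Submodule.span_le]
  rintro _ ⟨i, j, h, rfl⟩
  exact h

/-- The image of the lattice modulo `Y_0`. -/
def model (Y : Lat n) : Submodule ℂ (P n) := Y.space.map (phi Y.delta)

lemma mem_iff (Y : Lat n) {x : X n} : x ∈ Y.space ↔ phi Y.delta x ∈ Y.model := by
  rw [← Submodule.mem_comap, model, Submodule.comap_map_eq_self Y.ker_phi_le]

lemma tau_mem_model (Y : Lat n) : ∀ x ∈ Y.model, tau x ∈ Y.model := by
  rintro _ ⟨x, hx, rfl⟩
  exact ⟨_, Y.t_mem x hx, phi_T_smul _ _⟩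

lemma coeff_model_eq_zero (Y : Lat n) {N : ℕ} (hN : Y.space ≤ tX₀ n (-(N : ℤ))) {x : P n}
    (hx : x ∈ Y.model) {i : Fin n} {k : ℕ} (hk : (N : ℤ) - Y.delta i ≤ k) :
    (x i).coeff k = 0 := by
  obtain ⟨x, hx, rfl⟩ := hx
  rw [phi_apply, coeff_phi1]
  exact mem_tX₀.mp (hN hx) i _ (by omega)

end Lat

/-- The vectors of polynomials of bounded degrees. -/
def boundedP (n m : ℕ) : Submodule ℂ (P n) :=
  LinearMap.range (LinearMap.pi fun i =>
    (Polynomial.degreeLT ℂ m).subtype ∘ₗ LinearMap.proj (R := ℂ) (φ := fun _ : Fin n =>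
      Polynomial.degreeLT ℂ m) i)

instance (n m : ℕ) : FiniteDimensional ℂ (boundedP n m) := by
  unfold boundedP; infer_instance

lemma mem_boundedP {m : ℕ} {x : P n} : x ∈ boundedP n m ↔ ∀ i k, m ≤ k → (x i).coeff k = 0 := by
  constructor
  · rintro ⟨y, rfl⟩ i k hk
    exact mem_degreeLT_iff_coeff.mp (y i).2 k hk
  · intro h
    exact ⟨fun i => ⟨x i, mem_degreeLT_iff_coeff.mpr (h i)⟩, rfl⟩

namespace Lat

instance (Y : Lat n) : FiniteDimensional ℂ Y.model := by
  obtain ⟨N, h1, h2⟩ := Y.bounded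
  refine Submodule.finiteDimensional_of_le (S₂ := boundedP n (∑ i, (N - Y.delta i).toNat)) ?_
  intro x hx
  rw [mem_boundedP]
  intro i k hk
  refine Y.coeff_model_eq_zero h2 hx ?_
  have := Finset.single_le_sum (f := fun i => (N - Y.delta i).toNat) (fun _ _ => Nat.zero_le _)
    (Finset.mem_univ i)
  change (N - Y.delta i).toNat ≤ _ at this
  omega

end Lat

lemma exists_le_boundedP (W : Submodule ℂ (P n)) [FiniteDimensional ℂ W] :
    ∃ m, W ≤ boundedP n m := by
  have hfg : W.FG := Module.Finite.iff_fg.mp inferInstance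
  obtain ⟨s, hs⟩ := hfg
  refine ⟨∑ x ∈ s, ∑ i, ((x i).natDegree + 1), ?_⟩
  rw [← hs, Submodule.span_le]
  intro x hx
  refine mem_boundedP.mpr fun i k hk => Polynomial.coeff_eq_zero_of_natDegree_lt ?_
  have h1 := Finset.single_le_sum (f := fun x : P n => ∑ i, ((x i).natDegree + 1))
    (fun _ _ => Nat.zero_le _) hx
  have h2 := Finset.single_le_sum (f := fun i => (x i).natDegree + 1)
    (fun _ _ => Nat.zero_le _) (Finset.mem_univ i)
  omega

lemma tX₀_le_comap_phi {δ : Fin n → ℤ} {N : ℕ} (hN : ∀ i, (δ i).natAbs ≤ N)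
    (W : Submodule ℂ (P n)) : tX₀ n N ≤ W.comap (phi δ) := by
  intro x hx
  have : phi δ x = 0 := mem_ker_phi.mpr fun i j hj => mem_tX₀.mp hx i j (by
    have := hN i
    omega)
  rw [Submodule.mem_comap, this]
  exact zero_mem _

lemma comap_phi_le_tX₀ {δ : Fin n → ℤ} {N m : ℕ} (hN : ∀ i, m + (δ i).natAbs ≤ N)
    {W : Submodule ℂ (P n)} (hW : W ≤ boundedP n m) : W.comap (phi δ) ≤ tX₀ n (-(N : ℤ)) := by
  intro x hx
  rw [mem_tX₀]
  intro i j hj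
  have := hN i
  have hx := mem_boundedP.mp (hW hx) i (-δ i - 1 - j).toNat (by omega)
  rwa [phi_apply, coeff_phi1, Int.toNat_of_nonneg (by omega), sub_sub_cancel] at hx

/-- The lattice with given `δ` and given image modulo `Y_0`. -/
def ofModel (δ : Fin n → ℤ) (W : Submodule ℂ (P n)) [FiniteDimensional ℂ W]
    (hW : ∀ x ∈ W, tau x ∈ W) : Lat n where
  space := W.comap (phi δ)
  t_mem y hy := by
    rw [Submodule.mem_comap, phi_T_smul]
    exact hW _ hy
  bounded := by
    obtain ⟨m, hm⟩ := exists_le_boundedP W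
    have hδ : ∀ i, (δ i).natAbs ≤ ∑ i, (δ i).natAbs := fun i =>
      Finset.single_le_sum (f := fun i => (δ i).natAbs) (fun _ _ => Nat.zero_le _)
        (Finset.mem_univ i)
    exact ⟨m + ∑ i, (δ i).natAbs, tX₀_le_comap_phi (fun i => by have := hδ i; omega) W,
      comap_phi_le_tX₀ (fun i => by have := hδ i; omega) hm⟩

/-- If `W` met a single column, the preimage would contain further vectors `t^j e_i`, and `Y_0`
would be larger than the kernel of `phi δ`. -/
lemma delta_ofModel (δ : Fin n → ℤ) (W : Submodule ℂ (P n)) [FiniteDimensional ℂ W]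
    (hW : ∀ x ∈ W, tau x ∈ W) (h : ∀ i, W ⊓ VS {i} = ⊥) : (ofModel δ W hW).delta = δ := by
  ext1 i
  have key : ∀ j, -(ofModel δ W hW).delta i ≤ j ↔ -δ i ≤ j := by
    intro j
    rw [← Lat.tvec_mem_iff, ← tvec_mem_ker_phi, ofModel, Submodule.mem_comap, LinearMap.mem_ker]
    constructor
    · intro hx
      have : phi δ (tvec i j) ∈ W ⊓ VS {i} := ⟨hx, fun k hk => by
        simp only [phi_apply, tvec, Pi.single_eq_of_ne (show k ≠ i from hk), map_zero]⟩
      rwa [h i] at this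
    · intro hx
      rw [hx]
      exact zero_mem _
  have h1 := key (-δ i)
  have h2 := key (-(ofModel δ W hW).delta i)
  have h1' := h1.mpr le_rfl
  have h2' := h2.mp le_rfl
  omega

lemma model_ofModel (δ : Fin n → ℤ) (W : Submodule ℂ (P n)) [FiniteDimensional ℂ W]
    (hW : ∀ x ∈ W, tau x ∈ W) (h : ∀ i, W ⊓ VS {i} = ⊥) : (ofModel δ W hW).model = W := by
  rw [Lat.model, delta_ofModel δ W hW h]
  exact Submodule.map_comap_eq_of_surjective (phi_surjective δ) W

lemma Lat.ext_model {Y Y' : Lat n} (hd : Y.delta = Y'.delta) (hm : Y.model = Y'.model) : Y = Y' := by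
  ext x
  rw [Y.mem_iff, Y'.mem_iff, hd, hm]

end

section

variable {n : ℕ}

/-! ### Compatibility of a lattice in terms of its image modulo `Y_0` -/

lemma phi_mem_VS (δ : Fin n → ℤ) {a b : ℕ} {x : X n} (hx : x ∈ cols n a b) :
    phi δ x ∈ VS (iv n a b) := fun k hk => by rw [phi_apply, hx k hk, map_zero]

lemma psi_mem_cols (δ : Fin n → ℤ) {a b : ℕ} {x : P n} (hx : x ∈ VS (iv n a b)) :
    psi δ x ∈ cols n a b := fun k hk => by rw [psi_apply, hx k hk, map_zero]

lemma map_phi_inf_cols (Y : Lat n) (a b : ℕ) :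
    (Y.space ⊓ cols n a b).map (phi Y.delta) = Y.model ⊓ VS (iv n a b) := by
  apply le_antisymm
  · rintro _ ⟨x, ⟨hx, hx'⟩, rfl⟩
    exact ⟨⟨x, hx, rfl⟩, phi_mem_VS _ hx'⟩
  · rintro x ⟨hx, hx'⟩
    exact ⟨psi Y.delta x, ⟨Y.mem_iff.mpr (by rwa [phi_psi]), psi_mem_cols _ hx'⟩, phi_psi _ _⟩

/-- Encirclement is transitive, and the columns of an encircled loop are columns of `L`; so the
inner flags contribute only the vectors of loops inside `L`. -/
lemma flagInner_eq {p : KostantPicture n} {Y : Lat n} {y : KLoop p → X n} {L : KLoop p} :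
    flagInner p Y y L = (Y.zeroPart ⊓ L.V) ⊔ Submodule.span ℂ (y '' {L' | L'.Inside L}) := by
  apply le_antisymm
  · refine sup_le (iSup₂_le fun L' hL' => sup_le ?_ ?_) le_sup_left
    · refine le_trans (inf_le_inf_left _ ?_) le_sup_left
      intro x hx k hk
      refine hx k fun hk' => hk ?_
      rcases hL' with ⟨_, h1, h2⟩ | ⟨h1, _⟩
      · exact ⟨le_trans h1 hk'.1, le_trans hk'.2 h2⟩
      · rwa [← h1]
    · refine le_trans (Submodule.span_mono (Set.image_mono ?_)) le_sup_right
      rintro L'' (h | rfl)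
      · exact h.trans hL'
      · exact hL'
  · refine sup_le le_sup_right (le_trans ?_ le_sup_left)
    rw [Submodule.span_le]
    rintro _ ⟨L', hL', rfl⟩
    refine Submodule.mem_iSup_of_mem L' (Submodule.mem_iSup_of_mem hL' ?_)
    exact Submodule.mem_sup_right (Submodule.subset_span ⟨L', Or.inr rfl, rfl⟩)

lemma flag_eq {p : KostantPicture n} {Y : Lat n} {y : KLoop p → X n} {L : KLoop p} :
    flag p Y y L = flagInner p Y y L ⊔ Submodule.span ℂ {y L} := by
  rw [flagInner_eq, flag, sup_assoc, ← Submodule.span_union]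
  congr 2
  ext x
  simp only [Set.mem_image, Set.mem_union, Set.mem_singleton_iff]
  constructor
  · rintro ⟨L', h | rfl, rfl⟩
    · exact Or.inl ⟨L', h, rfl⟩
    · exact Or.inr rfl
  · rintro (⟨L', h, rfl⟩ | rfl)
    · exact ⟨L', Or.inl h, rfl⟩
    · exact ⟨L, Or.inr rfl, rfl⟩

/-- Since `Y_0` is spanned by basis vectors, it contains its own columns. Hence the projections in
the definition of compatibility may be compared modulo `Y_0`. -/
lemma ker_phi1_le_Proj {p : KostantPicture n} {Y : Lat n} {y : KLoop p → X n} {L : KLoop p}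
    {i : Fin n} (hi : L.Passes i) :
    LinearMap.ker (phi1 (Y.delta i)) ≤ Proj i (flagInner p Y y L) := by
  intro f hf
  refine ⟨Pi.single i f, Submodule.mem_sup_right ⟨?_, ?_⟩, by simp⟩
  · rw [SetLike.mem_coe, Y.zeroPart_eq_ker, LinearMap.mem_ker]
    ext1 k
    rcases eq_or_ne k i with rfl | hk
    · simpa using hf
    · simp [hk]
  · intro k hk
    have : k ≠ i := by rintro rfl; exact hk ⟨hi.1, hi.2⟩
    simp [this]

/-- The two flag members differ only by the line of `y L`, and this comparison descends along `phi1`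
because the inner projection contains its kernel. -/
lemma Proj_ne_iff {p : KostantPicture n} {Y : Lat n} {y : KLoop p → X n} {L : KLoop p}
    {i : Fin n} (hi : L.Passes i) : Proj i (flag p Y y L) ≠ Proj i (flagInner p Y y L) ↔
      phi Y.delta (y L) i ∉
        (Submodule.span ℂ ((fun L => phi Y.delta (y L)) '' {L' | L'.Inside L})).map (pr i) := by
  have h1 : Proj i (flag p Y y L) = Proj i (flagInner p Y y L) ↔
      y L i ∈ Proj i (flagInner p Y y L) := by
    rw [flag_eq, Proj, Submodule.map_sup, Submodule.map_span, Set.image_singleton, Proj, sup_eq_left,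
      Submodule.span_singleton_le_iff_mem]
    rfl
  have h2 : (Proj i (flagInner p Y y L)).map (phi1 (Y.delta i)) =
      (Submodule.span ℂ ((fun L => phi Y.delta (y L)) '' {L' | L'.Inside L})).map (pr i) := by
    have e : phi1 (Y.delta i) ∘ₗ (LinearMap.proj i : X n →ₗ[ℂ] _) = pr i ∘ₗ phi Y.delta := rfl
    rw [Proj, ← Submodule.map_comp, e, Submodule.map_comp, flagInner_eq, Submodule.map_sup,
      Submodule.map_span, ← Set.image_comp]
    have : (Y.zeroPart ⊓ L.V).map (phi Y.delta) = ⊥ := by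
      rw [eq_bot_iff]
      rintro _ ⟨x, ⟨hx, -⟩, rfl⟩
      rw [SetLike.mem_coe, Y.zeroPart_eq_ker] at hx
      exact hx
    rw [this, bot_sup_eq]
    rfl
  rw [Ne, h1, not_iff_not, ← h2, phi_apply]
  constructor
  · exact fun h => ⟨_, h, rfl⟩
  · rintro ⟨f, hf, hfe⟩
    have := ker_phi1_le_Proj (y := y) (Y := Y) hi
      (show y L i - f ∈ _ by rw [LinearMap.mem_ker, map_sub, hfe, sub_self])
    simpa using add_mem this hf

/-- By induction on depth, an encircled loop of depth one less generates all polynomials of degree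
below the depth of `L`. The inner span never exceeds this, so leaving it means having a nonzero
coefficient exactly at the depth. -/
lemma forall_coeff_ne_iff {p : KostantPicture n} {z : KLoop p → P n}
    (hV : ∀ L, z L ∈ VS (iv n L.root.left L.root.right))
    (ht : ∀ L, tau (z L) ∈ Submodule.span ℂ (z '' {L' | L'.Inside L})) :
    (∀ (L : KLoop p) (i : Fin n), L.Passes i →
      z L i ∉ (Submodule.span ℂ (z '' {L' | L'.Inside L})).map (pr i)) ↔
    ∀ (L : KLoop p) (i : Fin n), L.Passes i → (z L i).coeff (depth p i L) ≠ 0 := by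
  constructor
  · intro h L i hi
    induction hd : depth p i L using Nat.strong_induction_on generalizing L with
    | _ d ih =>
      intro h0
      apply h L i hi
      have hlow : ∀ j, d ≤ j → (z L i).coeff j = 0 := fun j hj => by
        rcases hj.eq_or_lt with rfl | hj
        · exact h0
        · exact coeff_eq_zero_of_depth_lt hV ht (hd ▸ hj)
      rcases Nat.eq_zero_or_pos d with rfl | hpos
      · have : z L i = 0 := by
          ext j
          exact hlow j (Nat.zero_le _)
        rw [this]
        exact zero_mem _
      · obtain ⟨L', hi', hin, hdep⟩ := exists_inside_of_depth_pos hi (hd ▸ hpos)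
        refine degreeLT_le_of_mem ?_ (f := z L' i) (k := depth p i L')
          (Submodule.mem_map_of_mem (f := pr i) (Submodule.subset_span (Set.mem_image_of_mem z hin))) (ih _ (by omega) L' hi' rfl)
          (fun j hj => coeff_eq_zero_of_depth_lt hV ht hj) ?_
        · rintro _ ⟨x, hx, rfl⟩
          exact ⟨tau x, span_stable ht (fun L₁ h₁ L₂ h₂ => h₂.trans h₁) x hx, rfl⟩
        · rw [mem_degreeLT_iff_coeff]
          intro j hj
          exact hlow j (by omega)
  · intro h L i hi
    rintro ⟨x, hx, hxe⟩
    have : Submodule.span ℂ (z '' {L' | L'.Inside L}) ≤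
        LinearMap.ker ((Polynomial.lcoeff ℂ (depth p i L)).comp (pr i)) := by
      rw [Submodule.span_le]
      rintro _ ⟨L', hL', rfl⟩
      by_cases hi' : L'.Passes i
      · exact coeff_eq_zero_of_depth_lt hV ht (depth_lt_of_inside hi' hL')
      · simp [apply_eq_zero_of_not_passes hV hi']
    have h0 := this hx
    apply h L i hi
    rw [← hxe]
    simpa using h0

/-- A flag basis is carried to the model by `phi` and lifted back by its section `psi`, which
respects columns. -/
lemma compatible_iff {p : KostantPicture n} {Y : Lat n} :
    Compatible p Y ↔ ∃ z, IsModelFlag p Y.model z := by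
  constructor
  · rintro ⟨y, hy, hne⟩
    have hV : ∀ L, phi Y.delta (y L) ∈ VS (iv n L.root.left L.root.right) :=
      fun L => phi_mem_VS _ (hy.mem_V L)
    have h0 : Y.zeroPart.map (phi Y.delta) = ⊥ := by
      rw [Y.zeroPart_eq_ker, eq_bot_iff]
      rintro _ ⟨x, hx, rfl⟩
      exact hx
    have ht : ∀ L, tau (phi Y.delta (y L)) ∈
        Submodule.span ℂ ((fun L => phi Y.delta (y L)) '' {L' | L'.Inside L}) := fun L => by
      have := Submodule.mem_map_of_mem (f := phi Y.delta) (hy.t_smul_mem L)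
      rwa [phi_T_smul, Submodule.map_sup, h0, bot_sup_eq, Submodule.map_span, ← Set.image_comp]
        at this
    refine ⟨fun L => phi Y.delta (y L), ?_, ?_, hV, ht, ?_⟩
    · refine hy.linearIndependent.map ?_
      rw [← Y.zeroPart_eq_ker]
      exact hy.disjoint.symm
    · rw [Lat.model, ← hy.sup_eq, Submodule.map_sup, h0, bot_sup_eq, Submodule.map_span,
        ← Set.range_comp]
      rfl
    · refine (forall_coeff_ne_iff hV ht).mp fun L i hi => (Proj_ne_iff hi).mp (hne L i hi)
  · rintro ⟨z, hz⟩
    have hcomap : ∀ s : Set (KLoop p), Y.zeroPart ⊔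
        Submodule.span ℂ ((fun L => psi Y.delta (z L)) '' s) =
        (Submodule.span ℂ (z '' s)).comap (phi Y.delta) := fun s => by
      rw [Y.zeroPart_eq_ker, sup_comm, ← Submodule.comap_map_eq, Submodule.map_span,
        ← Set.image_comp]
      congr 3
      ext1 L
      exact phi_psi _ _
    refine ⟨fun L => psi Y.delta (z L), ⟨?_, ?_, ?_, ?_, ?_⟩, ?_⟩
    · apply LinearIndependent.of_comp (phi Y.delta)
      convert hz.linearIndependent using 1
      ext1 L
      exact phi_psi _ _
    · have e : Submodule.span ℂ (Set.range fun L => psi Y.delta (z L)) =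
          (Submodule.span ℂ (Set.range z)).map (psi Y.delta) := by
        rw [Submodule.map_span, ← Set.range_comp]
        rfl
      rw [e, Submodule.disjoint_def, Y.zeroPart_eq_ker]
      rintro _ hx ⟨w, -, rfl⟩
      rw [LinearMap.mem_ker, phi_psi] at hx
      rw [hx, map_zero]
    · rw [← Set.image_univ, hcomap, Set.image_univ, hz.span_eq]
      ext x
      exact Y.mem_iff.symm
    · exact fun L => psi_mem_cols _ (hz.mem_VS L)
    · intro L
      rw [hcomap, Submodule.mem_comap, phi_T_smul, phi_psi]
      exact hz.tau_mem L
    · intro L i hi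
      rw [Proj_ne_iff hi]
      simp only [phi_psi]
      exact (forall_coeff_ne_iff hz.mem_VS hz.tau_mem).mpr hz.coeff_ne L i hi

/-! ### The picture of a lattice -/

/-- Split off the column at the left end: it avoids the right end, and the rest avoids the left end.
Thus `Y_0` contributes nothing to the quotient defining `p(Y)`, which may be computed in the model.
-/
lemma ker_phi_inf_cols_le {δ : Fin n → ℤ} {U : Submodule ℂ (X n)} (hU : LinearMap.ker (phi δ) ≤ U)
    {R : Root n} : LinearMap.ker (phi δ) ⊓ cols n R.left R.right ≤
      (U ⊓ cols n (R.left + 1) R.right) ⊔ (U ⊓ cols n R.left (R.right - 1)) := by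
  rintro x ⟨hx, hxc⟩
  have hlt : (R.left : ℕ) < R.right := R.lt
  have hs : Pi.single R.left (x R.left) ∈ LinearMap.ker (phi δ) := by
    rw [LinearMap.mem_ker]
    ext1 k
    rcases eq_or_ne k R.left with rfl | hk
    · simpa using congrFun hx R.left
    · simp [hk]
  have h1 : x - Pi.single R.left (x R.left) ∈ U ⊓ cols n (R.left + 1) R.right := by
    refine ⟨hU (sub_mem hx hs), fun k hk => ?_⟩
    rcases eq_or_ne k R.left with rfl | hk'
    · simp
    · have := Fin.val_ne_of_ne hk'
      simp only [Pi.sub_apply, Pi.single_eq_of_ne hk', sub_zero]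
      exact hxc k (by omega)
  have h2 : Pi.single R.left (x R.left) ∈ U ⊓ cols n R.left (R.right - 1) := by
    refine ⟨hU hs, fun k hk => ?_⟩
    have : k ≠ R.left := by rintro rfl; exact hk ⟨le_rfl, by omega⟩
    simp [this]
  simpa using Submodule.add_mem_sup h1 h2

lemma picture_add (Y : Lat n) (R : Root n) :
    Y.picture R + Module.finrank ℂ ↥(Y.model ⊓ VS (iv n (R.left + 1) R.right) ⊔
      Y.model ⊓ VS (iv n R.left (R.right - 1))) = D Y.model (iv n R.left R.right) := by
  set A := Y.space ⊓ cols n R.left R.right with hA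
  set B := (Y.space ⊓ cols n (R.left + 1) R.right) ⊔ (Y.space ⊓ cols n R.left (R.right - 1)) with hB
  set B' := Y.model ⊓ VS (iv n (R.left + 1) R.right) ⊔ Y.model ⊓ VS (iv n R.left (R.right - 1))
    with hB'
  have hBB' : B.map (phi Y.delta) = B' := by
    rw [hB, Submodule.map_sup, map_phi_inf_cols, map_phi_inf_cols]
  have hAA' : A.map (phi Y.delta) = Y.model ⊓ VS (iv n R.left R.right) := map_phi_inf_cols _ _ _
  have hBA : B ≤ A := by
    refine sup_le (inf_le_inf_left _ fun x hx k hk => hx k ?_)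
      (inf_le_inf_left _ fun x hx k hk => hx k ?_) <;> omega
  have hBA' : B' ≤ Y.model ⊓ VS (iv n R.left R.right) := by
    rw [← hBB', ← hAA']
    exact Submodule.map_mono hBA
  set g : ↥A →ₗ[ℂ] (P n ⧸ B') := B'.mkQ ∘ₗ phi Y.delta ∘ₗ A.subtype with hg
  have hker : LinearMap.ker g = B.submoduleOf A := by
    ext x
    simp only [hg, LinearMap.mem_ker, LinearMap.comp_apply, Submodule.mkQ_apply,
      Submodule.Quotient.mk_eq_zero, Submodule.submoduleOf, Submodule.mem_comap]
    rw [← hBB']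
    constructor
    · rintro ⟨b, hb, hbx⟩
      have : A.subtype x - b ∈ B := ker_phi_inf_cols_le Y.ker_phi_le
        ⟨by rw [SetLike.mem_coe, LinearMap.mem_ker, map_sub, hbx, sub_self],
          sub_mem x.2.2 (hBA hb).2⟩
      simpa using add_mem this hb
    · exact fun h => ⟨_, h, rfl⟩
  have hrange : LinearMap.range g =
      LinearMap.range (B'.mkQ ∘ₗ (Y.model ⊓ VS (iv n R.left R.right)).subtype) := by
    rw [hg, LinearMap.range_comp, LinearMap.range_comp, Submodule.range_subtype, hAA',
      LinearMap.range_comp, Submodule.range_subtype]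
  have e1 : Y.picture R = Module.finrank ℂ (LinearMap.range g) := by
    rw [← (LinearMap.quotKerEquivRange g).finrank_eq, hker]
    rfl
  have hfd : FiniteDimensional ℂ ↥(Y.model ⊓ VS (iv n R.left R.right)) :=
    Submodule.finiteDimensional_of_le inf_le_left
  have e2 := LinearMap.finrank_range_add_finrank_ker
    (B'.mkQ ∘ₗ (Y.model ⊓ VS (iv n R.left R.right)).subtype)
  rw [← hrange, ← e1, LinearMap.ker_comp, Submodule.ker_mkQ] at e2
  change _ + Module.finrank ℂ ↥(B'.submoduleOf _) = _ at e2
  rw [(Submodule.submoduleOfEquivOfLe hBA').finrank_eq] at e2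
  exact e2

/-- Inclusion and exclusion for `D` over the two shorter blocks matches `cnt_rec`, leaving the
multiplicity. -/
lemma picture_eq {p : KostantPicture n} {Y : Lat n}
    (h : ∀ a b, D Y.model (iv n a b) = cnt p a b) : Y.picture = p := by
  ext R
  have hlt : (R.left : ℕ) < R.right := R.lt
  have h1 := picture_add Y R
  have h2 := D_sup Y.model (iv n (R.left + 1) R.right) (iv n R.left (R.right - 1))
  have h3 := cnt_rec p hlt
  rw [iv_inter, h, h, h] at h2
  rw [h] at h1
  rw [mult_root] at h3
  omega

end

section

variable {n : ℕ}

/-! ### Collapsed lattices -/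

/-- Insertion of a zero column. -/
def insCol {F : Type*} [AddCommGroup F] [Module ℂ F] (i : Fin (n + 1)) :
    (Fin n → F) →ₗ[ℂ] (Fin (n + 1) → F) where
  toFun x := i.insertNth (α := fun _ => F) 0 x
  map_add' x y := by
    ext1 k
    rcases Fin.eq_self_or_eq_succAbove i k with rfl | ⟨m, rfl⟩ <;> simp
  map_smul' c x := by
    ext1 k
    rcases Fin.eq_self_or_eq_succAbove i k with rfl | ⟨m, rfl⟩ <;> simp

section InsCol

variable {F : Type*} [AddCommGroup F] [Module ℂ F]

@[simp] lemma insCol_self (i : Fin (n + 1)) (x : Fin n → F) : insCol i x i = 0 :=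
  Fin.insertNth_apply_same (α := fun _ => F) i 0 x

@[simp] lemma insCol_succAbove (i : Fin (n + 1)) (x : Fin n → F) (k : Fin n) :
    insCol i x (i.succAbove k) = x k :=
  Fin.insertNth_apply_succAbove (α := fun _ => F) i 0 x k

lemma insCol_eq {i : Fin (n + 1)} {z : Fin (n + 1) → F} (hz : z i = 0) :
    insCol i (fun k => z (i.succAbove k)) = z := by
  ext1 k
  rcases Fin.eq_self_or_eq_succAbove i k with rfl | ⟨m, rfl⟩
  · rw [insCol_self, hz]
  · rw [insCol_succAbove]

end InsCol

lemma phi_insCol (δ : Fin (n + 1) → ℤ) (i : Fin (n + 1)) (x : X n) :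
    phi δ (insCol i x) = insCol i (phi (fun k => δ (i.succAbove k)) x) := by
  ext1 k
  rcases Fin.eq_self_or_eq_succAbove i k with rfl | ⟨m, rfl⟩ <;> simp

lemma mem_collapse_space {Y : Lat (n + 1)} {i : Fin (n + 1)} {x : X n} :
    x ∈ (Y.collapse i).space ↔ insCol i x ∈ Y.space := by
  constructor
  · rintro ⟨z, ⟨hz, hz0⟩, rfl⟩
    have h0 : z i = 0 := by simpa [colZero] using hz0
    have : insCol i (dropCol i z) = z := insCol_eq h0
    rwa [this]
  · intro h
    refine ⟨insCol i x, ⟨h, by simp [colZero]⟩, ?_⟩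
    ext1 k
    simp [dropCol, LinearMap.funLeft_apply]

lemma insCol_tvec (i : Fin (n + 1)) (k : Fin n) (j : ℤ) :
    insCol i (tvec k j) = tvec (i.succAbove k) j := by
  ext1 m
  rcases Fin.eq_self_or_eq_succAbove i m with rfl | ⟨m, rfl⟩
  · rw [insCol_self, tvec, Pi.single_eq_of_ne (Fin.succAbove_ne _ _).symm]
  · rw [insCol_succAbove, tvec, tvec]
    rcases eq_or_ne m k with rfl | h
    · simp
    · rw [Pi.single_eq_of_ne h,
        Pi.single_eq_of_ne fun e => h (Fin.succAbove_right_injective e)]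

lemma delta_collapse (Y : Lat (n + 1)) (i : Fin (n + 1)) :
    (Y.collapse i).delta = fun k => Y.delta (i.succAbove k) := by
  ext1 k
  have key : ∀ j, -(Y.collapse i).delta k ≤ j ↔ -Y.delta (i.succAbove k) ≤ j := fun j => by
    rw [← Lat.tvec_mem_iff, mem_collapse_space, insCol_tvec, Lat.tvec_mem_iff]
  have h1 := (key _).mpr le_rfl
  have h2 := (key _).mp le_rfl
  omega

lemma mem_model_collapse {Y : Lat (n + 1)} {i : Fin (n + 1)} {x : P n} :
    x ∈ (Y.collapse i).model ↔ insCol i x ∈ Y.model := by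
  obtain ⟨x, rfl⟩ := phi_surjective (Y.collapse i).delta x
  rw [← Lat.mem_iff, mem_collapse_space, Lat.mem_iff, phi_insCol, delta_collapse]

lemma D_model_collapse (Y : Lat (n + 1)) (i : Fin (n + 1)) (S : Set (Fin n)) :
    D (Y.collapse i).model S = D Y.model (i.succAbove '' S) := by
  have e : ((Y.collapse i).model ⊓ VS S).map (insCol i) = Y.model ⊓ VS (i.succAbove '' S) := by
    apply le_antisymm
    · rintro _ ⟨x, ⟨hx, hxS⟩, rfl⟩
      refine ⟨mem_model_collapse.mp hx, fun k hk => ?_⟩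
      rcases Fin.eq_self_or_eq_succAbove i k with rfl | ⟨m, rfl⟩
      · rw [insCol_self]
      · rw [insCol_succAbove]
        exact hxS m fun h => hk ⟨m, h, rfl⟩
    · rintro z ⟨hz, hzS⟩
      have h0 : z i = 0 := hzS i (by rintro ⟨m, -, h⟩; exact Fin.succAbove_ne _ _ h)
      refine ⟨fun k => z (i.succAbove k), ⟨mem_model_collapse.mpr (by rwa [insCol_eq h0]), ?_⟩,
        insCol_eq h0⟩
      intro k hk
      refine hzS _ ?_
      rintro ⟨m, hm, h⟩
      exact hk (Fin.succAbove_right_injective h ▸ hm)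
  rw [D, D, ← e, finrank_map_of_forall]
  intro x _ hx
  ext1 k
  rw [← insCol_succAbove i x k, hx]
  rfl

lemma image_succAbove_iv (i : Fin (n + 1)) (a b : ℕ) :
    i.succAbove '' iv n a b = iv (n + 1) (lift i a) (lift i b) \ {i} := by
  ext k
  constructor
  · rintro ⟨m, hm, rfl⟩
    refine ⟨?_, Fin.succAbove_ne _ _⟩
    rw [mem_iv, val_succAbove, lift_le_lift, lift_le_lift]
    exact hm
  · rintro ⟨hk, hki⟩
    rcases Fin.eq_self_or_eq_succAbove i k with rfl | ⟨m, rfl⟩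
    · exact absurd rfl hki
    · refine ⟨m, ?_, rfl⟩
      rwa [mem_iv, val_succAbove, lift_le_lift, lift_le_lift] at hk

lemma exists_eq_image_succAbove {i : Fin (n + 1)} {S : Set (Fin (n + 1))} (hi : i ∉ S) :
    ∃ S' : Set (Fin n), S = i.succAbove '' S' := by
  refine ⟨i.succAbove ⁻¹' S, ?_⟩
  rw [Set.image_preimage_eq_inter_range, Fin.range_succAbove]
  refine (Set.inter_eq_left.mpr fun k hk => ?_).symm
  rintro rfl
  exact hi hk

/-- Compatibility expressed by dimensions. -/
lemma compatible_iff_D {p : KostantPicture n} {Y : Lat n} :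
    Compatible p Y ↔ (∀ a b, D Y.model (iv n a b) = cnt p a b) ∧
      ∀ (R : Root n) (i : Fin n), R.left ≤ i → i ≤ R.right →
        maxLevel p i R.left R.right + D Y.model (iv n R.left R.right \ {i}) ≤
          cnt p R.left R.right := by
  rw [compatible_iff]
  constructor
  · rintro ⟨z, hz⟩
    exact ⟨hz.D_iv, fun R i _ _ => (hz.D_iv_diff _ _ i).le⟩
  · rintro ⟨h1, h2⟩
    exact exists_isModelFlag Y.tau_mem_model h1 h2

lemma Compatible.D_iv {p : KostantPicture n} {Y : Lat n} (h : Compatible p Y) (a b : ℕ) :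
    D Y.model (iv n a b) = cnt p a b := (compatible_iff_D.mp h).1 a b

lemma Compatible.D_iv_diff {p : KostantPicture n} {Y : Lat n} (h : Compatible p Y) (a b : ℕ)
    (i : Fin n) : maxLevel p i a b + D Y.model (iv n a b \ {i}) = cnt p a b := by
  obtain ⟨z, hz⟩ := compatible_iff.mp h
  exact hz.D_iv_diff a b i

/-- Omitting column `i` costs `maxLevel` on both sides: for dimensions by compatibility, for loops
by the form of the collapse. -/
lemma Compatible.D_iv_collapse {p : KostantPicture (n + 1)} {Y : Lat (n + 1)}
    (h : Compatible p Y) (i : Fin (n + 1)) (a b : ℕ) :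
    D (Y.collapse i).model (iv n a b) = cnt (p.collapse i) a b := by
  have h1 := h.D_iv_diff (lift i a) (lift i b) i
  have h2 := cnt_collapse p i a b
  rw [D_model_collapse, image_succAbove_iv]
  omega

/-! ### Tropical lattices are strongly compatible -/

lemma iv_diff_left (a b : ℕ) (ha : a < n) : iv n a b \ {⟨a, ha⟩} = iv n (a + 1) b := by
  ext k
  simp only [Set.mem_sdiff, mem_iv, Set.mem_singleton_iff, Fin.ext_iff]
  omega

lemma iv_diff_right (a b : ℕ) (hb : b < n) (hb0 : 0 < b) :
    iv n a b \ {⟨b, hb⟩} = iv n a (b - 1) := by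
  ext k
  simp only [Set.mem_sdiff, mem_iv, Set.mem_singleton_iff, Fin.ext_iff]
  omega

/-- The tropical relation for the ends of the block and a column `i` between them, combined with
`cnt_rec`, turns the estimates for the two shorter blocks into the recursion defining `maxLevel`. -/
lemma IsTropical.maxLevel_add_le {W : Submodule ℂ (P n)} [FiniteDimensional ℂ W]
    (hW : IsTropical W) {p : KostantPicture n} (h : ∀ a b, D W (iv n a b) = cnt p a b) (i : Fin n)
    (a b : ℕ) (hb : b < n) : maxLevel p i a b + D W (iv n a b \ {i}) ≤ cnt p a b := by
  induction hm : b - a using Nat.strong_induction_on generalizing a b with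
  | _ m ih =>
    by_cases hab : a < b ∧ a ≤ (i : ℕ) ∧ (i : ℕ) ≤ b
    · obtain ⟨hlt, hai, hib⟩ := hab
      have ih1 := ih _ (by omega) (a + 1) b hb rfl
      have ih2 := ih _ (by omega) a (b - 1) (by omega) rfl
      have hrec := cnt_rec p hlt
      rw [maxLevel, if_pos ⟨hlt, hai, hib⟩]
      -- At an end of the block no relation is needed: one of the two shorter blocks misses `i` and
      -- has no level there.
      rcases hai.eq_or_lt with hai' | hai'
      · have e : ∀ c, iv n a c \ {i} = iv n (a + 1) c := fun c => by
          rw [← iv_diff_left a c (by omega)]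
          congr
          ext1
          exact hai'.symm
        rw [e, h] at ih2 ⊢
        rw [maxLevel_eq_zero p (i := i) (a := a + 1) (b := b) (by omega)]
        omega
      · rcases hib.eq_or_lt with hib' | hib'
        · have e : iv n a b \ {i} = iv n a (b - 1) := by
            rw [← iv_diff_right a b hb (by omega)]
            congr
            ext1
            exact hib'
          have e' : iv n (a + 1) b \ {i} = iv n (a + 1) (b - 1) := by
            rw [← iv_diff_right (a + 1) b hb (by omega)]
            congr
            ext1
            exact hib'
          rw [e', h] at ih1
          rw [e, h]
          rw [maxLevel_eq_zero p (i := i) (a := a) (b := b - 1) (by omega)]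
          omega
        -- Here `S` is the interior of the block without `i`, so the sets containing `i` are again
        -- blocks, with known `D`, and the others are blocks without `i`.
        · have key := hW (iv n (a + 1) (b - 1) \ {i}) ⟨a, by omega⟩ i ⟨b, hb⟩ hai' hib'
            (by
              rintro s ⟨hs, -⟩
              rw [mem_iv] at hs
              rw [Fin.lt_def, Fin.lt_def]
              simp only
              omega)
            (by simp)
          have e1 : insert (⟨a, by omega⟩ : Fin n) (insert ⟨b, hb⟩ (iv n (a + 1) (b - 1) \ {i})) =
              iv n a b \ {i} := by
            ext k
            simp only [Set.mem_insert_iff, Set.mem_sdiff, mem_iv, Set.mem_singleton_iff, Fin.ext_iff]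
            omega
          have e2 : insert i (iv n (a + 1) (b - 1) \ {i}) = iv n (a + 1) (b - 1) := by
            ext k
            simp only [Set.mem_insert_iff, Set.mem_sdiff, mem_iv, Set.mem_singleton_iff, Fin.ext_iff]
            omega
          have e3 : insert (⟨a, by omega⟩ : Fin n) (iv n (a + 1) (b - 1) \ {i}) =
              iv n a (b - 1) \ {i} := by
            ext k
            simp only [Set.mem_insert_iff, Set.mem_sdiff, mem_iv, Set.mem_singleton_iff, Fin.ext_iff]
            omega
          have e4 : insert (⟨b, hb⟩ : Fin n) (iv n (a + 1) (b - 1) \ {i}) =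
              iv n (a + 1) b \ {i} := by
            ext k
            simp only [Set.mem_insert_iff, Set.mem_sdiff, mem_iv, Set.mem_singleton_iff, Fin.ext_iff]
            omega
          have e5 : insert (⟨b, hb⟩ : Fin n) (iv n (a + 1) (b - 1)) = iv n (a + 1) b := by
            ext k
            simp only [Set.mem_insert_iff, mem_iv, Fin.ext_iff]
            omega
          have e6 : insert (⟨a, by omega⟩ : Fin n) (iv n (a + 1) (b - 1)) = iv n a (b - 1) := by
            ext k
            simp only [Set.mem_insert_iff, mem_iv, Fin.ext_iff]
            omega
          rw [e1, e2, e3, e4, e5, e6, h, h, h, le_min_iff] at key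
          omega
    · rw [maxLevel, if_neg hab, zero_add, ← h]
      exact D_mono W Set.sdiff_subset

lemma IsTropical.collapse {Y : Lat (n + 1)} (hY : IsTropical Y.model) (i : Fin (n + 1)) :
    IsTropical (Y.collapse i).model := by
  intro S a k b hak hkb hS hk
  simp only [D_model_collapse, Set.image_insert_eq]
  refine hY _ _ _ _ (Fin.succAbove_lt_succAbove_iff.mpr hak)
    (Fin.succAbove_lt_succAbove_iff.mpr hkb) ?_ ?_
  · rintro _ ⟨s, hs, rfl⟩
    exact ⟨Fin.succAbove_lt_succAbove_iff.mpr (hS s hs).1,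
      Fin.succAbove_lt_succAbove_iff.mpr (hS s hs).2⟩
  · rintro ⟨s, hs, e⟩
    exact hk (Fin.succAbove_right_injective e ▸ hs)

lemma IsTropical.compatible {p : KostantPicture n} {Y : Lat n} (hY : IsTropical Y.model)
    (h : ∀ a b, D Y.model (iv n a b) = cnt p a b) : Compatible p Y :=
  compatible_iff_D.mpr ⟨h, fun R i _ _ => hY.maxLevel_add_le h i _ _ R.right.isLt⟩

lemma StronglyCompatible.compatible {p : KostantPicture n} {Y : Lat n}
    (h : StronglyCompatible n p Y) : Compatible p Y := by
  match n, p, Y, h with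
  | 0, _, _, h | 1, _, _, h | 2, _, _, h => exact h
  | n + 3, _, _, h => exact h.1

/-- Both hypotheses pass to the collapses: the tropical relation since it only concerns sets of
columns, and the dimensions on blocks by compatibility. -/
lemma IsTropical.stronglyCompatible {p : KostantPicture n} {Y : Lat n} (hY : IsTropical Y.model)
    (h : ∀ a b, D Y.model (iv n a b) = cnt p a b) : StronglyCompatible n p Y := by
  induction n using Nat.strong_induction_on with
  | _ m ih =>
    match m, p, Y, hY, h, ih with
    | 0, p, Y, hY, h, _ | 1, p, Y, hY, h, _ | 2, p, Y, hY, h, _ => exact hY.compatible h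
    | m + 3, p, Y, hY, h, ih =>
      exact ⟨hY.compatible h, fun i =>
        ih (m + 2) (by omega) (hY.collapse i) ((hY.compatible h).D_iv_collapse i)⟩

/-! ### Strong compatibility in terms of dimensions -/

lemma exists_eq_iv_of_le_two (hn : n ≤ 2) (S : Set (Fin n)) : ∃ a b, S = iv n a b := by
  by_cases h0 : ∃ h : 0 < n, (⟨0, h⟩ : Fin n) ∈ S
  · obtain ⟨h, h0⟩ := h0
    by_cases h1 : ∃ h : 1 < n, (⟨1, h⟩ : Fin n) ∈ S
    · obtain ⟨h', h1⟩ := h1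
      refine ⟨0, 1, ?_⟩
      ext ⟨k, hk⟩
      have : k = 0 ∨ k = 1 := by omega
      rcases this with rfl | rfl <;> simp [mem_iv, h0, h1]
    · refine ⟨0, 0, ?_⟩
      ext ⟨k, hk⟩
      have : k = 0 ∨ k = 1 := by omega
      rcases this with rfl | rfl
      · simp [mem_iv, h0]
      · simpa [mem_iv] using fun h => h1 ⟨hk, h⟩
  · by_cases h1 : ∃ h : 1 < n, (⟨1, h⟩ : Fin n) ∈ S
    · obtain ⟨h', h1⟩ := h1
      refine ⟨1, 1, ?_⟩
      ext ⟨k, hk⟩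
      have : k = 0 ∨ k = 1 := by omega
      rcases this with rfl | rfl
      · simpa [mem_iv] using fun h => h0 ⟨hk, h⟩
      · simp [mem_iv, h1]
    · refine ⟨1, 0, ?_⟩
      ext ⟨k, hk⟩
      have : k = 0 ∨ k = 1 := by omega
      rcases this with rfl | rfl
      · simpa [mem_iv] using fun h => h0 ⟨hk, h⟩
      · simpa [mem_iv] using fun h => h1 ⟨hk, h⟩

/-- The dimensions of the intersections of a strongly compatible lattice with sums of columns are
determined by the Kostant picture. -/
lemma StronglyCompatible.D_eq {p : KostantPicture n} {Y Y' : Lat n}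
    (h : StronglyCompatible n p Y) (h' : StronglyCompatible n p Y') (S : Set (Fin n)) :
    D Y.model S = D Y'.model S := by
  induction n using Nat.strong_induction_on with
  | _ m ih =>
    by_cases hS : ∃ a b, S = iv m a b
    · obtain ⟨a, b, rfl⟩ := hS
      rw [h.compatible.D_iv, h'.compatible.D_iv]
    · match m, p, Y, Y', h, h', S, hS, ih with
      | 0, p, Y, Y', h, h', S, hS, _ => exact absurd (exists_eq_iv_of_le_two (by omega) S) hS
      | 1, p, Y, Y', h, h', S, hS, _ => exact absurd (exists_eq_iv_of_le_two (by omega) S) hS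
      | 2, p, Y, Y', h, h', S, hS, _ => exact absurd (exists_eq_iv_of_le_two le_rfl S) hS
      | m + 3, p, Y, Y', h, h', S, hS, ih =>
        -- The set of all columns is a block, so `S` omits some column and its dimension can be
        -- computed in the collapse along that column.
        have : ∃ i, i ∉ S := by
          by_contra! hall
          refine hS ⟨0, m + 3, ?_⟩
          ext k
          simp only [hall k, mem_iv, true_iff]
          omega
        obtain ⟨i, hi⟩ := this
        obtain ⟨S', rfl⟩ := exists_eq_image_succAbove hi
        rw [← D_model_collapse, ← D_model_collapse]
        exact ih (m + 2) (by omega) (h.2 i) (h'.2 i) S'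

/-- The collapses already have the right dimensions on blocks. The remaining condition for their
compatibility is an upper bound on `D` after omitting a column, inherited from the collapses of
`Y'`. -/
lemma Compatible.stronglyCompatible_of_D_le {p : KostantPicture n} {Y Y' : Lat n}
    (h : Compatible p Y) (h' : StronglyCompatible n p Y')
    (hle : ∀ S, D Y.model S ≤ D Y'.model S) : StronglyCompatible n p Y := by
  induction n using Nat.strong_induction_on with
  | _ m ih =>
    match m, p, Y, Y', h, h', hle, ih with
    | 0, p, Y, Y', h, h', hle, _ | 1, p, Y, Y', h, h', hle, _
    | 2, p, Y, Y', h, h', hle, _ => exact h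
    | m + 3, p, Y, Y', h, h', hle, ih =>
      refine ⟨h, fun i => ?_⟩
      have hle' : ∀ S, D (Y.collapse i).model S ≤ D (Y'.collapse i).model S := fun S => by
        rw [D_model_collapse, D_model_collapse]
        exact hle _
      refine ih (m + 2) (by omega) (compatible_iff_D.mpr ⟨h.D_iv_collapse i, ?_⟩) (h'.2 i) hle'
      intro R k _ _
      rw [← (h'.2 i).compatible.D_iv_diff R.left R.right k]
      exact Nat.add_le_add_left (hle' _) _

/-! ### A strongly compatible lattice -/

lemma iv_self (i : Fin n) : iv n i i = {i} := by
  ext k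
  simp only [mem_iv, Set.mem_singleton_iff, Fin.ext_iff]
  omega

/-- A lattice with given `p` and `λ` whose intersections with the sums of columns have the smallest
dimensions. -/
def genericLat (p : KostantPicture n) (lam : Fin n → ℤ) : Lat n :=
  ofModel (fun i => lam i - p.leftEnds i) (star n (mult p)) fun _ hx => tau_mem_star hx

lemma star_inf_VS_singleton (p : KostantPicture n) (i : Fin n) :
    star n (mult p) ⊓ VS {i} = ⊥ := by
  have : FiniteDimensional ℂ ↥(star n (mult p) ⊓ VS {i}) :=
    Submodule.finiteDimensional_of_le inf_le_left
  rw [← Submodule.finrank_eq_zero (R := ℂ), ← iv_self]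
  exact (D_star_iv p i i).trans (cnt_eq_zero p le_rfl)

lemma model_genericLat (p : KostantPicture n) (lam : Fin n → ℤ) :
    (genericLat p lam).model = star n (mult p) :=
  model_ofModel _ _ _ (star_inf_VS_singleton p)

lemma delta_genericLat (p : KostantPicture n) (lam : Fin n → ℤ) :
    (genericLat p lam).delta = fun i => lam i - p.leftEnds i :=
  delta_ofModel _ _ _ (star_inf_VS_singleton p)

lemma mem_M_of_D_iv {p : KostantPicture n} {lam : Fin n → ℤ} {Y : Lat n}
    (h : ∀ a b, D Y.model (iv n a b) = cnt p a b)
    (hd : Y.delta = fun i => lam i - p.leftEnds i) : Y ∈ M p lam := by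
  have hp := picture_eq h
  refine ⟨hp, ?_⟩
  ext1 i
  rw [Lat.coweight, hp, hd]
  ring

lemma delta_eq_of_mem_M {p : KostantPicture n} {lam : Fin n → ℤ} {Y : Lat n} (h : Y ∈ M p lam) :
    Y.delta = fun i => lam i - p.leftEnds i := by
  ext1 i
  rw [← h.2, Lat.coweight, h.1]
  ring

lemma stronglyCompatible_genericLat (p : KostantPicture n) (lam : Fin n → ℤ) :
    StronglyCompatible n p (genericLat p lam) := by
  apply IsTropical.stronglyCompatible
  · rw [model_genericLat]
    exact star_isTropical _ _
  · rw [model_genericLat]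
    exact D_star_iv p

lemma genericLat_mem (p : KostantPicture n) (lam : Fin n → ℤ) :
    genericLat p lam ∈ MDDagger p lam := by
  have h := stronglyCompatible_genericLat p lam
  exact ⟨⟨mem_M_of_D_iv h.compatible.D_iv (delta_genericLat p lam), h.compatible⟩, h⟩

/-- Strong compatibility becomes finitely many upper bounds on dimensions of intersections, which
are open conditions. -/
lemma mem_MDDagger_iff {p : KostantPicture n} {lam : Fin n → ℤ} {Y : Lat n}
    (hY : Y ∈ MDagger p lam) :
    Y ∈ MDDagger p lam ↔ ∀ S, D Y.model S ≤ D (genericLat p lam).model S := by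
  constructor
  · exact fun h S => (h.2.D_eq (stronglyCompatible_genericLat p lam) S).le
  · exact fun h => ⟨hY, hY.2.stronglyCompatible_of_D_le (stronglyCompatible_genericLat p lam) h⟩

end

section

variable {n : ℕ}

/-! ### Lattices as subspaces of a finite-dimensional space -/

lemma finrank_map_add_finrank_inf_ker {V V' : Type*} [AddCommGroup V] [Module ℂ V]
    [AddCommGroup V'] [Module ℂ V'] (f : V →ₗ[ℂ] V') (U : Submodule ℂ V) [FiniteDimensional ℂ U] :
    Module.finrank ℂ ↥(U.map f) + Module.finrank ℂ ↥(U ⊓ LinearMap.ker f) =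
      Module.finrank ℂ U := by
  have h := LinearMap.finrank_range_add_finrank_ker (f.domRestrict U)
  rw [LinearMap.range_domRestrict] at h
  rw [← h]
  congr 1
  have hk : (LinearMap.ker (f.domRestrict U)).map U.subtype = U ⊓ LinearMap.ker f := by
    ext x
    constructor
    · rintro ⟨y, hy, rfl⟩
      exact ⟨y.2, hy⟩
    · rintro ⟨h1, h2⟩
      exact ⟨⟨x, h1⟩, h2, rfl⟩
  rw [← hk, Submodule.finrank_map_subtype_eq]

/-- The vectors supported on `T`. -/
def supp {ι : Type*} (T : Set ι) : Submodule ℂ (ι → ℂ) where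
  carrier := {v | ∀ b, b ∉ T → v b = 0}
  zero_mem' := fun _ _ => rfl
  add_mem' := fun {x y} hx hy k hk => by simp [hx k hk, hy k hk]
  smul_mem' := fun c x hx k hk => by simp [hx k hk]

lemma mem_supp {ι : Type*} {T : Set ι} {v : ι → ℂ} : v ∈ supp T ↔ ∀ b, b ∉ T → v b = 0 := Iff.rfl

lemma finrank_supp {ι : Type*} [Fintype ι] (T : Set ι) [DecidablePred (· ∈ T)] :
    Module.finrank ℂ ↥(supp T) = Fintype.card T := by
  have e : supp T = ⨅ i ∈ Tᶜ, LinearMap.ker (LinearMap.proj i : (ι → ℂ) →ₗ[ℂ] ℂ) := by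
    ext v
    simp [mem_supp, Submodule.mem_iInf]
  rw [e, (LinearMap.iInfKerProjEquiv ℂ (fun _ : ι => ℂ) (I := T) (J := Tᶜ)
    disjoint_compl_right (by simp)).finrank_eq, Module.finrank_fintype_fun_eq_card]

/-- The vector of `X` with given coordinates in the box. -/
def sigma (n N : ℕ) : (Box n N → ℂ) →ₗ[ℂ] X n :=
  ∑ b : Box n N, (LinearMap.proj b : (Box n N → ℂ) →ₗ[ℂ] ℂ).smulRight (tvec b.1 (b.2 : ℤ))

lemma sigma_apply {N : ℕ} (v : Box n N → ℂ) :
    sigma n N v = ∑ b : Box n N, v b • tvec b.1 (b.2 : ℤ) := by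
  simp [sigma, LinearMap.sum_apply]

lemma coeff_sigma {N : ℕ} (v : Box n N → ℂ) (i : Fin n) (j : ℤ) :
    (sigma n N v i).coeff j = ∑ b : Box n N, if b.1 = i ∧ (b.2 : ℤ) = j then v b else 0 := by
  rw [sigma_apply, Finset.sum_apply]
  simp only [AddMonoidAlgebra.coeff_sum, Finsupp.coe_finsetSum, Finset.sum_apply]
  refine Finset.sum_congr rfl fun b _ => ?_
  by_cases h : b.1 = i
  · subst h
    simp [tvec]
  · rw [if_neg fun h' => h h'.1, Pi.smul_apply, tvec, Pi.single_eq_of_ne (Ne.symm h)]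
    simp

/-- The coordinates in the box. -/
def rho (n N : ℕ) : X n →ₗ[ℂ] (Box n N → ℂ) where
  toFun x b := (x b.1).coeff (b.2 : ℤ)
  map_add' _ _ := rfl
  map_smul' _ _ := rfl

lemma rho_apply {N : ℕ} (x : X n) (b : Box n N) : rho n N x b = (x b.1).coeff (b.2 : ℤ) := rfl

@[simp] lemma rho_sigma {N : ℕ} (v : Box n N → ℂ) : rho n N (sigma n N v) = v := by
  ext b
  rw [rho_apply, coeff_sigma, Finset.sum_eq_single b]
  · simp
  · rintro ⟨i, j⟩ - hb
    refine if_neg fun h => hb ?_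
    exact Prod.ext h.1 (Subtype.ext h.2)
  · simp

lemma rho_eq_zero {N : ℕ} {x : X n} (hx : x ∈ tX₀ n N) : rho n N x = 0 := by
  ext b
  exact mem_tX₀.mp hx b.1 b.2 (Finset.mem_Ico.mp b.2.2).2

lemma sub_sigma_rho_mem {N : ℕ} {x : X n} (hx : x ∈ tX₀ n (-(N : ℤ))) :
    x - sigma n N (rho n N x) ∈ tX₀ n N := by
  rw [mem_tX₀] at hx ⊢
  intro i j hj
  change (x i).coeff j - (sigma n N (rho n N x) i).coeff j = 0
  by_cases hj' : j < -(N : ℤ)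
  · rw [hx i j hj', coeff_sigma, zero_sub, neg_eq_zero]
    refine Finset.sum_eq_zero fun b _ => if_neg ?_
    rintro ⟨-, h⟩
    have := (Finset.mem_Ico.mp b.2.2).1
    omega
  · have : j ∈ Finset.Ico (-(N : ℤ)) (N : ℤ) := Finset.mem_Ico.mpr ⟨by omega, hj⟩
    have h := congrFun (rho_sigma (rho n N x)) (i, ⟨j, this⟩)
    rw [rho_apply, rho_apply] at h
    rw [h, sub_self]

lemma rowLattice_eq {N k : ℕ} (A : Matrix (Fin k) (Box n N) ℂ) :
    rowLattice N A = (Submodule.span ℂ (Set.range A)).map (sigma n N) ⊔ tX₀ n N := by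
  have e : (Set.range fun a : Fin k => ∑ b : Box n N, A a b • tvec b.1 (b.2 : ℤ)) =
      sigma n N '' Set.range A := by
    rw [← Set.range_comp (g := sigma n N) (f := fun a => A a)]
    congr 1
    ext1 a
    exact (sigma_apply (A a)).symm
  rw [rowLattice, Submodule.map_span, e]

lemma map_rho_rowLattice {N k : ℕ} (A : Matrix (Fin k) (Box n N) ℂ) :
    (rowLattice N A).map (rho n N) = Submodule.span ℂ (Set.range A) := by
  have h0 : (tX₀ n N).map (rho n N) = ⊥ := by
    rw [eq_bot_iff]
    rintro _ ⟨x, hx, rfl⟩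
    exact rho_eq_zero hx
  have h1 : rho n N ∘ₗ sigma n N = LinearMap.id := LinearMap.ext rho_sigma
  rw [rowLattice_eq, Submodule.map_sup, h0, sup_bot_eq, ← Submodule.map_comp, h1,
    Submodule.map_id]

lemma eq_map_sigma_sup {N : ℕ} {Z : Submodule ℂ (X n)} (h1 : tX₀ n N ≤ Z)
    (h2 : Z ≤ tX₀ n (-(N : ℤ))) : Z = (Z.map (rho n N)).map (sigma n N) ⊔ tX₀ n N := by
  apply le_antisymm
  · intro x hx
    have := Submodule.add_mem_sup (S := (Z.map (rho n N)).map (sigma n N))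
      ⟨_, ⟨x, hx, rfl⟩, rfl⟩ (sub_sigma_rho_mem (h2 hx))
    rwa [add_sub_cancel] at this
  · refine sup_le ?_ h1
    rintro _ ⟨_, ⟨x, hx, rfl⟩, rfl⟩
    have := sub_mem hx (h1 (sub_sigma_rho_mem (h2 hx)))
    rwa [sub_sub_cancel] at this

lemma eq_rowLattice_iff {N k : ℕ} {Z : Submodule ℂ (X n)} (h1 : tX₀ n N ≤ Z)
    (h2 : Z ≤ tX₀ n (-(N : ℤ))) (A : Matrix (Fin k) (Box n N) ℂ) :
    Z = rowLattice N A ↔ Submodule.span ℂ (Set.range A) = Z.map (rho n N) := by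
  constructor
  · rintro h
    rw [h, map_rho_rowLattice]
  · intro h
    rw [rowLattice_eq, h]
    exact eq_map_sigma_sup h1 h2

lemma exists_eq_rowLattice {N : ℕ} {Z : Submodule ℂ (X n)} (h1 : tX₀ n N ≤ Z)
    (h2 : Z ≤ tX₀ n (-(N : ℤ))) : ∃ (k : ℕ) (A : Matrix (Fin k) (Box n N) ℂ),
      LinearIndependent ℂ A.row ∧ Z = rowLattice N A := by
  set b := Module.finBasis ℂ (Z.map (rho n N))
  refine ⟨_, Matrix.of fun a => (b a : Box n N → ℂ), ?_, ?_⟩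
  · exact b.linearIndependent.map' (Z.map (rho n N)).subtype (Submodule.ker_subtype _)
  · rw [eq_rowLattice_iff h1 h2]
    have : Set.range (Matrix.of fun a => (b a : Box n N → ℂ)) =
        (Z.map (rho n N)).subtype '' Set.range b := by
      rw [← Set.range_comp]
      rfl
    rw [this, ← Submodule.map_span, b.span_eq, Submodule.map_top, Submodule.range_subtype]

/-! ### Ranks of intersections with coordinate subspaces -/

/-- Combinations of the rows that vanish outside `T` form the left kernel of the submatrix with the
columns outside `T`; rank–nullity gives its dimension. -/
lemma finrank_span_inf_supp {ι : Type*} [Fintype ι] {k : ℕ} {A : Matrix (Fin k) ι ℂ}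
    (hA : LinearIndependent ℂ A.row) (T : Set ι) :
    Module.finrank ℂ ↥(Submodule.span ℂ (Set.range A) ⊓ supp T) +
      Module.finrank ℂ ↥(Submodule.span ℂ (A.col '' Tᶜ)) = k := by
  classical
  set B : Matrix (Fin k) ↥Tᶜ ℂ := A.submatrix id Subtype.val
  have h1 : Submodule.span ℂ (A.col '' Tᶜ) = Submodule.span ℂ (Set.range B.col) := by
    congr 1
    ext v
    constructor
    · rintro ⟨b, hb, rfl⟩
      exact ⟨⟨b, hb⟩, rfl⟩
    · rintro ⟨⟨b, hb⟩, rfl⟩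
      exact ⟨b, hb, rfl⟩
  have h2 : Submodule.span ℂ (Set.range A) = LinearMap.range A.vecMulLinear := by
    rw [range_vecMulLinear]
    rfl
  have h3 : Submodule.span ℂ (Set.range A) ⊓ supp T =
      (LinearMap.ker B.vecMulLinear).map A.vecMulLinear := by
    rw [h2]
    ext v
    constructor
    · rintro ⟨⟨w, rfl⟩, hw⟩
      refine ⟨w, ?_, rfl⟩
      rw [SetLike.mem_coe, LinearMap.mem_ker]
      ext1 b
      exact hw b.1 b.2
    · rintro ⟨w, hw, rfl⟩
      refine ⟨⟨w, rfl⟩, fun b hb => ?_⟩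
      exact congrFun (LinearMap.mem_ker.mp hw) ⟨b, hb⟩
  have h4 : Function.Injective A.vecMulLinear := Matrix.vecMul_injective_iff.mpr hA
  rw [h1, ← Matrix.rank_eq_finrank_span_cols, ← Matrix.rank_transpose, h3,
    finrank_map_of_forall _ _ fun x _ hx => h4 (by rw [hx, map_zero]), Matrix.rank,
    Matrix.mulVecLin_transpose, add_comm, LinearMap.finrank_range_add_finrank_ker,
    Module.finrank_fintype_fun_eq_card, Fintype.card_fin]

lemma det_submatrix_ne_zero_iff {ι : Type*} {k : ℕ} {A : Matrix (Fin k) ι ℂ} {c : Fin k → ι} :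
    (A.submatrix id c).det ≠ 0 ↔ LinearIndependent ℂ fun a => A.col (c a) := by
  rw [← isUnit_iff_ne_zero, ← Matrix.isUnit_iff_isUnit_det,
    ← Matrix.linearIndependent_cols_iff_isUnit]
  rfl

/-- The dimension of the intersection of the row space with a coordinate subspace is bounded by `d`
if and only if some minor, with at most `d` of its columns in the subspace, does not vanish. -/
lemma finrank_span_inf_supp_le_iff {ι : Type*} [Fintype ι] {k : ℕ} {A : Matrix (Fin k) ι ℂ}
    (hA : LinearIndependent ℂ A.row) (T : Set ι) (d : ℕ) :
    Module.finrank ℂ ↥(Submodule.span ℂ (Set.range A) ⊓ supp T) ≤ d ↔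
      ∃ c : Fin k → ι, (A.submatrix id c).det ≠ 0 ∧ {a | c a ∈ T}.ncard ≤ d := by
  classical
  have hdim := finrank_span_inf_supp hA T
  have hcompl : ∀ c : Fin k → ι, {a | c a ∈ T}.ncard + {a | c a ∉ T}.ncard = k := fun c => by
    have := Set.ncard_add_ncard_compl {a | c a ∈ T}
    rwa [Nat.card_eq_fintype_card, Fintype.card_fin] at this
  constructor
  · intro hd
    -- A basis of the span of the columns outside `T` is extended to a basis of the whole column
    -- space; the resulting minor uses as few columns in `T` as possible.
    obtain ⟨B₀, hB₀T, -, hsp₀, hli₀⟩ := exists_linearIndepOn_extension (K := ℂ) (v := A.col)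
      (s := ∅) (t := Tᶜ) (linearIndepOn_empty _ _) (Set.empty_subset _)
    obtain ⟨B, -, hB₀B, hsp, hli⟩ := exists_linearIndepOn_extension hli₀ (Set.subset_univ _)
    have hcard : Fintype.card B = k := by
      have h1 := finrank_span_eq_card hli
      have h2 := hA.rank_matrix
      rw [Matrix.rank_eq_finrank_span_cols, Fintype.card_fin] at h2
      suffices hsp' : Submodule.span ℂ (Set.range fun b : B => A.col b) =
          Submodule.span ℂ (Set.range A.col) by
        rw [hsp'] at h1
        exact h1.symm.trans h2
      apply le_antisymm
      · refine Submodule.span_mono ?_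
        rintro _ ⟨b, rfl⟩
        exact ⟨b.1, rfl⟩
      · rw [Submodule.span_le]
        rw [Set.image_univ] at hsp
        refine hsp.trans ?_
        refine Submodule.span_mono ?_
        rintro _ ⟨b, hb, rfl⟩
        exact ⟨⟨b, hb⟩, rfl⟩
    set e : Fin k ≃ B := (Fintype.equivFinOfCardEq hcard).symm
    refine ⟨fun a => (e a).1, ?_, ?_⟩
    · rw [det_submatrix_ne_zero_iff]
      exact hli.comp e e.injective
    · have h1 : Module.finrank ℂ ↥(Submodule.span ℂ (A.col '' Tᶜ)) ≤ B₀.ncard := by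
        have h2 := finrank_span_eq_card hli₀
        rw [← Nat.card_eq_fintype_card, Nat.card_coe_set_eq] at h2
        rw [← h2]
        refine Submodule.finrank_mono ?_
        rw [Submodule.span_le]
        refine hsp₀.trans (Submodule.span_mono ?_)
        rintro _ ⟨b, hb, rfl⟩
        exact ⟨⟨b, hb⟩, rfl⟩
      have h2 : B₀.ncard ≤ {a | (e a).1 ∉ T}.ncard := by
        have : B₀ ⊆ (fun a => (e a).1) '' {a | (e a).1 ∉ T} := fun b hb =>
          ⟨e.symm ⟨b, hB₀B hb⟩, by simpa using hB₀T hb, by simp⟩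
        exact (Set.ncard_le_ncard this).trans (Set.ncard_image_le (Set.toFinite _))
      have h3 := hcompl fun a => (e a).1
      change {a | (e a).1 ∈ T}.ncard ≤ d
      change {a | (e a).1 ∈ T}.ncard + {a | (e a).1 ∉ T}.ncard = k at h3
      omega
  · rintro ⟨c, hc, hcd⟩
    rw [det_submatrix_ne_zero_iff] at hc
    have h1 := finrank_span_eq_card (hc.comp (Subtype.val : {a | c a ∉ T} → Fin k)
      Subtype.val_injective)
    rw [← Nat.card_eq_fintype_card, Nat.card_coe_set_eq] at h1
    have h2 : Module.finrank ℂ ↥(Submodule.span ℂ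
        (Set.range ((fun a => A.col (c a)) ∘ (Subtype.val : {a | c a ∉ T} → Fin k)))) ≤
        Module.finrank ℂ ↥(Submodule.span ℂ (A.col '' Tᶜ)) := by
      refine Submodule.finrank_mono (Submodule.span_mono ?_)
      rintro _ ⟨a, rfl⟩
      exact ⟨c a.1, a.2, rfl⟩
    have h3 := hcompl c
    omega

/-! ### Openness -/

lemma delta_le_of_le {Y : Lat n} {N : ℕ} (h : Y.space ≤ tX₀ n (-(N : ℤ))) (i : Fin n) :
    Y.delta i ≤ N := by
  have := h (Y.tvec_mem_iff.mpr (le_refl (-Y.delta i)))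
  rw [tX₀_eq_ker, tvec_mem_ker_phi] at this
  omega

lemma neg_le_delta_of_le {Y : Lat n} {N : ℕ} (h : tX₀ n N ≤ Y.space) (i : Fin n) :
    -(N : ℤ) ≤ Y.delta i := by
  have := Y.tvec_mem_iff.mp (h (Submodule.subset_span ⟨i, N, le_rfl, rfl⟩))
  omega

/-- The boxes in the columns of `S`. -/
def boxes (N : ℕ) (S : Set (Fin n)) : Set (Box n N) := {b | b.1 ∈ S}

-- The intersection maps onto `Y.model ⊓ VS S`, and the kernel is spanned by the basis vectors of
-- `Y_0` in the box: in column `i` the exponents from `-δ_i` to `N - 1`, which are `δ_i + N` many.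
open Classical in
lemma finrank_inf_boxes {Y : Lat n} {N : ℕ} (h1 : tX₀ n N ≤ Y.space)
    (h2 : Y.space ≤ tX₀ n (-(N : ℤ))) (S : Set (Fin n)) :
    (Module.finrank ℂ ↥(Y.space.map (rho n N) ⊓ supp (boxes N S)) : ℤ) =
      D Y.model S + ∑ i, if i ∈ S then Y.delta i + N else 0 := by
  set U := Y.space.map (rho n N) ⊓ supp (boxes N S)
  set f : (Box n N → ℂ) →ₗ[ℂ] P n := phi Y.delta ∘ₗ sigma n N
  have hker0 : tX₀ n N ≤ LinearMap.ker (phi Y.delta) := by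
    intro x hx
    rw [mem_ker_phi]
    intro i j hj
    have := neg_le_delta_of_le h1 i
    have := delta_le_of_le h2 i
    exact mem_tX₀.mp hx i j (by have := neg_le_delta_of_le h1 i; omega)
  have hsig : ∀ x ∈ Y.space, sigma n N (rho n N x) ∈ Y.space := fun x hx => by
    have := sub_mem hx (h1 (sub_sigma_rho_mem (h2 hx)))
    rwa [sub_sub_cancel] at this
  have hmap : U.map f = Y.model ⊓ VS S := by
    apply le_antisymm
    · rintro _ ⟨v, ⟨⟨x, hx, rfl⟩, hv⟩, rfl⟩
      refine ⟨⟨_, hsig x hx, rfl⟩, fun k hk => ?_⟩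
      have : sigma n N (rho n N x) k = 0 := by
        ext j
        rw [coeff_sigma]
        refine Finset.sum_eq_zero fun b _ => ?_
        split_ifs with hb
        · exact hv b fun hb' => hk (hb.1 ▸ hb')
        · rfl
      change phi1 _ (sigma n N (rho n N x) k) = 0
      rw [this, map_zero]
    · rintro z ⟨hz, hzS⟩
      have hx : psi Y.delta z ∈ Y.space := by rwa [Y.mem_iff, phi_psi]
      refine ⟨rho n N (psi Y.delta z), ⟨⟨_, hx, rfl⟩, fun b hb => ?_⟩, ?_⟩
      · rw [rho_apply, psi_apply, hzS b.1 hb, map_zero]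
        rfl
      · have := hker0 (sub_sigma_rho_mem (h2 hx))
        rw [LinearMap.mem_ker, map_sub, phi_psi, sub_eq_zero] at this
        exact this.symm
  have hker : U ⊓ LinearMap.ker f = supp {b | b.1 ∈ S ∧ -Y.delta b.1 ≤ (b.2 : ℤ)} := by
    have hk : ∀ v, v ∈ LinearMap.ker f ↔ ∀ b : Box n N, (b.2 : ℤ) < -Y.delta b.1 → v b = 0 := by
      intro v
      rw [LinearMap.mem_ker]
      change sigma n N v ∈ LinearMap.ker (phi Y.delta) ↔ _
      rw [mem_ker_phi]
      constructor
      · intro h b hb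
        have := h b.1 b.2 hb
        rwa [← rho_apply, rho_sigma] at this
      · intro h i j hj
        rw [coeff_sigma]
        refine Finset.sum_eq_zero fun b _ => ?_
        split_ifs with hb
        · exact h b (by rw [hb.1, hb.2]; exact hj)
        · rfl
    ext v
    constructor
    · rintro ⟨⟨-, hv⟩, hv'⟩ b hb
      by_cases hbS : b.1 ∈ S
      · exact (hk v).mp hv' b (by by_contra h; exact hb ⟨hbS, by omega⟩)
      · exact hv b hbS
    · intro hv
      have hv' : v ∈ LinearMap.ker f := (hk v).mpr fun b hb => hv b fun h => by
        have := h.2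
        omega
      refine ⟨⟨⟨sigma n N v, Y.ker_phi_le hv', rho_sigma v⟩, fun b hb => hv b fun h => hb h.1⟩, hv'⟩
  have key := finrank_map_add_finrank_inf_ker f U
  rw [hmap, hker, finrank_supp] at key
  rw [← key, Nat.cast_add, D]
  congr 1
  rw [Fintype.card_subtype]
  simp only [Set.mem_ofPred_eq]
  rw [Finset.card_filter, Fintype.sum_prod_type, Nat.cast_sum]
  refine Finset.sum_congr rfl fun i _ => ?_
  by_cases hi : i ∈ S
  · simp only [hi, true_and, if_true]
    rw [← Finset.card_filter]
    have e : ((Finset.univ.filter fun j : ↥(Finset.Ico (-(N : ℤ)) (N : ℤ)) =>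
        -Y.delta i ≤ (j : ℤ)).map (Function.Embedding.subtype _)) =
        Finset.Ico (-Y.delta i) (N : ℤ) := by
      ext j
      have := delta_le_of_le h2 i
      simp only [Finset.mem_map, Finset.mem_filter, Finset.mem_univ, true_and,
        Function.Embedding.coe_subtype, Subtype.exists, Finset.mem_Ico]
      constructor
      · rintro ⟨j, ⟨_, hj⟩, h, rfl⟩
        exact ⟨h, hj⟩
      · rintro ⟨h, hj⟩
        exact ⟨j, ⟨by omega, hj⟩, h, rfl⟩
    rw [← Finset.card_map (Function.Embedding.subtype _), e, Int.card_Ico]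
    have := neg_le_delta_of_le h1 i
    omega
  · simp [hi]

-- Up to a constant depending on `N`, the bounded quantity is the dimension of the intersection of
-- `Y / t^N X_0` with a coordinate subspace, so the set is a union of nonvanishing loci of single
-- Plücker coordinates. The summands `δ_i` cannot be dropped in general, since they compensate for
-- the variation of `Y_0`.
open Classical in
lemma isOpen_setOf_D_le (S : Set (Fin n)) (e : ℤ) :
    IsOpen {Y : Lat n | (D Y.model S : ℤ) + (∑ i, if i ∈ S then Y.delta i else 0) ≤ e} := by
  refine isOpen_iSup_iff.mpr fun N => isOpen_coinduced.mpr ?_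
  let := boundedZariski n N
  set d : ℤ := e + ∑ i : Fin n, if i ∈ S then (N : ℤ) else 0 with hd
  have key : (Subtype.val : BoundedLat n N → Lat n) ⁻¹'
      {Y : Lat n | (D Y.model S : ℤ) + (∑ i, if i ∈ S then Y.delta i else 0) ≤ e} =
      ⋃ (k : ℕ) (c : Fin k → Box n N) (_ : ({a | c a ∈ boxes N S}.ncard : ℤ) ≤ d),
        (Subtype.val : BoundedLat n N → Lat n) ⁻¹' pluckerOpen n N k (MvPolynomial.X c) := by
    ext ⟨Y, h1, h2⟩
    have hfin := finrank_inf_boxes h1 h2 S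
    have hsum : (∑ i, if i ∈ S then Y.delta i + (N : ℤ) else 0) =
        (∑ i, if i ∈ S then Y.delta i else 0) + ∑ i : Fin n, if i ∈ S then (N : ℤ) else 0 := by
      rw [← Finset.sum_add_distrib]
      refine Finset.sum_congr rfl fun i _ => ?_
      split_ifs <;> simp
    have hiff : (D Y.model S : ℤ) + (∑ i, if i ∈ S then Y.delta i else 0) ≤ e ↔
        (Module.finrank ℂ ↥(Y.space.map (rho n N) ⊓ supp (boxes N S)) : ℤ) ≤ d := by
      rw [hfin, hsum, hd]
      constructor <;> intro h <;> linarith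
    simp only [Set.mem_preimage, Set.mem_iUnion, exists_prop]
    refine hiff.trans ?_
    constructor
    · intro h
      obtain ⟨k, A, hA, hYA⟩ := exists_eq_rowLattice h1 h2
      have hsp := (eq_rowLattice_iff h1 h2 A).mp hYA
      rw [← hsp] at h
      -- A dimension is bounded by `d` here, so `d` is nonnegative and `d.toNat` loses nothing.
      obtain ⟨c, hc, hcd⟩ := (finrank_span_inf_supp_le_iff hA (boxes N S) d.toNat).mp (by omega)
      refine ⟨k, c, by omega, A, hA, hYA, ?_⟩
      rwa [MvPolynomial.eval_X]
    · rintro ⟨k, c, hcd, A, hA, hYA, hne⟩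
      have hsp := (eq_rowLattice_iff h1 h2 A).mp hYA
      rw [MvPolynomial.eval_X] at hne
      have := (finrank_span_inf_supp_le_iff hA (boxes N S) d.toNat).mpr ⟨c, hne, by omega⟩
      rw [hsp] at this
      omega
  rw [key]
  refine isOpen_iUnion fun k => isOpen_iUnion fun c => isOpen_iUnion fun _ => ?_
  exact TopologicalSpace.isOpen_generateFrom_of_mem
    ⟨k, 1, MvPolynomial.X c, MvPolynomial.isHomogeneous_X _ _, rfl⟩

/-- On `M p lam` the `δ_i` are fixed by `p` and `lam`, so the semicontinuous quantity is `D` up to a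
constant, and there are only finitely many sets of columns. -/
lemma isOpen_MDDagger (p : KostantPicture n) (lam : Fin n → ℤ) :
    IsOpen {Y : ↥(MDagger p lam) | Y.1 ∈ MDDagger p lam} := by
  classical
  have e : {Y : ↥(MDagger p lam) | Y.1 ∈ MDDagger p lam} = Subtype.val ⁻¹'
      ⋂ S : Set (Fin n), {Y : Lat n | (D Y.model S : ℤ) + (∑ i, if i ∈ S then Y.delta i else 0) ≤
        D (genericLat p lam).model S + ∑ i, if i ∈ S then lam i - p.leftEnds i else 0} := by
    ext ⟨Y, hY⟩
    simp only [Set.mem_preimage, Set.mem_iInter]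
    refine (mem_MDDagger_iff hY).trans (forall_congr' fun S => ?_)
    change _ ↔ (D Y.model S : ℤ) + (∑ i, if i ∈ S then Y.delta i else 0) ≤ _
    rw [delta_eq_of_mem_M hY.1, add_le_add_iff_right, Nat.cast_le]
  rw [e]
  exact (isOpen_iInter_of_finite fun S => isOpen_setOf_D_le S _).preimage continuous_subtype_val

end

section

variable {n : ℕ}

/-! ### Coordinates on the flag bases -/

instance (p : KostantPicture n) : DecidableEq (KLoop p) := Classical.decEq _

/-- `C` and `a` record the action of `t` and the leading coefficients of a flag basis. -/
structure IsFlagData {R : Type*} [CommRing R] {p : KostantPicture n}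
    (C : Matrix (KLoop p) (KLoop p) R) (a : Matrix (KLoop p) (Fin n) R) : Prop where
  tri : ∀ L L', ¬ L'.Inside L → C L L' = 0
  passes : ∀ L i, ¬ L.Passes i → a L i = 0

lemma KLoop.Inside.passes {p : KostantPicture n} {L L' : KLoop p} (h : L'.Inside L) {i : Fin n}
    (hi : L'.Passes i) : L.Passes i := by
  rcases h with ⟨_, h1, h2⟩ | ⟨h1, _⟩
  · exact ⟨h1.trans hi.1, hi.2.trans h2⟩
  · rwa [KLoop.Passes, ← h1]

section Ring

variable {R : Type*} [CommRing R] {p : KostantPicture n}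
  {C : Matrix (KLoop p) (KLoop p) R} {a : Matrix (KLoop p) (Fin n) R}

lemma IsFlagData.pow_mul_eq_zero (h : IsFlagData C a) (k : ℕ) {L : KLoop p} {i : Fin n} (hi : ¬ L.Passes i) :
    (C ^ k * a) L i = 0 := by
  induction k generalizing L with
  | zero => rw [pow_zero, Matrix.one_mul, h.passes L i hi]
  | succ k ih =>
    rw [pow_succ', Matrix.mul_assoc, Matrix.mul_apply]
    refine Finset.sum_eq_zero fun L' _ => ?_
    by_cases hin : L'.Inside L
    · rw [ih fun hi' => hi (hin.passes hi'), mul_zero]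
    · rw [h.tri L L' hin, zero_mul]

/-- A nonzero entry of `C ^ k` in row `L` requires a chain of `k` loops, each inside the previous
one, all inside `L`. -/
lemma IsFlagData.pow_eq_zero_of_lt (h : IsFlagData C a) {k : ℕ} {L : KLoop p}
    (hk : {L' : KLoop p | L'.Inside L}.ncard < k) (M : KLoop p) : (C ^ k) L M = 0 := by
  induction k generalizing L with
  | zero => omega
  | succ k ih =>
    rw [pow_succ', Matrix.mul_apply]
    refine Finset.sum_eq_zero fun L' _ => ?_
    by_cases hin : L'.Inside L
    · have : {L'' : KLoop p | L''.Inside L'}.ncard < {L' : KLoop p | L'.Inside L}.ncard := by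
        refine Set.ncard_lt_ncard (Set.ssubset_iff_exists.mpr
          ⟨fun L'' h'' => h''.trans hin, L', hin, fun h' => h'.ne rfl⟩)
      rw [ih (by omega), mul_zero]
    · rw [h.tri L L' hin, zero_mul]

lemma IsFlagData.pow_eq_zero (h : IsFlagData C a) {k : ℕ} (hk : Fintype.card (KLoop p) < k) : C ^ k = 0 := by
  ext L M
  refine h.pow_eq_zero_of_lt (lt_of_le_of_lt ?_ hk) M
  rw [← Nat.card_eq_fintype_card]
  exact Set.ncard_le_card _

end Ring

variable {p : KostantPicture n}

/-- The vectors with given coordinates. -/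
def flagVec (C : Matrix (KLoop p) (KLoop p) ℂ) (a : Matrix (KLoop p) (Fin n) ℂ) (L : KLoop p) :
    P n := fun i =>
  ∑ k ∈ Finset.range (Fintype.card (KLoop p) + 1), Polynomial.monomial k ((C ^ k * a) L i)

variable {C C' : Matrix (KLoop p) (KLoop p) ℂ} {a a' : Matrix (KLoop p) (Fin n) ℂ}

lemma IsFlagData.coeff_flagVec (h : IsFlagData C a) (L : KLoop p) (i : Fin n) (k : ℕ) :
    (flagVec C a L i).coeff k = (C ^ k * a) L i := by
  rw [flagVec, Polynomial.finsetSum_coeff]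
  simp only [Polynomial.coeff_monomial]
  rw [Finset.sum_ite_eq']
  split_ifs with hk
  · rfl
  · rw [h.pow_eq_zero (by simpa using hk), Matrix.zero_mul, Matrix.zero_apply]

lemma IsFlagData.tau_flagVec (h : IsFlagData C a) (L : KLoop p) :
    tau (flagVec C a L) = ∑ L', C L L' • flagVec C a L' := by
  ext i k
  rw [tau_apply, coeff_dX, h.coeff_flagVec, Finset.sum_apply, Polynomial.finsetSum_coeff, pow_succ',
    Matrix.mul_assoc, Matrix.mul_apply]
  refine Finset.sum_congr rfl fun L' _ => ?_
  rw [Pi.smul_apply, Polynomial.coeff_smul, h.coeff_flagVec, smul_eq_mul]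

lemma IsFlagData.tau_mem_span (h : IsFlagData C a) (L : KLoop p) :
    tau (flagVec C a L) ∈ Submodule.span ℂ (flagVec C a '' {L' | L'.Inside L}) := by
  rw [h.tau_flagVec]
  refine Submodule.sum_mem _ fun L' _ => ?_
  by_cases hin : L'.Inside L
  · exact Submodule.smul_mem _ _ (Submodule.subset_span ⟨L', hin, rfl⟩)
  · rw [h.tri L L' hin, zero_smul]
    exact zero_mem _

lemma IsFlagData.mem_VS (h : IsFlagData C a) (L : KLoop p) :
    flagVec C a L ∈ VS (iv n L.root.left L.root.right) := by
  intro i hi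
  ext k
  rw [h.coeff_flagVec, h.pow_mul_eq_zero k fun hp => hi ⟨hp.1, hp.2⟩, Polynomial.coeff_zero]

lemma IsFlagData.isModelFlag (h : IsFlagData C a)
    (hne : ∀ (L : KLoop p) (i : Fin n), L.Passes i → (C ^ depth p i L * a) L i ≠ 0) :
    IsModelFlag p (Submodule.span ℂ (Set.range (flagVec C a))) (flagVec C a) := by
  have hc : ∀ (L : KLoop p) (i : Fin n), L.Passes i →
      (flagVec C a L i).coeff (depth p i L) ≠ 0 := fun L i hi => by
    rw [h.coeff_flagVec]
    exact hne L i hi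
  exact ⟨linearIndependent_of_coeff_ne h.mem_VS h.tau_mem_span hc, rfl, h.mem_VS, h.tau_mem_span,
    hc⟩

/-- Since `t` shifts coefficients and acts on the basis by `C`, the coefficients at `k + 1` are `C`
times those at `k`. The basis is thus determined by `C` and its constant coefficients. -/
lemma IsModelFlag.exists_isFlagData {W : Submodule ℂ (P n)} {z : KLoop p → P n}
    (hz : IsModelFlag p W z) : ∃ (C : Matrix (KLoop p) (KLoop p) ℂ) (a : Matrix (KLoop p) (Fin n) ℂ),
      IsFlagData C a ∧ flagVec C a = z := by
  have hex : ∀ L, ∃ c : KLoop p → ℂ, (∀ L', ¬ L'.Inside L → c L' = 0) ∧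
      tau (z L) = ∑ L', c L' • z L' := fun L => by
    obtain ⟨l, hl, hlz⟩ := (Finsupp.mem_span_image_iff_linearCombination ℂ).mp (hz.tau_mem L)
    refine ⟨l, fun L' hL' => ?_, ?_⟩
    · by_contra hne
      exact hL' (hl (Finsupp.mem_support_iff.mpr hne))
    · rw [← hlz, Finsupp.linearCombination_apply, Finsupp.sum_fintype _ _ (by simp)]
  obtain ⟨C, hC⟩ : ∃ C : Matrix (KLoop p) (KLoop p) ℂ, ∀ L,
      (∀ L', ¬ L'.Inside L → C L L' = 0) ∧ tau (z L) = ∑ L', C L L' • z L' :=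
    ⟨fun L => (hex L).choose, fun L => (hex L).choose_spec⟩
  have hd : IsFlagData C (Matrix.of fun L i => (z L i).coeff 0) :=
    ⟨fun L => (hC L).1, fun L i hi => by simp [apply_eq_zero_of_not_passes hz.mem_VS hi]⟩
  refine ⟨C, _, hd, ?_⟩
  ext L i k
  rw [hd.coeff_flagVec]
  induction k generalizing L with
  | zero => simp
  | succ k ih =>
    have h1 : (z L i).coeff (k + 1) = ∑ L', C L L' * (z L' i).coeff k := by
      rw [← coeff_dX, ← tau_apply, (hC L).2, Finset.sum_apply, Polynomial.finsetSum_coeff]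
      rfl
    rw [h1, pow_succ', Matrix.mul_assoc, Matrix.mul_apply]
    exact Finset.sum_congr rfl fun L' _ => by rw [ih]

/-! ### Lines of flag bases -/

/-- The line through two matrices. -/
def pencil {l m : Type*} (M M' : Matrix l m ℂ) : Matrix l m (Polynomial ℂ) :=
  Matrix.of fun i j => Polynomial.C (M i j) + Polynomial.X * Polynomial.C (M' i j - M i j)

/-- The point of the line through two matrices with parameter `s`. -/
def pencilAt {l m : Type*} (M M' : Matrix l m ℂ) (s : ℂ) : Matrix l m ℂ :=
  (pencil M M').map (Polynomial.evalRingHom s)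

lemma pencilAt_apply {l m : Type*} (M M' : Matrix l m ℂ) (s : ℂ) (i : l) (j : m) :
    pencilAt M M' s i j = M i j + s * (M' i j - M i j) := by
  simp [pencilAt, pencil]

lemma pencilAt_zero {l m : Type*} (M M' : Matrix l m ℂ) : pencilAt M M' 0 = M := by
  ext i j
  rw [pencilAt_apply, zero_mul, add_zero]

lemma pencilAt_one {l m : Type*} (M M' : Matrix l m ℂ) : pencilAt M M' 1 = M' := by
  ext i j
  rw [pencilAt_apply, one_mul, add_sub_cancel]

lemma IsFlagData.pencilAt (h : IsFlagData C a) (h' : IsFlagData C' a') (s : ℂ) :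
    IsFlagData (pencilAt C C' s) (pencilAt a a' s) :=
  ⟨fun L L' hin => by rw [pencilAt_apply, h.tri L L' hin, h'.tri L L' hin]; simp,
    fun L i hi => by rw [pencilAt_apply, h.passes L i hi, h'.passes L i hi]; simp⟩

lemma pencilAt_pow_mul (C C' : Matrix (KLoop p) (KLoop p) ℂ) (a a' : Matrix (KLoop p) (Fin n) ℂ)
    (s : ℂ) (k : ℕ) (L : KLoop p) (i : Fin n) :
    (pencilAt C C' s ^ k * pencilAt a a' s) L i =
      Polynomial.eval s ((pencil C C' ^ k * pencil a a') L i) := by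
  have : pencilAt C C' s ^ k * pencilAt a a' s =
      (pencil C C' ^ k * pencil a a').map (Polynomial.evalRingHom s) := by
    rw [Matrix.map_mul, Matrix.map_pow]
    rfl
  rw [this]
  rfl

/-- The parameters at which the flag basis is compatible. -/
def goodParams (C C' : Matrix (KLoop p) (KLoop p) ℂ) (a a' : Matrix (KLoop p) (Fin n) ℂ) : Set ℂ :=
  {s | ∀ (L : KLoop p) (i : Fin n), L.Passes i →
    (pencilAt C C' s ^ depth p i L * pencilAt a a' s) L i ≠ 0}

/-- A parameter is bad if it is a root of one of finitely many polynomials, none of them zero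
because `s₀` is good. -/
lemma finite_compl_goodParams {s₀ : ℂ} (h0 : s₀ ∈ goodParams C C' a a') :
    (goodParams C C' a a')ᶜ.Finite := by
  have : (goodParams C C' a a')ᶜ ⊆ ⋃ (q : {q : KLoop p × Fin n // q.1.Passes q.2}),
      {s | ((pencil C C' ^ depth p q.1.2 q.1.1 * pencil a a') q.1.1 q.1.2).IsRoot s} := by
    intro s hs
    simp only [goodParams, Set.mem_compl_iff, Set.mem_ofPred_eq, not_forall, not_not] at hs
    obtain ⟨L, i, hi, hs⟩ := hs
    refine Set.mem_iUnion.mpr ⟨⟨(L, i), hi⟩, ?_⟩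
    rw [pencilAt_pow_mul] at hs
    exact hs
  refine (Set.finite_iUnion fun q => Polynomial.finite_setOfPred_isRoot ?_).subset this
  intro h
  apply h0 q.1.1 q.1.2 q.2
  rw [pencilAt_pow_mul, h, Polynomial.eval_zero]

instance : FiniteDimensional ℂ ↥(Submodule.span ℂ (Set.range (flagVec C a))) :=
  FiniteDimensional.span_of_finite ℂ (Set.finite_range _)

lemma IsFlagData.tau_mem (h : IsFlagData C a) :
    ∀ x ∈ Submodule.span ℂ (Set.range (flagVec C a)),
      tau x ∈ Submodule.span ℂ (Set.range (flagVec C a)) := by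
  rw [← Set.image_univ]
  exact span_stable h.tau_mem_span fun _ _ _ _ => trivial

/-- The lattice spanned by a flag basis. -/
def flagLat (δ : Fin n → ℤ) (h : IsFlagData C a) : Lat n :=
  ofModel δ (Submodule.span ℂ (Set.range (flagVec C a))) h.tau_mem

lemma flagLat_space (δ : Fin n → ℤ) (h : IsFlagData C a) : (flagLat δ h).space =
    (Submodule.span ℂ (Set.range (flagVec C a))).comap (phi δ) := rfl

lemma IsModelFlag.inf_VS_singleton {W : Submodule ℂ (P n)} {z : KLoop p → P n}
    (hz : IsModelFlag p W z) (i : Fin n) : W ⊓ VS {i} = ⊥ := by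
  have := hz.finiteDimensional
  have : FiniteDimensional ℂ ↥(W ⊓ VS {i}) := Submodule.finiteDimensional_of_le inf_le_left
  rw [← Submodule.finrank_eq_zero (R := ℂ), ← iv_self]
  exact (hz.D_iv i i).trans (cnt_eq_zero p le_rfl)

lemma delta_flagLat (h : IsFlagData C a)
    (hne : ∀ (L : KLoop p) (i : Fin n), L.Passes i → (C ^ depth p i L * a) L i ≠ 0)
    (δ : Fin n → ℤ) : (flagLat δ h).delta = δ :=
  delta_ofModel δ _ h.tau_mem (h.isModelFlag hne).inf_VS_singleton

lemma model_flagLat (h : IsFlagData C a)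
    (hne : ∀ (L : KLoop p) (i : Fin n), L.Passes i → (C ^ depth p i L * a) L i ≠ 0)
    (δ : Fin n → ℤ) : (flagLat δ h).model = Submodule.span ℂ (Set.range (flagVec C a)) :=
  model_ofModel δ _ h.tau_mem (h.isModelFlag hne).inf_VS_singleton

lemma flagLat_mem_MDagger (h : IsFlagData C a)
    (hne : ∀ (L : KLoop p) (i : Fin n), L.Passes i → (C ^ depth p i L * a) L i ≠ 0)
    (lam : Fin n → ℤ) :
    flagLat (fun i => lam i - p.leftEnds i) h ∈ MDagger p lam := by
  have hz := h.isModelFlag hne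
  refine ⟨mem_M_of_D_iv ?_ (delta_flagLat h hne _), compatible_iff.mpr ⟨flagVec C a, ?_⟩⟩
  · rw [model_flagLat h hne]
    exact hz.D_iv
  · rwa [model_flagLat h hne]

lemma eq_flagLat {Y : Lat n} (h : IsFlagData C a) (hz : IsModelFlag p Y.model (flagVec C a)) :
    Y = flagLat Y.delta h := by
  have hne : ∀ (L : KLoop p) (i : Fin n), L.Passes i → (C ^ depth p i L * a) L i ≠ 0 :=
    fun L i hi => by
      rw [← h.coeff_flagVec]
      exact hz.coeff_ne L i hi
  refine Lat.ext_model (delta_flagLat h hne _).symm ?_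
  rw [model_flagLat h hne, hz.span_eq]

end

section

variable {n : ℕ} {p : KostantPicture n}

/-! ### Matrices of row lattices -/

/-- The coordinates in the box of a flag basis and of the basis vectors in `Y_0`. -/
def flagRows {R : Type*} [CommRing R] (δ : Fin n → ℤ) (N : ℕ) (C : Matrix (KLoop p) (KLoop p) R)
    (a : Matrix (KLoop p) (Fin n) R) :
    Matrix (KLoop p ⊕ {b : Box n N // -δ b.1 ≤ (b.2 : ℤ)}) (Box n N) R :=
  Matrix.of (Sum.elim
    (fun L b => if (b.2 : ℤ) < -δ b.1 then (C ^ (-δ b.1 - 1 - b.2).toNat * a) L b.1 else 0)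
    (fun t b => if b = t.1 then 1 else 0))

/-- Allows the rows to be formed once over `ℂ[s]` and then specialised at every parameter. -/
lemma flagRows_map {R R' : Type*} [CommRing R] [CommRing R'] (φ : R →+* R') (δ : Fin n → ℤ) (N : ℕ)
    (C : Matrix (KLoop p) (KLoop p) R) (a : Matrix (KLoop p) (Fin n) R) :
    (flagRows δ N C a).map φ = flagRows δ N (C.map φ) (a.map φ) := by
  ext (L | t) b
  · have : ∀ k, (C.map φ ^ k * a.map φ : Matrix (KLoop p) (Fin n) R') L b.1 =
        φ ((C ^ k * a : Matrix (KLoop p) (Fin n) R) L b.1) := fun k => by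
      rw [← Matrix.map_pow, ← Matrix.map_mul]
      rfl
    simp only [flagRows, Matrix.map_apply, Matrix.of_apply, Sum.elim_inl, this]
    split_ifs
    · rfl
    · exact map_zero φ
  · simp only [flagRows, Matrix.map_apply, Matrix.of_apply, Sum.elim_inr]
    split_ifs
    · exact map_one φ
    · exact map_zero φ

variable {C C' : Matrix (KLoop p) (KLoop p) ℂ} {a a' : Matrix (KLoop p) (Fin n) ℂ}

lemma flagRows_inl {δ : Fin n → ℤ} {N : ℕ} (h : IsFlagData C a) (L : KLoop p) :
    flagRows δ N C a (Sum.inl L) = rho n N (psi δ (flagVec C a L)) := by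
  ext b
  rw [rho_apply, psi_apply, coeff_psi1, h.coeff_flagVec]
  rfl

lemma flagRows_inr {δ : Fin n → ℤ} {N : ℕ} (t : {b : Box n N // -δ b.1 ≤ (b.2 : ℤ)}) :
    flagRows δ N C a (Sum.inr t) = Pi.single t.1 1 := by
  ext b
  rw [Pi.single_apply]
  rfl

lemma sigma_single {N : ℕ} (b : Box n N) : sigma n N (Pi.single b 1) = tvec b.1 (b.2 : ℤ) := by
  rw [sigma_apply, Finset.sum_eq_single b]
  · rw [Pi.single_eq_same, one_smul]
  · intro b' _ hb'
    rw [Pi.single_eq_of_ne hb', zero_smul]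
  · simp

lemma span_flagRows (δ : Fin n → ℤ) (N : ℕ) (h : IsFlagData C a) :
    Submodule.span ℂ (Set.range (flagRows δ N C a)) = (flagLat δ h).space.map (rho n N) := by
  apply le_antisymm
  · rw [Submodule.span_le]
    rintro _ ⟨L | t, rfl⟩
    · rw [flagRows_inl h]
      refine Submodule.mem_map_of_mem ?_
      rw [flagLat_space, Submodule.mem_comap, phi_psi]
      exact Submodule.subset_span ⟨L, rfl⟩
    · rw [flagRows_inr, ← rho_sigma (Pi.single t.1 1), sigma_single]
      refine Submodule.mem_map_of_mem ?_
      rw [flagLat_space, Submodule.mem_comap, LinearMap.mem_ker.mp (tvec_mem_ker_phi.mpr t.2)]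
      exact zero_mem _
  · rintro _ ⟨x, hx, rfl⟩
    rw [SetLike.mem_coe, flagLat_space, Submodule.mem_comap] at hx
    have h1 : (Submodule.span ℂ (Set.range (flagVec C a))).map (rho n N ∘ₗ psi δ) ≤
        Submodule.span ℂ (Set.range (flagRows δ N C a)) := by
      rw [Submodule.map_span_le]
      rintro _ ⟨L, rfl⟩
      refine Submodule.subset_span ⟨Sum.inl L, ?_⟩
      rw [flagRows_inl h]
      rfl
    have h2 : x - psi δ (phi δ x) ∈ LinearMap.ker (phi δ) := by
      rw [LinearMap.mem_ker, map_sub, phi_psi, sub_self]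
    have h3 : rho n N (x - psi δ (phi δ x)) ∈ Submodule.span ℂ (Set.range (flagRows δ N C a)) := by
      have e : rho n N (x - psi δ (phi δ x)) = ∑ b, rho n N (x - psi δ (phi δ x)) b •
          (Pi.single b 1 : Box n N → ℂ) := by
        ext b
        rw [Finset.sum_apply, Finset.sum_eq_single b]
        · simp
        · intro b' _ hb'
          simp [hb'.symm]
        · simp
      rw [e]
      refine Submodule.sum_mem _ fun b _ => ?_
      by_cases hb : -δ b.1 ≤ (b.2 : ℤ)
      · refine Submodule.smul_mem _ _ (Submodule.subset_span ⟨Sum.inr ⟨b, hb⟩, ?_⟩)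
        rw [flagRows_inr]
      · rw [rho_apply, mem_ker_phi.mp h2 b.1 b.2 (by omega), zero_smul]
        exact zero_mem _
    have h4 := add_mem (h1 ⟨_, hx, rfl⟩) h3
    rwa [LinearMap.comp_apply, ← map_add, add_sub_cancel] at h4

/-- The map `phi δ ∘ sigma` kills the unit rows of `Y_0` and returns the flag vectors from the
others, so the two groups of rows are independent of each other. -/
lemma linearIndependent_flagRows {δ : Fin n → ℤ} {N : ℕ} (h : IsFlagData C a)
    (h1 : tX₀ n N ≤ LinearMap.ker (phi δ)) (h2 : (flagLat δ h).space ≤ tX₀ n (-(N : ℤ)))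
    (hli : LinearIndependent ℂ (flagVec C a)) : LinearIndependent ℂ (flagRows δ N C a) := by
  have hv : ∀ w ∈ Submodule.span ℂ (Set.range (flagVec C a)),
      phi δ (sigma n N (rho n N (psi δ w))) = w := fun w hw => by
    have : psi δ w ∈ (flagLat δ h).space := by
      rwa [flagLat_space, Submodule.mem_comap, phi_psi]
    have := h1 (sub_sigma_rho_mem (h2 this))
    rw [LinearMap.mem_ker, map_sub, phi_psi, sub_eq_zero] at this
    exact this.symm
  have e : flagRows δ N C a = Sum.elim (fun L => rho n N (psi δ (flagVec C a L)))
      (fun t : {b : Box n N // -δ b.1 ≤ (b.2 : ℤ)} => Pi.single t.1 1) := by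
    refine funext fun q => ?_
    rcases q with L | t
    · exact flagRows_inl h L
    · exact flagRows_inr t
  rw [e]
  refine LinearIndependent.sum_type ?_ ?_ ?_
  · apply LinearIndependent.of_comp (phi δ ∘ₗ sigma n N)
    convert hli using 1
    ext1 L
    exact hv _ (Submodule.subset_span ⟨L, rfl⟩)
  · have e' : (fun t : {b : Box n N // -δ b.1 ≤ (b.2 : ℤ)} => (Pi.single t.1 1 : Box n N → ℂ)) =
        Pi.basisFun ℂ (Box n N) ∘ Subtype.val := by
      ext1 t
      simp
    rw [e']
    exact (Pi.basisFun ℂ (Box n N)).linearIndependent.comp _ Subtype.val_injective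
  · rw [Submodule.disjoint_def]
    intro v hv1 hv2
    have e1 : Submodule.span ℂ (Set.range fun L => rho n N (psi δ (flagVec C a L))) ≤
        (Submodule.span ℂ (Set.range (flagVec C a))).map (rho n N ∘ₗ psi δ) := by
      rw [Submodule.span_le]
      rintro _ ⟨L, rfl⟩
      exact ⟨_, Submodule.subset_span ⟨L, rfl⟩, rfl⟩
    have e2 : Submodule.span ℂ (Set.range fun t : {b : Box n N // -δ b.1 ≤ (b.2 : ℤ)} =>
        (Pi.single t.1 1 : Box n N → ℂ)) ≤ LinearMap.ker (phi δ ∘ₗ sigma n N) := by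
      rw [Submodule.span_le]
      rintro _ ⟨t, rfl⟩
      rw [SetLike.mem_coe, LinearMap.mem_ker, LinearMap.comp_apply, sigma_single]
      exact LinearMap.mem_ker.mp (tvec_mem_ker_phi.mpr t.2)
    obtain ⟨w, hw, rfl⟩ := e1 hv1
    have := e2 hv2
    rw [LinearMap.mem_ker, LinearMap.comp_apply, LinearMap.comp_apply, hv w hw] at this
    rw [this, map_zero]

/-- A change of the basis of `Y / t^N X_0` multiplies all Plücker coordinates by one determinant;
homogeneity makes nonvanishing independent of it. -/
lemma eval_ne_zero_of_eval_smul_ne_zero {σ : Type*} [Fintype σ] {f : MvPolynomial σ ℂ} {d : ℕ}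
    (hf : f.IsHomogeneous d) {r : ℂ} {v : σ → ℂ}
    (h : MvPolynomial.eval (fun i => r * v i) f ≠ 0) : MvPolynomial.eval v f ≠ 0 := by
  have : MvPolynomial.eval (fun i => r * v i) f = r ^ d * MvPolynomial.eval v f := by
    rw [MvPolynomial.eval_eq', MvPolynomial.eval_eq', Finset.mul_sum]
    refine Finset.sum_congr rfl fun m hm => ?_
    have hd : m.degree = d := by
      by_contra hne
      exact (MvPolynomial.mem_support_iff.mp hm) (hf.coeff_eq_zero hne)
    rw [Finsupp.degree_eq_sum] at hd
    simp only [mul_pow, Finset.prod_mul_distrib, Finset.prod_pow_eq_pow_sum, hd]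
    ring
  exact fun h0 => h (by rw [this, h0, mul_zero])

/-! ### Density -/

lemma flagRows_pencilAt (δ : Fin n → ℤ) (N : ℕ) (C C' : Matrix (KLoop p) (KLoop p) ℂ)
    (a a' : Matrix (KLoop p) (Fin n) ℂ) (s : ℂ) :
    flagRows δ N (pencilAt C C' s) (pencilAt a a' s) =
      (flagRows δ N (pencil C C') (pencil a a')).map (Polynomial.evalRingHom s) :=
  (flagRows_map _ δ N _ _).symm

/-- Along the line the Plücker coordinates are polynomials in the parameter, so `f` becomes one
polynomial `g`. The lattice at `s₀` shows that `g` is nonzero, and the exceptional good parameters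
are among its roots. -/
lemma finite_notMem_pluckerOpen {δ : Fin n → ℤ} {N : ℕ} (h : IsFlagData C a)
    (h' : IsFlagData C' a') (h1 : tX₀ n N ≤ LinearMap.ker (phi δ))
    (h2 : ∀ s, (flagLat δ (h.pencilAt h' s)).space ≤ tX₀ n (-(N : ℤ))) {k d : ℕ}
    {f : MvPolynomial (Fin k → Box n N) ℂ} (hf : f.IsHomogeneous d) {s₀ : ℂ}
    (hs₀ : s₀ ∈ goodParams C C' a a') (hmem : flagLat δ (h.pencilAt h' s₀) ∈ pluckerOpen n N k f) :
    {s | s ∈ goodParams C C' a a' ∧ flagLat δ (h.pencilAt h' s) ∉ pluckerOpen n N k f}.Finite := by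
  have hle : ∀ s, tX₀ n N ≤ (flagLat δ (h.pencilAt h' s)).space := fun s => h1.trans fun x hx => by
    rw [flagLat_space, Submodule.mem_comap, LinearMap.mem_ker.mp hx]
    exact zero_mem _
  have hli : ∀ s ∈ goodParams C C' a a',
      LinearIndependent ℂ (flagRows δ N (pencilAt C C' s) (pencilAt a a' s)) := fun s hs =>
    linearIndependent_flagRows (h.pencilAt h' s) h1 (h2 s)
      ((h.pencilAt h' s).isModelFlag hs).linearIndependent
  obtain ⟨A₀, hA₀, hYA₀, hne⟩ := hmem
  have hsp₀ := (eq_rowLattice_iff (hle s₀) (h2 s₀) A₀).mp hYA₀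
  rw [← span_flagRows] at hsp₀
  -- At `s₀` the rows of `A₀` and the flag rows are bases of the same space, so `k` is the number of
  -- flag rows.
  have hcard : Fintype.card (KLoop p ⊕ {b : Box n N // -δ b.1 ≤ (b.2 : ℤ)}) = k := by
    have e1 := finrank_span_eq_card hA₀
    have e2 := finrank_span_eq_card (hli s₀ hs₀)
    rw [Fintype.card_fin] at e1
    rw [← e2, ← hsp₀]
    exact e1
  set e : Fin k ≃ _ := (Fintype.equivFinOfCardEq hcard).symm
  set 𝒜 := (flagRows δ N (pencil C C') (pencil a a')).submatrix e id
  set A : ℂ → Matrix (Fin k) (Box n N) ℂ := fun s =>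
    (flagRows δ N (pencilAt C C' s) (pencilAt a a' s)).submatrix e id with hA
  have hA𝒜 : ∀ s, A s = 𝒜.map (Polynomial.evalRingHom s) := fun s => by
    rw [hA]
    simp only [flagRows_pencilAt]
    rfl
  have hspA : ∀ s, Submodule.span ℂ (Set.range (A s)) =
      Submodule.span ℂ (Set.range (flagRows δ N (pencilAt C C' s) (pencilAt a a' s))) := fun s => by
    congr 1
    exact e.surjective.range_comp (flagRows δ N (pencilAt C C' s) (pencilAt a a' s))
  set g : Polynomial ℂ := MvPolynomial.aeval (fun c => (𝒜.submatrix id c).det) f with hg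
  have heval : ∀ s, Polynomial.eval s g =
      MvPolynomial.eval (fun c => ((A s).submatrix id c).det) f := fun s => by
    rw [← Polynomial.coe_aeval_eq_eval, hg, MvPolynomial.comp_aeval_apply,
      ← MvPolynomial.coe_aeval_eq_eval]
    refine congrArg (fun v => MvPolynomial.aeval v f) (funext fun c => ?_)
    rw [hA𝒜, Polynomial.coe_aeval_eq_eval, ← Polynomial.coe_evalRingHom, RingHom.map_det]
    rfl
  have hg0 : g ≠ 0 := by
    intro h0
    have hex : ∀ r, ∃ G : Fin k → ℂ, ∀ b, A₀ r b = ∑ j, G j * A s₀ j b := fun r => by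
      have hr : A₀ r ∈ Submodule.span ℂ (Set.range (A s₀)) := by
        rw [hspA, ← hsp₀]
        exact Submodule.subset_span ⟨r, rfl⟩
      obtain ⟨G, hG⟩ := (Submodule.mem_span_range_iff_exists_fun ℂ).mp hr
      refine ⟨G, fun b => ?_⟩
      rw [← hG, Finset.sum_apply]
      rfl
    -- The matrix `A₀` that witnesses membership may come from another basis; it differs from the
    -- flag rows at `s₀` by a left factor `G`.
    obtain ⟨G, hG⟩ : ∃ G : Matrix (Fin k) (Fin k) ℂ, A₀ = G * A s₀ := by
      refine ⟨Matrix.of fun r => (hex r).choose, ?_⟩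
      ext r b
      exact (hex r).choose_spec b
    have hdet : (fun c : Fin k → Box n N => (A₀.submatrix id c).det) =
        fun c => G.det * ((A s₀).submatrix id c).det := by
      ext1 c
      rw [hG, ← Matrix.det_mul]
      rfl
    rw [hdet] at hne
    refine eval_ne_zero_of_eval_smul_ne_zero hf hne ?_
    rw [← heval, h0, Polynomial.eval_zero]
  refine (Polynomial.finite_setOfPred_isRoot hg0).subset ?_
  rintro s ⟨hs, hns⟩
  by_contra hroot
  refine hns ⟨A s, ?_, ?_, ?_⟩
  · exact (hli s hs).comp e e.injective
  · rw [eq_rowLattice_iff (hle s) (h2 s), hspA, span_flagRows]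
  · rw [← heval]
    exact hroot

/-- The nilpotency of `C` bounds the pole orders by the number of loops, so one `N` serves for all
flag data, in particular for a whole line. -/
lemma IsFlagData.exists_bounds (δ : Fin n → ℤ) (p : KostantPicture n) :
    ∃ N : ℕ, tX₀ n N ≤ LinearMap.ker (phi δ) ∧
      ∀ (C : Matrix (KLoop p) (KLoop p) ℂ) (a : Matrix (KLoop p) (Fin n) ℂ) (h : IsFlagData C a),
        (flagLat δ h).space ≤ tX₀ n (-(N : ℤ)) := by
  have hδ : ∀ i, (δ i).natAbs ≤ ∑ i, (δ i).natAbs := fun i =>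
    Finset.single_le_sum (f := fun i => (δ i).natAbs) (fun _ _ => Nat.zero_le _)
      (Finset.mem_univ i)
  refine ⟨Fintype.card (KLoop p) + 1 + ∑ i, (δ i).natAbs, ?_, fun C a h => ?_⟩
  · exact tX₀_le_comap_phi (fun i => by have := hδ i; omega) ⊥
  · refine comap_phi_le_tX₀ (m := Fintype.card (KLoop p) + 1) (fun i => by have := hδ i; omega) ?_
    rw [Submodule.span_le]
    rintro _ ⟨L, rfl⟩
    rw [SetLike.mem_coe, mem_boundedP]
    intro i k hk
    rw [h.coeff_flagVec, h.pow_eq_zero (by omega), Matrix.zero_mul, Matrix.zero_apply]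

/-- The line is continuous for the cofinite topology on the good parameters. Plücker conditions
generate the topology, and the property passes to finite intersections and arbitrary unions. -/
lemma finite_notMem_of_isOpen {δ : Fin n → ℤ} (h : IsFlagData C a) (h' : IsFlagData C' a')
    {O : Set (Lat n)} (hO : IsOpen O) {s₀ : ℂ} (hs₀ : s₀ ∈ goodParams C C' a a')
    (hmem : flagLat δ (h.pencilAt h' s₀) ∈ O) :
    {s | s ∈ goodParams C C' a a' ∧ flagLat δ (h.pencilAt h' s) ∉ O}.Finite := by
  obtain ⟨N, h1, h2⟩ := IsFlagData.exists_bounds δ p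
  set γ : ℂ → BoundedLat n N := fun s => ⟨flagLat δ (h.pencilAt h' s), h1.trans fun x hx => by
    rw [flagLat_space, Submodule.mem_comap, LinearMap.mem_ker.mp hx]
    exact zero_mem _, h2 _ _ _⟩
  have hON : TopologicalSpace.GenerateOpen _ ((Subtype.val : BoundedLat n N → Lat n) ⁻¹' O) :=
    isOpen_coinduced.mp (isOpen_iSup_iff.mp hO N)
  have key : ∀ U : Set (BoundedLat n N), TopologicalSpace.GenerateOpen
      {U | ∃ (k d : ℕ) (f : MvPolynomial (Fin k → Box n N) ℂ),
        f.IsHomogeneous d ∧ U = Subtype.val ⁻¹' pluckerOpen n N k f} U →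
      γ s₀ ∈ U → {s | s ∈ goodParams C C' a a' ∧ γ s ∉ U}.Finite := by
    intro U hU
    induction hU with
    | basic U hU =>
      obtain ⟨k, d, f, hf, rfl⟩ := hU
      exact finite_notMem_pluckerOpen h h' h1 (fun s => h2 _ _ _) hf hs₀
    | univ => simp
    | inter U V _ _ ihU ihV =>
      rintro ⟨hU, hV⟩
      refine ((ihU hU).union (ihV hV)).subset ?_
      rintro s ⟨hs, hn⟩
      by_cases hsU : γ s ∈ U
      · exact Or.inr ⟨hs, fun hsV => hn ⟨hsU, hsV⟩⟩
      · exact Or.inl ⟨hs, hsU⟩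
    | sUnion 𝒰 _ ih =>
      rintro ⟨U, hU, hmem⟩
      refine (ih U hU hmem).subset ?_
      rintro s ⟨hs, hn⟩
      exact ⟨hs, fun hsU => hn ⟨U, hU, hsU⟩⟩
  exact key _ hON hmem

/-- On the line through the data of `Y`, at `0`, and of `genericLat`, at `1`, all but finitely many
parameters are good, lie in the given neighbourhood of `Y`, and give strongly compatible lattices.
-/
lemma dense_MDDagger (p : KostantPicture n) (lam : Fin n → ℤ) :
    Dense {Y : ↥(MDagger p lam) | Y.1 ∈ MDDagger p lam} := by
  rw [dense_iff_inter_open]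
  rintro U hU ⟨Y, hYU⟩
  obtain ⟨O, hO, rfl⟩ := isOpen_induced_iff.mp hU
  -- `O'` is an open set of the whole Grassmannian that cuts out the strongly compatible locus, so
  -- it can be tested along the line like `O`.
  obtain ⟨O', hO', hOO'⟩ := isOpen_induced_iff.mp (isOpen_MDDagger p lam)
  obtain ⟨Y, hY⟩ := Y
  obtain ⟨z, hz⟩ := compatible_iff.mp hY.2
  obtain ⟨z', hz'⟩ := compatible_iff.mp (genericLat_mem p lam).1.2
  obtain ⟨C, a, h, rfl⟩ := hz.exists_isFlagData
  obtain ⟨C', a', h', rfl⟩ := hz'.exists_isFlagData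
  set δ : Fin n → ℤ := fun i => lam i - p.leftEnds i with hδ
  have e0 : flagLat δ (h.pencilAt h' 0) = Y := by
    have := eq_flagLat h hz
    rw [delta_eq_of_mem_M hY.1] at this
    conv_rhs => rw [this]
    congr 1 <;> exact pencilAt_zero _ _
  have e1 : flagLat δ (h.pencilAt h' 1) = genericLat p lam := by
    have := eq_flagLat h' hz'
    rw [delta_genericLat] at this
    conv_rhs => rw [this]
    congr 1 <;> exact pencilAt_one _ _
  have g0 : (0 : ℂ) ∈ goodParams C C' a a' := fun L i hi => by
    rw [pencilAt_zero, pencilAt_zero, ← h.coeff_flagVec]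
    exact hz.coeff_ne L i hi
  have g1 : (1 : ℂ) ∈ goodParams C C' a a' := fun L i hi => by
    rw [pencilAt_one, pencilAt_one, ← h'.coeff_flagVec]
    exact hz'.coeff_ne L i hi
  have f0 := finite_notMem_of_isOpen h h' hO g0 (δ := δ) (by rw [e0]; exact hYU)
  have f1 := finite_notMem_of_isOpen h h' hO' g1 (δ := δ) (by
    rw [e1]
    have : (⟨genericLat p lam, (genericLat_mem p lam).1⟩ : ↥(MDagger p lam)) ∈
        Subtype.val ⁻¹' O' := by
      rw [hOO']
      exact genericLat_mem p lam
    exact this)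
  -- As `ℂ` is infinite, some parameter avoids the three finite exceptional sets.
  obtain ⟨s, hs⟩ := (((finite_compl_goodParams g0).union (f0.union f1)).infinite_compl).nonempty
  simp only [Set.mem_compl_iff, Set.mem_union, not_or, not_not] at hs
  obtain ⟨hs, hs0, hs1⟩ := hs
  have hm := flagLat_mem_MDagger (h.pencilAt h' s) hs lam
  refine ⟨⟨flagLat δ (h.pencilAt h' s), hm⟩, ?_, ?_⟩
  · by_contra hn
    exact hs0 ⟨hs, hn⟩
  · rw [← hOO']
    by_contra hn
    exact hs1 ⟨hs, hn⟩

end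

end LoopGrassmannian

end

theorem mainTheorem7 (n : ℕ) (p : LoopGrassmannian.KostantPicture n) (lam : Fin n → ℤ) :
    LoopGrassmannian.MDDagger p lam ⊆ LoopGrassmannian.MDagger p lam ∧
    IsOpen {Y : ↥(LoopGrassmannian.MDagger p lam) | Y.1 ∈ LoopGrassmannian.MDDagger p lam} ∧
    Dense {Y : ↥(LoopGrassmannian.MDagger p lam) | Y.1 ∈ LoopGrassmannian.MDDagger p lam} ∧
    (LoopGrassmannian.MDDagger p lam).Nonempty :=
  ⟨fun _ hY => hY.1, LoopGrassmannian.isOpen_MDDagger p lam, LoopGrassmannian.dense_MDDagger p lam,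
    _, LoopGrassmannian.genericLat_mem p lam⟩
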